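/- Let $\mathbf F$ be a field. Let $\mathcal E$ be the reduced Barratt–Eccles operad over $\mathbf F$: $\mathcal E(0)=0$, and for $r\ge 1$, $\mathcal E(r)$ is the normalized chain complex of the homogeneous bar construction of the symmetric group $\Sigma_r$, spanned by the simplices $(w_0,\dots,w_n)$, $w_i\in\Sigma_r$, with diagonal $\Delta(w_0,\dots,w_n)=\sum_k(w_0,\dots,w_k)\otimes(w_k,\dots,w_n)$. ($\mathcal E$-algebras are the augmentation ideals of augmented algebras over the unreduced operad.) Let $\epsilon_r:\mathcal E(r)_{r-1}\to\mathbf F$ be the cocycle whose value on $(w_0,\dots,w_{r-1})$ is the signature of $(w_0(1),\dots,w_{r-1}(1))$ if this sequence is a permutation of $(1,\dots,r)$, and $0$ otherwise, and let $\epsilon_r\cap\rho=\sum\epsilon_r(\rho_{(1)})\rho_{(2)}$, where $\Delta(\rho)=\sum\rho_{(1)}\otimes\rho_{(2)}$. For a dg-module $A$, the suspension $\Sigma^*A$ is given by $(\Sigma^*A)^n=A^{n-1}$. Let $\Lambda^*\mathcal E$ be the suspension of the operad $\mathcal E$, with $\Lambda^*\mathcal E(r)_*=\operatorname{sgn}(r)\otimes\mathcal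 E(r)_{*-r+1}$, for which the $\Lambda^*\mathcal E$-algebras are the suspensions $\Sigma^*A$ of the $\mathcal E$-algebras $A$. For an $\mathcal E$-algebra $A$, the dg-module $\Sigma^*A$ is also an $\mathcal E$-algebra, namely $\operatorname{Hom}_{\mathbf F}(\tilde N_*(S^1),A)$, where $\tilde N_*(S^1)=\mathbf F e_1$ is the reduced chain coalgebra of the circle, with co-operations $\rho^*(e_1)=\epsilon_r(\rho)\,e_1^{\otimes r}$; so $\rho(\Sigma^*a_1,\dots,\Sigma^*a_r)=\pm\Sigma^*\big((\epsilon_r\cap\rho)(a_1,\dots,a_r)\big)$, where $\pm$ is the Koszul sign. A loop algebra $\Omega^*A$ of an $\mathcal E$-algebra $A$ is an $\mathcal E$-algebra with a morphism $\eta:A\to\Sigma^*\Omega^*A$ of $\mathcal E$-algebras that induces a bijection $\operatorname{Hom}_{\mathcal E}(\Omega^*A,B)\cong\operatorname{Hom}_{\mathcal E}(A,\Sigma^*B)$ for every $\mathcal E$-algebra $B$. For an operad $P$ and a dg-module $V$, an almost free $P$-algebra on $V$, determined by a homogeneous morphism $h:V\to P(V)$ of degree $1$, is the free graded $P$-algebra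 $P(V)$ equipped with a differential $\delta_h$ of degree $1$ that satisfies the derivation relation with respect to the operations (including the differential of $P$) and $\delta_h(v)=\delta(v)+h(v)$ for $v\in V$. **Proposition.** Let $F=(\mathcal E(V),\delta_h)$ be an almost free $\mathcal E$-algebra, determined by $h:V\to\mathcal E(V)$. 1. There is a unique linear map $\kappa:\mathcal E(V)\to\Lambda^*\mathcal E(V)$ such that $\kappa(\rho(v_1,\dots,v_r))=(\epsilon_r\cap\rho)(v_1,\dots,v_r)$ for all $\rho\in\mathcal E(r)$ and $v_1,\dots,v_r\in V$. 2. There is a unique differential $\delta'$ on $\Lambda^*\mathcal E(V)$ which makes it an almost free $\Lambda^*\mathcal E$-algebra determined by the composite $V\xrightarrow{h}\mathcal E(V)\xrightarrow{\kappa}\Lambda^*\mathcal E(V)$. 3. $F$ has a loop algebra $\Omega^*F$, and for every loop algebra $(\Omega^*F,\eta)$ of $F$ there is a unique isomorphism of $\Lambda^*\mathcal E$-algebras $\Psi:\Sigma^*\Omega^*F\to(\Lambda^*\mathcal E(V),\delta')$ such that $\Psi\circ\eta=\kappa$. In particular $\Psi(\eta(v))=v$ for $v\in V$. -/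

import Mathlib

open Finset CategoryTheory

universe u

noncomputable section

namespace LoopAlgebra

/-! ### Operads given on homogeneous bases -/

/-- The structure maps of a differential graded symmetric operad over `F`, written on homogeneous
bases: the arity `r` component is the free module `ι r →₀ F`, and the basis element `x` has
(lower) degree `deg x`.  The composition products are recorded through the partial composites
`comp i x y = x ∘ᵢ y = x(1, …, 1, y, 1, …, 1)`, with `y` in the slot `i` (slots are numbered
from `0`). -/
structure OperadData (F : Type u) [Field F] where
  ι : ℕ → Type
  deg : ∀ {r : ℕ}, ι r → ℤ
  d : ∀ {r : ℕ}, ι r → (ι r →₀ F)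
  act : ∀ {r : ℕ}, Equiv.Perm (Fin r) → ι r → (ι r →₀ F)
  one : ι 1
  comp : ∀ {r s : ℕ}, Fin (r + 1) → ι (r + 1) → ι s → (ι (r + s) →₀ F)
  deg_d : ∀ {r : ℕ} (x : ι r), d x ∈ Finsupp.supported F F {y | deg y = deg x - 1}
  deg_act : ∀ {r : ℕ} (g : Equiv.Perm (Fin r)) (x : ι r),
    act g x ∈ Finsupp.supported F F {y | deg y = deg x}
  deg_one : deg one = 0
  deg_comp : ∀ {r s : ℕ} (i : Fin (r + 1)) (x : ι (r + 1)) (y : ι s),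
    comp i x y ∈ Finsupp.supported F F {z | deg z = deg x + deg y}

/-- The underlying module of the arity `r` component. -/
abbrev OperadData.obj {F : Type u} [Field F] (P : OperadData F) (r : ℕ) : Type u := P.ι r →₀ F

/-- The position, among `r + s` inputs, of the inputs of a partial composite: the summand `Fin s`
is the block substituted in the slot `i`, and `Fin r` stands for the other slots, in order. -/
def slotEquiv {r s : ℕ} (i : Fin (r + 1)) : Fin r ⊕ Fin s ≃ Fin (r + s) where
  toFun := Sum.elim
    (fun y => if y.val < i.val then ⟨y.val, by omega⟩ else ⟨y.val + s, by omega⟩)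
    (fun k => ⟨i.val + k.val, by omega⟩)
  invFun x :=
    if h₁ : x.val < i.val then Sum.inl ⟨x.val, by omega⟩
    else if h₂ : x.val < i.val + s then Sum.inr ⟨x.val - i.val, by omega⟩
    else Sum.inl ⟨x.val - s, by omega⟩
  left_inv := by
    rintro (y | k)
    · by_cases h : y.val < i.val
      · simp [h]
      · have h₁ : ¬ (y.val + s < i.val) := by omega
        have h₂ : ¬ (y.val + s < i.val + s) := by omega
        simp [h, h₁]
    · simp
  right_inv := by
    intro x
    by_cases h₁ : x.val < i.val
    · simp [h₁]
    · by_cases h₂ : x.val < i.val + s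
      · simp only [h₁, h₂, dite_true, dite_false, Sum.elim_inr]
        ext
        simp only
        omega
      · have h₃ : ¬ (x.val - s < i.val) := by omega
        simp only [h₁, h₂, dite_false, Sum.elim_inl, h₃, if_false]
        ext
        simp only
        omega

/-- The Koszul sign of the reordering `(a₁, …, a_r) ↦ (a_{g(1)}, …, a_{g(r)})`, where `n i` is the
degree of `aᵢ`. -/
def koszulSign {r : ℕ} (g : Equiv.Perm (Fin r)) (n : Fin r → ℤ) : ℤˣ :=
  ∏ p : Fin r × Fin r with p.1 < p.2 ∧ g p.2 < g p.1, (n (g p.1) * n (g p.2)).negOnePow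

/-! ### The reduced Barratt-Eccles operad -/

/-- The nondegenerate simplices `(w₀, …, w_n)` of the homogeneous bar construction of the symmetric
group on `r` letters.  There are none in arity `0`, since the operad is reduced. -/
def Simplex (r : ℕ) : Type :=
  {w : List (Equiv.Perm (Fin r)) // r ≠ 0 ∧ w ≠ [] ∧ w.IsChain (· ≠ ·)}

/-- The dimension of a simplex. -/
def Simplex.dim {r : ℕ} (w : Simplex r) : ℤ := (w.1.length : ℤ) - 1

section BarrattEccles

variable (F : Type u) [Field F]

open Classical in
/-- The class of a simplex `(w₀, …, w_n)` in the normalized chain complex: degenerate simplices are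
zero. -/
def chain {r : ℕ} (w : List (Equiv.Perm (Fin r))) : Simplex r →₀ F :=
  if h : r ≠ 0 ∧ w ≠ [] ∧ w.IsChain (· ≠ ·) then Finsupp.single ⟨w, h⟩ 1 else 0

/-- The differential `∑ᵢ (-1)ⁱ (w₀, …, ŵᵢ, …, w_n)`. -/
def beD {r : ℕ} (w : Simplex r) : Simplex r →₀ F :=
  ∑ i ∈ range w.1.length, (i : ℤ).negOnePow • chain F (w.1.eraseIdx i)

/-- The diagonal left action `g (w₀, …, w_n) = (g w₀, …, g w_n)`. -/
def beAct {r : ℕ} (g : Equiv.Perm (Fin r)) (w : Simplex r) : Simplex r →₀ F :=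
  chain F (w.1.map (g * ·))

/-- Substitution of permutations.  A permutation `w` is thought of as the word
`(w(1), …, w(r))`; in this word the letter `i` is replaced by the word of `u`, on the block of
letters of the slot `i`. -/
def permComp {r s : ℕ} (i : Fin (r + 1)) (w : Equiv.Perm (Fin (r + 1))) (u : Equiv.Perm (Fin s)) :
    Equiv.Perm (Fin (r + s)) :=
  (slotEquiv (w.symm i)).symm.trans
    ((Equiv.sumCongr
      ((finSuccAboveEquiv (w.symm i)).trans
        ((w.subtypeEquiv fun _ => not_congr (Equiv.eq_symm_apply w)).trans
          (finSuccAboveEquiv i).symm)) u).trans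
      (slotEquiv i))

/-- The Eilenberg-Zilber (shuffle) product of an `n`-simplex `(x₀, …, x_n)` and of an `m`-simplex
`(y₀, …, y_m)`: the signed sum over the lattice paths from `(0, 0)` to `(n, m)`.  The sign is that
of the shuffle, a step in the second direction being moved past the remaining steps in the first
direction. -/
def shuffle {α β : Type} : List α → List β → (List (α × β) →₀ ℤ)
  | [], _ => 0
  | _ :: _, [] => 0
  | [x], [y] => Finsupp.single [(x, y)] 1
  | x :: xs, y :: ys =>
      (shuffle xs (y :: ys) + (xs.length : ℤ).negOnePow • shuffle (x :: xs) ys).mapDomain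
        (List.cons (x, y))
termination_by xs ys => xs.length + ys.length

/-- The partial composite of simplices: levelwise substitution of permutations along the
Eilenberg-Zilber product. -/
def beComp {r s : ℕ} (i : Fin (r + 1)) (w : Simplex (r + 1)) (u : Simplex s) :
    Simplex (r + s) →₀ F :=
  (shuffle w.1 u.1).sum fun l c => c • chain F (l.map fun p => permComp i p.1 p.2)

lemma chain_mem {r : ℕ} (w : List (Equiv.Perm (Fin r))) :
    chain F w ∈ Finsupp.supported F F {y : Simplex r | y.1.length = w.length} := by
  unfold chain
  split_ifs with h
  · exact Finsupp.single_mem_supported F 1 rfl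
  · exact Submodule.zero_mem _

lemma units_smul_mem {M : Type*} [AddCommGroup M] [Module F M] (p : Submodule F M) (e : ℤˣ) {x : M}
    (hx : x ∈ p) : e • x ∈ p := by
  rcases Int.units_eq_one_or e with rfl | rfl
  · simpa using hx
  · simpa using hx

lemma shuffle_length {α β : Type} (xs : List α) (ys : List β) :
    ∀ l ∈ (shuffle xs ys).support, l.length + 1 = xs.length + ys.length := by
  classical
  induction xs, ys using shuffle.induct with
  | case1 => simp [shuffle]
  | case2 => simp [shuffle]
  | case3 x y =>
    intro l hl
    rw [shuffle] at hl
    have := Finsupp.support_single_subset hl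
    simp only [Finset.mem_singleton] at this
    simp [this]
  | case4 x xs y ys hne ih₁ ih₂ =>
    intro l hl
    rw [shuffle] at hl
    · have h₁ := Finsupp.mapDomain_support hl
      obtain ⟨l', hl', rfl⟩ := Finset.mem_image.1 h₁
      rcases Finset.mem_union.1 (Finsupp.support_add hl') with h | h
      · have := ih₁ l' h
        simp only [List.length_cons] at this ⊢
        omega
      · have h' : l' ∈ (shuffle (x :: xs) ys).support := by
          rcases Int.units_eq_one_or (xs.length : ℤ).negOnePow with e | e
          · simpa [e] using h
          · simpa [e] using h
        have := ih₂ l' h'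
        simp only [List.length_cons] at this ⊢
        omega
    · exact hne

/-- The reduced Barratt-Eccles operad: the normalized chains on the homogeneous bar constructions of
the symmetric groups, with the arity `0` component replaced by `0`. -/
def barrattEccles : OperadData F where
  ι := Simplex
  deg := Simplex.dim
  d := beD F
  act := beAct F
  one := ⟨[1], by simp⟩
  comp := beComp F
  deg_d := by
    intro r w
    refine Submodule.sum_mem _ fun i hi => units_smul_mem F _ _ ?_
    refine Finsupp.supported_mono ?_ (chain_mem F _)
    intro y hy
    have h := List.length_eraseIdx_of_lt (Finset.mem_range.1 hi)
    have h' := List.length_pos_of_ne_nil w.2.2.1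
    simp only [Set.mem_ofPred_eq, Simplex.dim] at hy ⊢
    omega
  deg_act := by
    intro r g w
    refine Finsupp.supported_mono ?_ (chain_mem F _)
    intro y hy
    simp only [Set.mem_ofPred_eq, Simplex.dim, List.length_map] at hy ⊢
    omega
  deg_one := by simp [Simplex.dim]
  deg_comp := by
    intro r s i w u
    refine Submodule.sum_mem _ fun l hl => ?_
    refine zsmul_mem ?_ _
    refine Finsupp.supported_mono ?_ (chain_mem F _)
    intro y hy
    have h := shuffle_length _ _ l hl
    simp only [Set.mem_ofPred_eq, Simplex.dim, List.length_map] at hy ⊢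
    omega

end BarrattEccles

/-! ### The cocycles `ε_r` and the cap product -/

open Classical in
/-- The cochain `ε_r` on the simplex `(w₀, …, w_d)`: it vanishes unless `d = r - 1` and
`(w₀(1), …, w_d(1))` is a permutation of `(1, …, r)`, and is the signature of this permutation in
that case. -/
def epsilon {r : ℕ} (w : List (Equiv.Perm (Fin r))) : ℤ :=
  if h : w.length = r then
    if hf : Function.Bijective fun k : Fin r => (w.get (k.cast h.symm)) ⟨0, k.pos⟩ then
      Equiv.Perm.sign (Equiv.ofBijective _ hf)
    else 0
  else 0

/-- The cap product `ε_r ∩ (w₀, …, w_n) = ∑ₖ ε_r(w₀, …, w_k) (w_k, …, w_n)`, which comes from the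
diagonal `Δ(w₀, …, w_n) = ∑ₖ (w₀, …, w_k) ⊗ (w_k, …, w_n)`. -/
def cap (F : Type u) [Field F] {r : ℕ} (w : Simplex r) : Simplex r →₀ F :=
  ∑ k ∈ range w.1.length, epsilon (w.1.take (k + 1)) • chain F (w.1.drop k)

/-! ### The suspension of an operad -/

/-- The operadic suspension `Λ^*P`, with `Λ^*P(r)_* = sgn(r) ⊗ P(r)_{*-r+1}`: the basis element `x`
of `P(r)` has degree `deg x + r - 1` in `Λ^*P(r)`, and the action is twisted by the signature.
The signs of the differential and of the composites are those for which the `Λ^*P`-algebras are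
the suspensions of the `P`-algebras, see `GradedOps.suspension`. -/
def OperadData.suspension {F : Type u} [Field F] (P : OperadData F) : OperadData F where
  ι := P.ι
  deg {r} x := P.deg x + (r - 1)
  d {r} x := ((r : ℤ) - 1).negOnePow • P.d x
  act g x := Equiv.Perm.sign g • P.act g x
  one := P.one
  comp {r s} i x y := (((s : ℤ) - 1) * (P.deg x + r - i.val)).negOnePow • P.comp i x y
  deg_d x := units_smul_mem F _ _ (Finsupp.supported_mono (by
    intro y hy
    simp only [Set.mem_ofPred_eq] at hy ⊢
    omega) (P.deg_d x))
  deg_act g x := units_smul_mem F _ _ (Finsupp.supported_mono (by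
    intro y hy
    simp only [Set.mem_ofPred_eq] at hy ⊢
    omega) (P.deg_act g x))
  deg_one := by simp [P.deg_one]
  deg_comp i x y := units_smul_mem F _ _ (Finsupp.supported_mono (by
    intro z hz
    simp only [Set.mem_ofPred_eq] at hz ⊢
    push_cast
    omega) (P.deg_comp i x y))

/-! ### Algebras over an operad -/

section Algebras

variable {F : Type u} [Field F] (P : OperadData F)

/-- A (upper) graded module `A` together with a multilinear operation `A^{⊗ r} → A` for each element
of `P(r)`.  The laws are stated in `GradedOps.IsAlgebra`. -/
structure GradedOps (A : Type u) [AddCommGroup A] [Module F A] where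
  gr : ℤ → Submodule F A
  internal : DirectSum.IsInternal gr
  op : ∀ {r : ℕ}, P.ι r → MultilinearMap F (fun _ : Fin r => A) A

variable {P} {A B : Type u} [AddCommGroup A] [Module F A] [AddCommGroup B] [Module F B]

/-- The operation associated to an arbitrary element of `P(r)`. -/
def GradedOps.eval (X : GradedOps P A) {r : ℕ} (ρ : P.obj r) :
    MultilinearMap F (fun _ : Fin r => A) A :=
  Finsupp.linearCombination F (fun x : P.ι r => X.op x) ρ

/-- The laws of a graded `P`-algebra: an operation of lower degree `d` lowers the upper degree by
`d`, the unit acts by the identity, `(gρ)(a₁, …, a_r) = ± ρ(a_{g(1)}, …, a_{g(r)})`, and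
`(ρ ∘ᵢ σ)(a₁, …) = ± ρ(a₁, …, σ(aᵢ, …), …)`. -/
structure GradedOps.IsAlgebra (X : GradedOps P A) : Prop where
  op_mem : ∀ {r : ℕ} (x : P.ι r) (a : Fin r → A) (n : Fin r → ℤ), (∀ i, a i ∈ X.gr (n i)) →
    X.op x a ∈ X.gr (∑ i, n i - P.deg x)
  op_one : ∀ a : A, X.op P.one (fun _ => a) = a
  op_act : ∀ {r : ℕ} (g : Equiv.Perm (Fin r)) (x : P.ι r) (a : Fin r → A) (n : Fin r → ℤ),
    (∀ i, a i ∈ X.gr (n i)) →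
    X.eval (P.act g x) a = koszulSign g n • X.op x (fun i => a (g i))
  op_comp : ∀ {r s : ℕ} (i : Fin (r + 1)) (x : P.ι (r + 1)) (y : P.ι s) (a : Fin (r + s) → A)
    (n : Fin (r + s) → ℤ), (∀ k, a k ∈ X.gr (n k)) →
    X.eval (P.comp i x y) a =
      (P.deg y * ∑ k : Fin (r + s) with k.val < i.val, n k).negOnePow •
        X.op x (i.insertNth (α := fun _ => A) (X.op y fun k => a (slotEquiv i (Sum.inr k)))
          fun k => a (slotEquiv i (Sum.inl k)))

/-- `d` is a differential of degree `1` on the graded `P`-algebra `X`, compatible with the operations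
and with the differential of the operad:
`d(ρ(a₁, …, a_r)) = (dρ)(a₁, …, a_r) + ∑ᵢ ± ρ(a₁, …, d aᵢ, …, a_r)`. -/
structure GradedOps.IsDifferential (X : GradedOps P A) (d : A →ₗ[F] A) : Prop where
  mem : ∀ (n : ℤ) (a : A), a ∈ X.gr n → d a ∈ X.gr (n + 1)
  sq : ∀ a : A, d (d a) = 0
  leibniz : ∀ {r : ℕ} (x : P.ι r) (a : Fin r → A) (n : Fin r → ℤ), (∀ i, a i ∈ X.gr (n i)) →
    d (X.op x a) = X.eval (P.d x) a +
      ∑ i : Fin r, (P.deg x + ∑ j : Fin r with j < i, n j).negOnePow •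
        X.op x (Function.update a i (d (a i)))

/-- `(X, d)` is a (differential graded) `P`-algebra. -/
def GradedOps.IsDGAlgebra (X : GradedOps P A) (d : A →ₗ[F] A) : Prop :=
  X.IsAlgebra ∧ X.IsDifferential d

/-- `f` is a morphism of `P`-algebras `(X, dX) → (Y, dY)`: it preserves degrees, and commutes with
the operations and with the differentials. -/
structure IsDGHom (X : GradedOps P A) (dX : A →ₗ[F] A) (Y : GradedOps P B) (dY : B →ₗ[F] B)
    (f : A →ₗ[F] B) : Prop where
  mem : ∀ (n : ℤ) (a : A), a ∈ X.gr n → f a ∈ Y.gr n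
  op : ∀ {r : ℕ} (x : P.ι r) (a : Fin r → A), f (X.op x a) = Y.op x (fun i => f (a i))
  d : ∀ a : A, f (dX a) = dY (f a)

/-! ### Suspension of algebras -/

/-- The linear map which multiplies the elements of degree `n` by `(-1)ⁿ`. -/
def parity (gr : ℤ → Submodule F A) (h : DirectSum.IsInternal gr) : A →ₗ[F] A :=
  letI := h.chooseDecomposition
  (DirectSum.toModule F ℤ A fun n => (n.negOnePow : ℤ) • (gr n).subtype) ∘ₗ
    (DirectSum.decomposeLinearEquiv gr).toLinearMap

lemma internal_shift (gr : ℤ → Submodule F A) (h : DirectSum.IsInternal gr) :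
    DirectSum.IsInternal fun n => gr (n - 1) := by
  rw [DirectSum.isInternal_submodule_iff_iSupIndep_and_iSup_eq_top] at h ⊢
  refine ⟨h.1.comp (f := fun n : ℤ => n - 1) fun a b hab => by simpa using hab, ?_⟩
  rw [← h.2]
  exact (Equiv.subRight (1 : ℤ)).iSup_congr fun _ => rfl

/-- The suspension `Σ^*A` as an algebra over the suspended operad `Λ^*P`.  It has the same underlying
module as `A`, with `(Σ^*A)ⁿ = Aⁿ⁻¹`.  If we write `Σa` for `a` regarded as an element of `Σ^*A`,
then `x ∈ P(r)`, regarded as an element of `Λ^*P(r)`, acts by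
`x(Σa₁, …, Σa_r) = (-1)^{(r-1) deg x + ∑ⱼ (r-j) deg(Σaⱼ)} Σ x(a₁, …, a_r)`.
The differential of `Σ^*A` is `Σa ↦ Σ(δa)`. -/
def GradedOps.suspension (X : GradedOps P A) : GradedOps P.suspension A where
  gr n := X.gr (n - 1)
  internal := internal_shift X.gr X.internal
  op {r} x := (((r : ℤ) - 1) * P.deg x).negOnePow •
    (X.op (r := r) x).compLinearMap fun j =>
      parity (fun n => X.gr (n - 1)) (internal_shift X.gr X.internal) ^ (r - 1 - j.val)

/-- The suspension algebra `Σ^*A` of an algebra over the reduced Barratt-Eccles operad, that is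
`Hom(K, A)`, where `K = F e₁` is the reduced chain coalgebra of the circle, with `deg e₁ = 1` and
co-operations `ρ^*(e₁) = ε_r(ρ) e₁^{⊗ r}`.  The element `Σa` is the map `e₁ ↦ a`, of upper degree
`deg a + 1`.  For `Δ(ρ) = ∑ ρ' ⊗ ρ''` the operation `ρ` of `Hom(K, A)` is
`ρ(u₁, …, u_r) = ∑ ± ρ'' ∘ (u₁ ⊗ ⋯ ⊗ u_r) ∘ ρ'^*`, hence
`ρ(Σa₁, …, Σa_r) = ∑ ± ε_r(ρ') Σ ρ''(a₁, …, a_r)`,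
the sum of the terms with `ρ' = (w₀, …, w_k)` and `ρ'' = (w_k, …, w_n)` for `ρ = (w₀, …, w_n)`.
The Koszul sign has exponent `deg ρ' deg ρ'' + deg ρ' ∑ⱼ deg uⱼ + ∑ⱼ (j-1) deg uⱼ`: the operation
`ρ'` is moved past `ρ''` and `u₁, …, u_r`, and `uⱼ` is moved past `j-1` factors `e₁`. -/
def GradedOps.suspensionAlgebra (X : GradedOps (barrattEccles F) A) :
    GradedOps (barrattEccles F) A where
  gr n := X.gr (n - 1)
  internal := internal_shift X.gr X.internal
  op {_} w := ∑ k ∈ range w.1.length, ((k : ℤ) * (w.dim - k)).negOnePow •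
    epsilon (w.1.take (k + 1)) • (X.eval (chain F (w.1.drop k))).compLinearMap fun j =>
      parity (fun n => X.gr (n - 1)) (internal_shift X.gr X.internal) ^ (k + j.val)

/-- `(Y, dY)`, together with the morphism `u : X → Σ^*Y`, is a loop algebra `Ω^*X` of the
algebra `(X, dX)` over the reduced Barratt-Eccles operad: it represents the functor
`B ↦ Hom(X, Σ^*B)`, so that `Hom(Ω^*X, B) = Hom(X, Σ^*B)`. -/
structure IsLoopAlgebra (X : GradedOps (barrattEccles F) A) (dX : A →ₗ[F] A)
    (Y : GradedOps (barrattEccles F) B) (dY : B →ₗ[F] B) (u : A →ₗ[F] B) : Prop where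
  isDGAlgebra : Y.IsDGAlgebra dY
  isDGHom : IsDGHom X dX Y.suspensionAlgebra dY u
  exists_unique : ∀ (C : Type u) [AddCommGroup C] [Module F C] (Z : GradedOps (barrattEccles F) C)
    (dZ : C →ₗ[F] C), Z.IsDGAlgebra dZ → ∀ f : A →ₗ[F] C, IsDGHom X dX Z.suspensionAlgebra dZ f →
      ∃! g : B →ₗ[F] C, IsDGHom Y dY Z dZ g ∧ g ∘ₗ u = f

end Algebras

/-! ### Free algebras -/

section Free

variable {F : Type u} [Field F] (P : OperadData F) (V : CochainComplex (ModuleCat.{u} F) ℤ)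

/-- Formal composites of operations applied to homogeneous elements of `V`. -/
inductive Term : Type u
  | var (n : ℤ) (v : V.X n) : Term
  | op {r : ℕ} (x : P.ι r) (a : Fin r → Term) : Term

variable {P V}

/-- The (upper) degree of a formal composite. -/
def Term.deg : Term P V → ℤ
  | .var n _ => n
  | .op x a => ∑ i, (a i).deg - P.deg x

/-- The multilinear extension to linear combinations of formal composites of the operation
`(a₁, …, a_r) ↦ x(a₁, …, a_r)`. -/
def termOp {r : ℕ} (x : P.ι r) :
    MultilinearMap F (fun _ : Fin r => Term P V →₀ F) (Term P V →₀ F) :=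
  letI := Classical.decEq (Term P V)
  letI := Classical.decEq F
  ((Finsupp.lmapDomain F F fun a : Fin r → Term P V => Term.op x a) ∘ₗ
    (PiTensorProduct.ofFinsuppEquiv' (R := F) (ι := Fin r)
      (κ := fun _ => Term P V)).toLinearMap).compMultilinearMap
        (PiTensorProduct.tprod F)

variable (P V)

/-- The relations of the free graded `P`-algebra: linearity in the generators, unit, equivariance and
composition, closed under the operations. -/
inductive Rel : (Term P V →₀ F) → Prop
  | var_add (n : ℤ) (v w : V.X n) : Rel (Finsupp.single (Term.var n (v + w)) 1 -
      Finsupp.single (Term.var n v) 1 - Finsupp.single (Term.var n w) 1)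
  | var_smul (n : ℤ) (c : F) (v : V.X n) : Rel (Finsupp.single (Term.var n (c • v)) 1 -
      c • Finsupp.single (Term.var n v) 1)
  | one (t : Term P V) : Rel (Finsupp.single (Term.op P.one fun _ => t) 1 - Finsupp.single t 1)
  | act {r : ℕ} (g : Equiv.Perm (Fin r)) (x : P.ι r) (a : Fin r → Term P V) :
      Rel ((P.act g x).mapDomain (fun y => Term.op y a) -
        koszulSign g (fun i => (a i).deg) • Finsupp.single (Term.op x fun i => a (g i)) 1)
  | comp {r s : ℕ} (i : Fin (r + 1)) (x : P.ι (r + 1)) (y : P.ι s) (a : Fin (r + s) → Term P V) :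
      Rel ((P.comp i x y).mapDomain (fun z => Term.op z a) -
        (P.deg y * ∑ k : Fin (r + s) with k.val < i.val, (a k).deg).negOnePow •
          Finsupp.single (Term.op x (i.insertNth (α := fun _ => Term P V)
            (Term.op y fun k => a (slotEquiv i (Sum.inr k)))
            fun k => a (slotEquiv i (Sum.inl k)))) 1)
  | op {r : ℕ} (x : P.ι r) (a : Fin r → Term P V) (i : Fin r) {z : Term P V →₀ F} (hz : Rel z) :
      Rel (z.mapDomain fun t => Term.op x (Function.update a i t))

/-- The submodule of relations. -/
def relations : Submodule F (Term P V →₀ F) := Submodule.span F {z | Rel P V z}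

/-- The underlying module of the free graded `P`-algebra `P(V)` on the graded module `V`. -/
abbrev Free : Type u := (Term P V →₀ F) ⧸ relations P V

/-- The inclusion of the generators `V → P(V)`. -/
def Free.var (n : ℤ) : V.X n →ₗ[F] Free P V where
  toFun v := (relations P V).mkQ (Finsupp.single (Term.var n v) 1)
  map_add' v w := by
    rw [← map_add, ← sub_eq_zero, ← map_sub, Submodule.mkQ_apply, Submodule.Quotient.mk_eq_zero]
    refine Submodule.subset_span ?_
    rw [← sub_sub]
    exact Rel.var_add n v w
  map_smul' c v := by
    rw [RingHom.id_apply, ← map_smul, ← sub_eq_zero, ← map_sub, Submodule.mkQ_apply,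
      Submodule.Quotient.mk_eq_zero]
    exact Submodule.subset_span (Rel.var_smul n c v)

/-- The degree `n` component of the module of formal linear combinations. -/
def termGr (n : ℤ) : Submodule F (Term P V →₀ F) := Finsupp.supported F F {t | t.deg = n}

variable {P V}

lemma single_mem_termGr (t : Term P V) (c : F) : Finsupp.single t c ∈ termGr P V t.deg :=
  Finsupp.single_mem_supported F c rfl

lemma mapDomain_mem_termGr {α : Type*} {f : α → Term P V} {z : α →₀ F} {s : Set α} {n : ℤ}
    (hz : z ∈ Finsupp.supported F F s) (h : ∀ y ∈ s, (f y).deg = n) :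
    z.mapDomain f ∈ termGr P V n := by
  classical
  intro t ht
  obtain ⟨y, hy, rfl⟩ := Finset.mem_image.1 (Finsupp.mapDomain_support ht)
  exact h y (hz hy)

lemma Rel.homogeneous {z : Term P V →₀ F} (hz : Rel P V z) : ∃ n, z ∈ termGr P V n := by
  induction hz with
  | var_add n v w =>
    exact ⟨n, sub_mem (sub_mem (single_mem_termGr (Term.var n (v + w)) 1)
      (single_mem_termGr (Term.var n v) 1)) (single_mem_termGr (Term.var n w) 1)⟩
  | var_smul n c v =>
    exact ⟨n, sub_mem (single_mem_termGr (Term.var n (c • v)) 1)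
      (Submodule.smul_mem _ c (single_mem_termGr (Term.var n v) 1))⟩
  | one t =>
    refine ⟨t.deg, sub_mem ?_ (single_mem_termGr t 1)⟩
    have h := single_mem_termGr (Term.op P.one fun _ => t) (1 : F)
    simpa [Term.deg, P.deg_one] using h
  | act g x a =>
    refine ⟨∑ i, (a i).deg - P.deg x, sub_mem (mapDomain_mem_termGr (P.deg_act g x) ?_)
      (units_smul_mem F _ _ ?_)⟩
    · intro y hy
      simp only [Set.mem_ofPred_eq] at hy
      simp [Term.deg, hy]
    · have h := single_mem_termGr (Term.op x fun i => a (g i)) (1 : F)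
      simpa [Term.deg, Equiv.sum_comp g fun i => (a i).deg] using h
  | comp i x y a =>
    refine ⟨∑ k, (a k).deg - (P.deg x + P.deg y), sub_mem
      (mapDomain_mem_termGr (P.deg_comp i x y) ?_) (units_smul_mem F _ _ ?_)⟩
    · intro z hz
      simp only [Set.mem_ofPred_eq] at hz
      simp [Term.deg, hz]
    · have h := single_mem_termGr (Term.op x (i.insertNth (α := fun _ => Term P V)
            (Term.op y fun k => a (slotEquiv i (Sum.inr k)))
            fun k => a (slotEquiv i (Sum.inl k)))) (1 : F)
      have e : ∑ k, (a k).deg - (P.deg x + P.deg y) =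
          (Term.op x (i.insertNth (α := fun _ => Term P V)
            (Term.op y fun k => a (slotEquiv i (Sum.inr k)))
            fun k => a (slotEquiv i (Sum.inl k)))).deg := by
        rw [← Equiv.sum_comp (slotEquiv i) fun k => (a k).deg, Fintype.sum_sum_type]
        simp only [Term.deg, Fin.sum_univ_succAbove _ i, Fin.insertNth_apply_same,
          Fin.insertNth_apply_succAbove]
        ring
      rw [e]
      exact h
  | op x a i hz ih =>
    obtain ⟨n, hn⟩ := ih
    refine ⟨∑ j, Function.update (fun j => (a j).deg) i n j - P.deg x,
      mapDomain_mem_termGr hn ?_⟩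
    intro t ht
    simp only [Set.mem_ofPred_eq] at ht
    simp only [Term.deg, sub_left_inj]
    refine Finset.sum_congr rfl fun j _ => ?_
    by_cases h : j = i
    · subst h
      simp [ht]
    · simp [h]

variable (P V)

/-- The degree `n` component of the free algebra. -/
def Free.gr (n : ℤ) : Submodule F (Free P V) := (termGr P V n).map (relations P V).mkQ

variable {P V}

/-- The projection of the formal linear combinations onto their degree `n` part. -/
def termProj (n : ℤ) : (Term P V →₀ F) →ₗ[F] (Term P V →₀ F) :=
  Finsupp.linearCombination F fun t : Term P V => if t.deg = n then Finsupp.single t (1 : F) else 0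

lemma termProj_apply {m : ℤ} {z : Term P V →₀ F} (hz : z ∈ termGr P V m) (n : ℤ) :
    termProj n z = if m = n then z else 0 := by
  unfold termGr at hz
  rw [Finsupp.supported_eq_span_single] at hz
  induction hz using Submodule.span_induction with
  | mem z hz =>
    obtain ⟨t, ht, rfl⟩ := hz
    simp only [Set.mem_ofPred_eq] at ht
    rw [termProj, Finsupp.linearCombination_single, one_smul, ht]
  | zero => simp
  | add z w _ _ hz hw =>
    rw [map_add, hz, hw]
    split_ifs <;> simp
  | smul c z _ hz =>
    rw [map_smul, hz]
    split_ifs <;> simp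

lemma relations_le_comap (n : ℤ) :
    relations P V ≤ (relations P V).comap (termProj n) := by
  refine Submodule.span_le.2 fun z hz => ?_
  obtain ⟨m, hm⟩ := Rel.homogeneous hz
  change termProj n z ∈ relations P V
  rw [termProj_apply hm]
  split_ifs
  · exact Submodule.subset_span hz
  · exact zero_mem _

/-- The projection of the free algebra onto its degree `n` component. -/
def Free.proj (n : ℤ) : Free P V →ₗ[F] Free P V :=
  (relations P V).mapQ (relations P V) (termProj n) (relations_le_comap n)

lemma Free.proj_apply {m : ℤ} {q : Free P V} (hq : q ∈ Free.gr P V m) (n : ℤ) :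
    Free.proj n q = if m = n then q else 0 := by
  obtain ⟨z, hz, rfl⟩ := hq
  have h : Free.proj n ((relations P V).mkQ z) = (relations P V).mkQ (termProj n z) := rfl
  rw [h, termProj_apply hz]
  split_ifs
  · rfl
  · exact map_zero _

lemma Free.internal : DirectSum.IsInternal (Free.gr P V) := by
  refine DirectSum.isInternal_submodule_of_iSupIndep_of_iSup_eq_top ?_ ?_
  · intro n
    rw [Submodule.disjoint_def]
    intro q hq hq'
    have h : (⨆ m, ⨆ _ : m ≠ n, Free.gr P V m) ≤ LinearMap.ker (Free.proj (P := P) (V := V) n) :=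
      iSup₂_le fun m hm q hq => by
        rw [LinearMap.mem_ker, Free.proj_apply hq, if_neg hm]
    have h' := Free.proj_apply hq n
    rw [if_pos rfl] at h'
    rw [← h']
    exact h hq'
  · rw [eq_top_iff]
    intro q _
    obtain ⟨z, rfl⟩ := (relations P V).mkQ_surjective q
    induction z using Finsupp.induction_linear with
    | zero => rw [map_zero]; exact zero_mem _
    | add z w hz hw => rw [map_add]; exact add_mem (hz trivial) (hw trivial)
    | single t c =>
      exact Submodule.mem_iSup_of_mem t.deg (Submodule.mem_map_of_mem (single_mem_termGr t c))

lemma termOp_single {r : ℕ} (x : P.ι r) (a : Fin r → Term P V) (c : Fin r → F) :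
    termOp x (fun i => Finsupp.single (a i) (c i)) = Finsupp.single (Term.op x a) (∏ i, c i) := by
  classical
  simp [termOp]

lemma termOp_insertNth_single {r : ℕ} (x : P.ι (r + 1)) (i : Fin (r + 1)) (a : Fin r → Term P V)
    (z : Term P V →₀ F) :
    termOp x (i.insertNth (α := fun _ => Term P V →₀ F) z fun j => Finsupp.single (a j) 1) =
      z.mapDomain fun t => Term.op x (i.insertNth (α := fun _ => Term P V) t a) := by
  induction z using Finsupp.induction_linear with
  | zero =>
    rw [Finsupp.mapDomain_zero]
    exact (termOp x).map_coord_zero i (by simp)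
  | add z w hz hw =>
    rw [Finsupp.mapDomain_add, ← hz, ← hw]
    exact (termOp x).map_insertNth_add i _ z w
  | single t c =>
    rw [Finsupp.mapDomain_single]
    have h := termOp_single x (i.insertNth (α := fun _ => Term P V) t a)
      (i.insertNth (α := fun _ => F) c fun _ => 1)
    have e : ∏ j, i.insertNth (α := fun _ => F) c (fun _ => 1) j = c := by
      rw [Fin.prod_univ_succAbove _ i]
      simp
    rw [e] at h
    rw [← h]
    congr 1
    funext j
    refine Fin.succAboveCases i ?_ (fun j => ?_) j
    · simp
    · simp

lemma termOp_mem {r : ℕ} (x : P.ι r) (a : Fin r → Term P V →₀ F) (i : Fin r)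
    (hi : a i ∈ relations P V) : termOp x a ∈ relations P V := by
  obtain _ | r := r
  · exact i.elim0
  have key : ∀ z ∈ relations P V, ((relations P V).mkQ.compMultilinearMap (termOp x)).curryMid i z
      = 0 := by
    intro z hz
    induction hz using Submodule.span_induction with
    | zero => exact map_zero _
    | add z w _ _ hz hw => rw [map_add, hz, hw, add_zero]
    | smul c z _ hz => rw [map_smul, hz, smul_zero]
    | mem z hz =>
      refine Module.Basis.ext_multilinear (fun _ => Finsupp.basisSingleOne) fun v => ?_
      simp only [Finsupp.coe_basisSingleOne]
      change (relations P V).mkQ (termOp x (i.insertNth (α := fun _ => Term P V →₀ F) z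
        fun j => Finsupp.single (v j) 1)) = 0
      rw [termOp_insertNth_single, Submodule.mkQ_apply, Submodule.Quotient.mk_eq_zero]
      rcases isEmpty_or_nonempty (Term P V) with h | ⟨⟨t₀⟩⟩
      · rw [Subsingleton.elim z 0, Finsupp.mapDomain_zero]
        exact zero_mem _
      · have := Rel.op x (i.insertNth (α := fun _ => Term P V) t₀ v) i hz
        simp only [Fin.update_insertNth] at this
        exact Submodule.subset_span this
  have h : (relations P V).mkQ (termOp x (i.insertNth (α := fun _ => Term P V →₀ F) (a i)
      (i.removeNth a))) = 0 := DFunLike.congr_fun (key (a i) hi) (i.removeNth a)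
  rw [Fin.insertNth_self_removeNth] at h
  exact (Submodule.Quotient.mk_eq_zero _).1 h

lemma termOp_congr {r : ℕ} (x : P.ι r) {a b : Fin r → Term P V →₀ F}
    (h : ∀ i, (relations P V).mkQ (a i) = (relations P V).mkQ (b i)) :
    (relations P V).mkQ (termOp x a) = (relations P V).mkQ (termOp x b) := by
  classical
  have key : ∀ s : Finset (Fin r), (relations P V).mkQ (termOp x (s.piecewise a b)) =
      (relations P V).mkQ (termOp x b) := by
    intro s
    induction s using Finset.induction_on with
    | empty => simp
    | insert i s hi ih =>
      rw [← ih, ← sub_eq_zero, ← map_sub, Finset.piecewise_insert]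
      have e : s.piecewise a b = Function.update (s.piecewise a b) i (b i) := by
        rw [eq_comm, Function.update_eq_self_iff]
        simp [hi]
      conv_lhs => rw [e, Function.update_idem, ← MultilinearMap.map_update_sub]
      refine (Submodule.Quotient.mk_eq_zero _).2 (termOp_mem x _ i ?_)
      rw [Function.update_self, ← Submodule.Quotient.mk_eq_zero]
      have := h i
      rw [← sub_eq_zero, ← map_sub] at this
      exact this
  simpa using key Finset.univ

/-- The value of an operation on classes, through representatives. -/
def Free.opFun {r : ℕ} (x : P.ι r) (q : Fin r → Free P V) : Free P V :=
  (relations P V).mkQ (termOp x fun i => (q i).out)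

lemma Free.opFun_mkQ {r : ℕ} (x : P.ι r) (a : Fin r → Term P V →₀ F) :
    Free.opFun x (fun i => (relations P V).mkQ (a i)) = (relations P V).mkQ (termOp x a) :=
  termOp_congr x fun i => Submodule.Quotient.mk_out ((relations P V).mkQ (a i))

lemma update_mkQ {r : ℕ} (a : Fin r → Term P V →₀ F) (i : Fin r) (z : Term P V →₀ F) :
    Function.update (fun j => (relations P V).mkQ (a j)) i ((relations P V).mkQ z) =
      fun j => (relations P V).mkQ (Function.update a i z j) := by
  funext j
  by_cases e : j = i
  · subst e
    rw [Function.update_self, Function.update_self]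
  · rw [Function.update_of_ne e, Function.update_of_ne e]

/-- The operation of the free algebra associated to a basis element of the operad. -/
def Free.op {r : ℕ} (x : P.ι r) : MultilinearMap F (fun _ : Fin r => Free P V) (Free P V) :=
  MultilinearMap.mk' (Free.opFun x)
    (by
      intro q i v w
      obtain ⟨a, rfl⟩ : ∃ a : Fin r → Term P V →₀ F, q = fun j => (relations P V).mkQ (a j) :=
        ⟨fun j => (q j).out, funext fun j => (Submodule.Quotient.mk_out (q j)).symm⟩
      obtain ⟨v, rfl⟩ := (relations P V).mkQ_surjective v
      obtain ⟨w, rfl⟩ := (relations P V).mkQ_surjective w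
      rw [← map_add, update_mkQ, update_mkQ, update_mkQ, Free.opFun_mkQ, Free.opFun_mkQ,
        Free.opFun_mkQ, ← map_add, MultilinearMap.map_update_add])
    (by
      intro q i c v
      obtain ⟨a, rfl⟩ : ∃ a : Fin r → Term P V →₀ F, q = fun j => (relations P V).mkQ (a j) :=
        ⟨fun j => (q j).out, funext fun j => (Submodule.Quotient.mk_out (q j)).symm⟩
      obtain ⟨v, rfl⟩ := (relations P V).mkQ_surjective v
      rw [← map_smul, update_mkQ, update_mkQ, Free.opFun_mkQ, Free.opFun_mkQ, ← map_smul,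
        MultilinearMap.map_update_smul])

variable (P V)

/-- The free graded `P`-algebra `P(V)` on the graded module underlying `V`. -/
def freeAlgebra : GradedOps P (Free P V) where
  gr := Free.gr P V
  internal := Free.internal
  op x := Free.op x

variable {P V}

/-- `δ` is the differential `δ_h = δ + d_h` of an almost free algebra `(P(V), δ_h)` determined by the
homogeneous morphism `h : V → P(V)` of degree `1`: it is a differential on `P(V)`, compatible with
the operations, with `δ_h(v) = δ(v) + h(v)` on the generators. -/
structure IsAlmostFreeDifferential (h : ∀ n : ℤ, V.X n →ₗ[F] Free P V)
    (δ : Free P V →ₗ[F] Free P V) : Prop where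
  mem : ∀ (n : ℤ) (v : V.X n), h n v ∈ (freeAlgebra P V).gr (n + 1)
  isDifferential : (freeAlgebra P V).IsDifferential δ
  var : ∀ (n : ℤ) (v : V.X n),
    δ (Free.var P V n v) = Free.var P V (n + 1) (V.d n (n + 1) v) + h n v

end Free

/-- `κ` is the map `E(V) → Λ^*E(V)` induced by the cap products with the cocycles `ε_r`, that is
`κ(ρ(v₁, …, v_r)) = (ε_r ∩ ρ)(v₁, …, v_r)`. -/
def IsCapMap {F : Type u} [Field F] (V : CochainComplex (ModuleCat.{u} F) ℤ)
    (κ : Free (barrattEccles F) V →ₗ[F] Free (barrattEccles F).suspension V) : Prop :=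
  ∀ (r : ℕ) (w : Simplex r) (n : Fin r → ℤ) (v : ∀ i, V.X (n i)),
    κ ((freeAlgebra (barrattEccles F) V).op w fun i => Free.var _ V (n i) (v i)) =
      (freeAlgebra (barrattEccles F).suspension V).eval (cap F w)
        fun i => Free.var _ V (n i) (v i)

end LoopAlgebra

end

/-!
The cap products with the cocycles `ε_r` form a morphism of differential graded operads
`E → Λ^*E`, `ρ ↦ ε_r ∩ ρ` (`cap_isOperadHom`), and the `E`-algebra structure of a suspension `Σ^*A`
is the restriction along this morphism of the `Λ^*E`-algebra structure of `Σ^*A`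
(`suspensionAlgebra_eq`).  Everything else is formal.

* The map `κ` (`capMap`) is the morphism of `E`-algebras from `E(V)` to the restriction of
  `Λ^*E(V)` that is the identity on `V`.  It is the only linear map with the prescribed values,
  because `E(V)` is spanned by the results of a single operation on generators
  (`Free.linear_ext_op_var`).
* A derivation of a free algebra is determined by its values on generators, which may be prescribed
  (`Free.der`, `Free.derivation_ext`).  This yields `δ'`.  Both `δ'κ` and `κδ` are derivations along
  `κ` with the same values on `V`, hence `δ'κ = κδ`, and `δ'² = 0` holds on `V` because it is
  `κδ²`; by `GradedOps.IsDerivation.sq_op` it holds everywhere.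
* Since the operations on `Σ^*A` differ from those on `A` by signs only, each `Λ^*E`-algebra has
  a desuspension (`GradedOps.suspension_desuspension`).  A morphism `E(V) → Σ^*B` of `E`-algebras
  is determined by its values on `V`, as is a morphism `Λ^*E(V) → Σ^*B` of `Λ^*E`-algebras; thus the
  first factors uniquely through `κ`, and the desuspension of `(Λ^*E(V), δ')` is a loop algebra of
  `(E(V), δ)` (`loopFree_isLoopAlgebra`).  Uniqueness of representing objects gives `Ψ`
  (`IsLoopAlgebra.exists_equiv`).

That `ε ∩ -` is compatible with the composition products rests on two facts about shuffles.  The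
diagonal of an Eilenberg-Zilber product is the product of the diagonals (`diagonalSum_shuffle`),
and `ε(w ∘ᵢ u) = ± ε(w) ε(u)` (`epsilon_shuffle`).  The second one is a statement about the words
of first letters: in a shuffle without repetitions the word of `u` has to be read in one go at the
place of the letter `i`, so that a single term remains.  The compatibility with the differential is
the cocycle property of `ε_r` (`wordSign_listBoundary`).  Simplices are handled as lists of
vertices, with formal combinations of all lists, and the passage to normalized chains uses that all
structure maps preserve degenerate lists.
-/

noncomputable section

namespace LoopAlgebra

/-! ### Signs, homogeneous elements and multilinear maps -/

section Linear

variable {F : Type u} [Field F] {A B : Type u} [AddCommGroup A] [Module F A]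
  [AddCommGroup B] [Module F B]

lemma negOnePow_congr {a b : ℤ} (h : (a : ZMod 2) = b) : a.negOnePow = b.negOnePow := by
  rw [Int.negOnePow_eq_iff, even_iff_two_dvd]
  exact (ZMod.intCast_eq_intCast_iff_dvd_sub b a 2).1 h.symm

lemma map_sign_smul (f : A →ₗ[F] B) (e : ℤˣ) (a : A) : f (e • a) = e • f a := by
  rw [Units.smul_def, Units.smul_def, map_zsmul]

lemma multilinear_sign_smul_apply {ι : Type*} (f : MultilinearMap F (fun _ : ι => A) B) (e : ℤˣ)
    (a : ι → A) : (e • f) a = e • f a := by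
  rcases Int.units_eq_one_or e with rfl | rfl <;> simp

lemma multilinear_zsmul_apply {ι : Type*} (f : MultilinearMap F (fun _ : ι => A) B) (e : ℤ)
    (a : ι → A) : (e • f) a = e • f a := by
  rw [← Int.cast_smul_eq_zsmul F, smul_apply, Int.cast_smul_eq_zsmul]

lemma sign_smul_injective (e : ℤˣ) {a b : A} (h : e • a = e • b) : a = b :=
  (MulAction.injective e) h

/-- Multilinear maps which agree on the tuples of elements of given subsets agree on the spans. -/
lemma multilinear_eq_of_span {r : ℕ} (f g : MultilinearMap F (fun _ : Fin r => A) B)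
    (S : Fin r → Set A) (h : ∀ a : Fin r → A, (∀ i, a i ∈ S i) → f a = g a) (a : Fin r → A)
    (ha : ∀ i, a i ∈ Submodule.span F (S i)) : f a = g a := by
  classical
  have key : ∀ (s : Finset (Fin r)) (a : Fin r → A), (∀ i ∈ s, a i ∈ Submodule.span F (S i)) →
      (∀ i ∉ s, a i ∈ S i) → f a = g a := by
    intro s
    induction s using Finset.induction_on with
    | empty => exact fun a _ h' => h a fun i => h' i (Finset.notMem_empty i)
    | insert i s hi ih =>
      intro a h₁ h₂
      have : ∀ v ∈ Submodule.span F (S i), f (Function.update a i v) =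
          g (Function.update a i v) := by
        intro v hv
        induction hv using Submodule.span_induction with
        | mem v hv =>
          refine ih _ (fun j hj => ?_) fun j hj => ?_
          · have : j ≠ i := fun e => hi (e ▸ hj)
            rw [Function.update_of_ne this]
            exact h₁ j (Finset.mem_insert_of_mem hj)
          · by_cases e : j = i
            · subst e
              rwa [Function.update_self]
            · rw [Function.update_of_ne e]
              exact h₂ j (by simp [e, hj])
        | zero => rw [f.map_update_zero, g.map_update_zero]
        | add v w _ _ hv hw => rw [f.map_update_add, g.map_update_add, hv, hw]
        | smul c v _ hv => rw [f.map_update_smul, g.map_update_smul, hv]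
      have := this (a i) (h₁ i (Finset.mem_insert_self i s))
      rwa [Function.update_eq_self] at this
  exact key Finset.univ a (fun i _ => ha i) fun i hi => absurd (Finset.mem_univ i) hi

lemma mem_span_homogeneous {gr : ℤ → Submodule F A} (hgr : DirectSum.IsInternal gr) (a : A) :
    a ∈ Submodule.span F {b | ∃ n, b ∈ gr n} := by
  have h : (⨆ n, gr n) ≤ Submodule.span F {b | ∃ n, b ∈ gr n} :=
    iSup_le fun n b hb => Submodule.subset_span ⟨n, hb⟩
  exact h (hgr.submodule_iSup_eq_top ▸ Submodule.mem_top)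

/-- Multilinear maps which agree on homogeneous elements are equal. -/
lemma multilinear_ext_homogeneous {gr : ℤ → Submodule F A} (hgr : DirectSum.IsInternal gr) {r : ℕ}
    {f g : MultilinearMap F (fun _ : Fin r => A) B}
    (h : ∀ (a : Fin r → A) (n : Fin r → ℤ), (∀ i, a i ∈ gr (n i)) → f a = g a) : f = g := by
  ext a
  refine multilinear_eq_of_span f g (fun _ => {b | ∃ n, b ∈ gr n}) (fun a ha => ?_) a
    fun i => mem_span_homogeneous hgr (a i)
  choose n hn using ha
  exact h a n hn

lemma parity_apply {gr : ℤ → Submodule F A} (hgr : DirectSum.IsInternal gr) {n : ℤ} {a : A}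
    (ha : a ∈ gr n) : parity gr hgr a = n.negOnePow • a := by
  let := hgr.chooseDecomposition
  change DirectSum.toModule F ℤ A (fun n => (n.negOnePow : ℤ) • (gr n).subtype)
    (DirectSum.decompose gr a) = _
  rw [DirectSum.decompose_of_mem gr ha]
  change DirectSum.toModule F ℤ A (fun n => (n.negOnePow : ℤ) • (gr n).subtype)
    (DirectSum.lof F ℤ (fun n => gr n) n ⟨a, ha⟩) = _
  rw [DirectSum.toModule_lof, Units.smul_def]
  rfl

lemma parity_pow_apply {gr : ℤ → Submodule F A} (hgr : DirectSum.IsInternal gr) {n : ℤ} {a : A}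
    (ha : a ∈ gr n) (k : ℕ) : (parity gr hgr ^ k) a = (k * n).negOnePow • a := by
  induction k with
  | zero => simp
  | succ k ih =>
    rw [pow_succ', Module.End.mul_apply, ih, map_sign_smul, parity_apply hgr ha, smul_smul,
      ← Int.negOnePow_add]
    congr 2
    push_cast
    ring

lemma multilinear_map_sign_smul {r : ℕ} (f : MultilinearMap F (fun _ : Fin r => A) B)
    (m : Fin r → ℤ) (a : Fin r → A) :
    f (fun i => (m i).negOnePow • a i) = (∑ i, m i).negOnePow • f a := by
  have h : (fun i => (m i).negOnePow • a i) =
      fun i => (((m i).negOnePow : ℤ) : F) • a i := by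
    funext i
    rw [Int.cast_smul_eq_zsmul, Units.smul_def]
  rw [h, f.map_smul_univ]
  have : ((∑ i, m i).negOnePow) = ∏ i, (m i).negOnePow := by
    induction (Finset.univ : Finset (Fin r)) using Finset.induction_on with
    | empty => simp
    | insert i s hi ih => rw [Finset.sum_insert hi, Finset.prod_insert hi, Int.negOnePow_add, ih]
  rw [this, Units.smul_def, ← Int.cast_smul_eq_zsmul F]
  congr 1
  push_cast
  rfl

lemma update_slotEquiv_inl {X : Type*} {r s : ℕ} (i : Fin (r + 1)) (a : Fin (r + s) → X)
    (k : Fin r) (v : X) :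
    (fun j => Function.update a (slotEquiv i (Sum.inl k)) v (slotEquiv (s := s) i (Sum.inl j))) =
      Function.update (fun j => a (slotEquiv i (Sum.inl j))) k v := by
  funext j
  rw [Function.update_apply, Function.update_apply]
  simp

lemma update_slotEquiv_inr {X : Type*} {r s : ℕ} (i : Fin (r + 1)) (a : Fin (r + s) → X)
    (k : Fin s) (v : X) :
    (fun j => Function.update a (slotEquiv i (Sum.inr k)) v (slotEquiv (r := r) i (Sum.inr j))) =
      Function.update (fun j => a (slotEquiv i (Sum.inr j))) k v := by
  funext j
  rw [Function.update_apply, Function.update_apply]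
  simp

lemma update_slotEquiv_inl_inr {X : Type*} {r s : ℕ} (i : Fin (r + 1)) (a : Fin (r + s) → X)
    (k : Fin r) (v : X) :
    (fun j => Function.update a (slotEquiv i (Sum.inl k)) v (slotEquiv (s := s) i (Sum.inr j))) =
      fun j => a (slotEquiv i (Sum.inr j)) := by
  funext j
  rw [Function.update_of_ne]
  simp

lemma update_slotEquiv_inr_inl {X : Type*} {r s : ℕ} (i : Fin (r + 1)) (a : Fin (r + s) → X)
    (k : Fin s) (v : X) :
    (fun j => Function.update a (slotEquiv i (Sum.inr k)) v (slotEquiv (s := s) i (Sum.inl j))) =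
      fun j => a (slotEquiv i (Sum.inl j)) := by
  funext j
  rw [Function.update_of_ne]
  simp

/-- The partial composite `f ∘ᵢ g` of multilinear maps, with the inputs ordered by `slotEquiv`. -/
def multilinearComp {r s : ℕ} (i : Fin (r + 1)) (f : MultilinearMap F (fun _ : Fin (r + 1) => A) B)
    (g : MultilinearMap F (fun _ : Fin s => A) A) :
    MultilinearMap F (fun _ : Fin (r + s) => A) B :=
  MultilinearMap.mk' (fun a => f (i.insertNth (α := fun _ => A)
      (g fun k => a (slotEquiv i (Sum.inr k))) fun k => a (slotEquiv i (Sum.inl k))))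
    (by
      intro a k v w
      obtain ⟨k | k, rfl⟩ := (slotEquiv i).surjective k
      · simp only [update_slotEquiv_inl, update_slotEquiv_inl_inr, Fin.insertNth_update,
          MultilinearMap.map_update_add]
      · simp only [update_slotEquiv_inr, update_slotEquiv_inr_inl, MultilinearMap.map_update_add,
          f.map_insertNth_add])
    (by
      intro a k c v
      obtain ⟨k | k, rfl⟩ := (slotEquiv i).surjective k
      · simp only [update_slotEquiv_inl, update_slotEquiv_inl_inr, Fin.insertNth_update,
          MultilinearMap.map_update_smul]
      · simp only [update_slotEquiv_inr, update_slotEquiv_inr_inl, MultilinearMap.map_update_smul,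
          f.map_insertNth_smul])

lemma multilinearComp_apply {r s : ℕ} (i : Fin (r + 1))
    (f : MultilinearMap F (fun _ : Fin (r + 1) => A) B)
    (g : MultilinearMap F (fun _ : Fin s => A) A) (a : Fin (r + s) → A) :
    multilinearComp i f g a = f (i.insertNth (α := fun _ => A)
      (g fun k => a (slotEquiv i (Sum.inr k))) fun k => a (slotEquiv i (Sum.inl k))) := rfl

/-- The multilinear map `(a₁, …, a_r) ↦ f(a₁, …, d aᵢ, …, a_r)`. -/
def multilinearAt {r : ℕ} (f : MultilinearMap F (fun _ : Fin r => A) B) (d : A →ₗ[F] A)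
    (i : Fin r) : MultilinearMap F (fun _ : Fin r => A) B :=
  f.compLinearMap fun j => if j = i then d else LinearMap.id

lemma multilinearAt_apply {r : ℕ} (f : MultilinearMap F (fun _ : Fin r => A) B) (d : A →ₗ[F] A)
    (i : Fin r) (a : Fin r → A) :
    multilinearAt f d i a = f (Function.update a i (d (a i))) := by
  rw [multilinearAt, MultilinearMap.compLinearMap_apply]
  congr 1
  funext j
  by_cases h : j = i
  · subst h
    simp
  · simp [h]

end Linear

/-! ### Operations of arbitrary elements of an operad -/

section Eval

variable {F : Type u} [Field F] {P : OperadData F} {A B : Type u} [AddCommGroup A] [Module F A]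
  [AddCommGroup B] [Module F B]

lemma GradedOps.eval_single (X : GradedOps P A) {r : ℕ} (x : P.ι r) (c : F) :
    X.eval (Finsupp.single x c) = c • X.op x :=
  Finsupp.linearCombination_single F c x

lemma GradedOps.eval_single_one (X : GradedOps P A) {r : ℕ} (x : P.ι r) :
    X.eval (Finsupp.single x (1 : F)) = X.op x := by
  rw [X.eval_single, one_smul]

lemma GradedOps.eval_zero (X : GradedOps P A) {r : ℕ} : X.eval (0 : P.obj r) = 0 :=
  map_zero (Finsupp.linearCombination F fun x : P.ι r => X.op x)

lemma GradedOps.eval_add (X : GradedOps P A) {r : ℕ} (ρ σ : P.obj r) :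
    X.eval (ρ + σ) = X.eval ρ + X.eval σ :=
  map_add (Finsupp.linearCombination F fun x : P.ι r => X.op x) ρ σ

lemma GradedOps.eval_smul (X : GradedOps P A) {r : ℕ} (c : F) (ρ : P.obj r) :
    X.eval (c • ρ) = c • X.eval ρ :=
  map_smul (Finsupp.linearCombination F fun x : P.ι r => X.op x) c ρ

lemma GradedOps.eval_sign_smul (X : GradedOps P A) {r : ℕ} (e : ℤˣ) (ρ : P.obj r) :
    X.eval (e • ρ) = e • X.eval ρ :=
  map_sign_smul (Finsupp.linearCombination F fun x : P.ι r => X.op x) e ρ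

/-- The linear extension of a map defined on the basis elements of an operad. -/
abbrev linearExtension {ι : Type} {M : Type u} [AddCommGroup M] [Module F M] (f : ι → M) :
    (ι →₀ F) →ₗ[F] M := Finsupp.linearCombination F f

/-- Two linear maps on the homogeneous elements of degree `n` agree as soon as they agree on the
basis elements of degree `n`. -/
lemma eq_of_mem_supported {ι M : Type*} [AddCommGroup M] [Module F M]
    {f g : (ι →₀ F) →ₗ[F] M} {s : Set ι} (h : ∀ x ∈ s, f (Finsupp.single x 1) =
      g (Finsupp.single x 1)) {ρ : ι →₀ F} (hρ : ρ ∈ Finsupp.supported F F s) : f ρ = g ρ := by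
  rw [Finsupp.supported_eq_span_single] at hρ
  induction hρ using Submodule.span_induction with
  | mem z hz =>
    obtain ⟨x, hx, rfl⟩ := hz
    exact h x hx
  | zero => simp
  | add z w _ _ hz hw => rw [map_add, map_add, hz, hw]
  | smul c z _ hz => rw [map_smul, map_smul, hz]

lemma linearExtension_mem {ι : Type} {M : Type u} [AddCommGroup M] [Module F M] {f : ι → M}
    {s : Set ι} {p : Submodule F M} (h : ∀ x ∈ s, f x ∈ p) {ρ : ι →₀ F}
    (hρ : ρ ∈ Finsupp.supported F F s) : linearExtension f ρ ∈ p :=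
  Submodule.sum_mem _ fun x hx => p.smul_mem _ (h x (hρ hx))

/-- Evaluation of all the elements of the operad at given arguments. -/
def GradedOps.evalAt (X : GradedOps P A) {r : ℕ} (a : Fin r → A) : P.obj r →ₗ[F] A where
  toFun ρ := X.eval ρ a
  map_add' ρ σ := by rw [X.eval_add, add_apply]
  map_smul' c ρ := by rw [X.eval_smul, smul_apply, RingHom.id_apply]

lemma GradedOps.evalAt_apply (X : GradedOps P A) {r : ℕ} (a : Fin r → A) (ρ : P.obj r) :
    X.evalAt a ρ = X.eval ρ a := rfl

lemma GradedOps.evalAt_single (X : GradedOps P A) {r : ℕ} (a : Fin r → A) (x : P.ι r) :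
    X.evalAt a (Finsupp.single x 1) = X.op x a := by
  rw [X.evalAt_apply, X.eval_single_one]

lemma GradedOps.eval_eq_linearExtension (X : GradedOps P A) {r : ℕ} (a : Fin r → A)
    (ρ : P.obj r) : X.eval ρ a = linearExtension (fun x => X.op x a) ρ := by
  rw [← X.evalAt_apply]
  congr 1
  refine Finsupp.lhom_ext fun x c => ?_
  rw [X.evalAt_apply, X.eval_single, Finsupp.linearCombination_single]
  rfl

lemma GradedOps.IsAlgebra.eval_mem {X : GradedOps P A} (hX : X.IsAlgebra) {r : ℕ} {d : ℤ}
    {ρ : P.obj r} (hρ : ρ ∈ Finsupp.supported F F {y | P.deg y = d}) {a : Fin r → A}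
    {n : Fin r → ℤ} (ha : ∀ i, a i ∈ X.gr (n i)) : X.eval ρ a ∈ X.gr (∑ i, n i - d) := by
  rw [X.eval_eq_linearExtension]
  refine linearExtension_mem (fun x hx => ?_) hρ
  rw [← show P.deg x = d from hx]
  exact hX.op_mem x a n ha

end Eval

/-! ### The free algebra and its universal property -/

section FreeAlgebra

variable {F : Type u} [Field F] {P : OperadData F} {V : CochainComplex (ModuleCat.{u} F) ℤ}
  {A : Type u} [AddCommGroup A] [Module F A]

/-- The class of a formal composite in the free algebra. -/
def Free.ofTerm (t : Term P V) : Free P V := (relations P V).mkQ (Finsupp.single t 1)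

lemma Free.op_ofTerm {r : ℕ} (x : P.ι r) (a : Fin r → Term P V) :
    (freeAlgebra P V).op x (fun i => Free.ofTerm (a i)) = Free.ofTerm (Term.op x a) := by
  change Free.opFun x _ = _
  unfold Free.ofTerm
  rw [Free.opFun_mkQ, termOp_single]
  simp

lemma Free.ofTerm_var (n : ℤ) (v : V.X n) : Free.ofTerm (Term.var n v) = Free.var P V n v := rfl

lemma Free.eval_ofTerm {r : ℕ} (ρ : P.obj r) (a : Fin r → Term P V) :
    (freeAlgebra P V).eval ρ (fun i => Free.ofTerm (a i)) =
      (relations P V).mkQ (ρ.mapDomain fun y => Term.op y a) := by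
  rw [← GradedOps.evalAt_apply, ← Finsupp.lmapDomain_apply F F, ← LinearMap.comp_apply]
  congr 1
  refine Finsupp.lhom_ext' fun x => LinearMap.ext_ring ?_
  change (freeAlgebra P V).evalAt _ (Finsupp.single x 1) =
    (relations P V).mkQ (Finsupp.lmapDomain F F _ (Finsupp.single x 1))
  rw [GradedOps.evalAt_single, Free.op_ofTerm, Finsupp.lmapDomain_apply, Finsupp.mapDomain_single]
  rfl

lemma Free.gr_eq_span (n : ℤ) :
    Free.gr P V n = Submodule.span F {q | ∃ t : Term P V, t.deg = n ∧ Free.ofTerm t = q} := by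
  rw [Free.gr, termGr, Finsupp.supported_eq_span_single, Submodule.map_span, ← Set.image_comp]
  rfl

lemma Free.span_ofTerm : Submodule.span F (Set.range (Free.ofTerm (P := P) (V := V))) = ⊤ := by
  rw [eq_top_iff]
  intro q _
  obtain ⟨z, rfl⟩ := (relations P V).mkQ_surjective q
  induction z using Finsupp.induction_linear with
  | zero => rw [map_zero]; exact zero_mem _
  | add z w hz hw => rw [map_add]; exact add_mem (hz trivial) (hw trivial)
  | single t c =>
    rw [← mul_one c, ← smul_eq_mul, ← Finsupp.smul_single, map_smul]
    exact Submodule.smul_mem _ _ (Submodule.subset_span ⟨t, rfl⟩)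

lemma Free.ofTerm_mem (t : Term P V) : Free.ofTerm t ∈ (freeAlgebra P V).gr t.deg :=
  Submodule.mem_map_of_mem (single_mem_termGr t 1)

lemma Free.var_mem (n : ℤ) (v : V.X n) : Free.var P V n v ∈ (freeAlgebra P V).gr n :=
  Free.ofTerm_mem (Term.var n v)

/-- Multilinear maps which agree on the formal composites of given degrees agree on the homogeneous
elements of these degrees. -/
lemma Free.multilinear_ext {r : ℕ} {f g : MultilinearMap F (fun _ : Fin r => Free P V) A}
    {n : Fin r → ℤ} (h : ∀ t : Fin r → Term P V, (∀ i, (t i).deg = n i) →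
      f (fun i => Free.ofTerm (t i)) = g fun i => Free.ofTerm (t i))
    {a : Fin r → Free P V} (ha : ∀ i, a i ∈ (freeAlgebra P V).gr (n i)) : f a = g a := by
  refine multilinear_eq_of_span f g (fun i => {q | ∃ t : Term P V, t.deg = n i ∧
    Free.ofTerm t = q}) (fun a h' => ?_) a fun i => ?_
  · choose t ht₁ ht₂ using h'
    rw [← funext ht₂]
    exact h t ht₁
  · rw [← Free.gr_eq_span]
    exact ha i

lemma Free.mkQ_eq_of_sub_rel {z w : Term P V →₀ F} (h : Rel P V (z - w)) :
    (relations P V).mkQ z = (relations P V).mkQ w := by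
  rw [← sub_eq_zero, ← map_sub, Submodule.mkQ_apply, Submodule.Quotient.mk_eq_zero]
  exact Submodule.subset_span h

lemma freeAlgebra_isAlgebra : (freeAlgebra P V).IsAlgebra where
  op_mem {r} x a n ha := by
    rw [← Submodule.Quotient.mk_eq_zero]
    change ((Submodule.mkQ _).compMultilinearMap ((freeAlgebra P V).op x)) a =
      (0 : MultilinearMap F (fun _ : Fin r => Free P V) _) a
    refine Free.multilinear_ext (n := n) (fun t ht => ?_) ha
    rw [LinearMap.compMultilinearMap_apply, Free.op_ofTerm, Submodule.mkQ_apply,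
      zero_apply, Submodule.Quotient.mk_eq_zero]
    simp_rw [← ht]
    exact Free.ofTerm_mem (Term.op x t)
  op_one a := by
    have h := multilinear_eq_of_span ((freeAlgebra P V).op P.one)
      (MultilinearMap.ofSubsingleton F _ _ (0 : Fin 1) LinearMap.id) (fun _ => Set.range Free.ofTerm)
      (fun a ha => ?_) (fun _ => a) fun _ => by rw [Free.span_ofTerm]; exact Submodule.mem_top
    · simpa using h
    · choose t ht using ha
      have e : t = fun _ => t 0 := funext fun i => by rw [Subsingleton.elim i 0]
      rw [← funext ht, Free.op_ofTerm, e]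
      exact Free.mkQ_eq_of_sub_rel (Rel.one (t 0))
  op_act {r} g x a n ha := by
    have h := Free.multilinear_ext (f := (freeAlgebra P V).eval (P.act g x))
      (g := koszulSign g n • ((freeAlgebra P V).op x).domDomCongr g) (n := n) (fun t ht => ?_) ha
    · rw [h, multilinear_sign_smul_apply, MultilinearMap.domDomCongr_apply]
    · rw [multilinear_sign_smul_apply, MultilinearMap.domDomCongr_apply, Free.eval_ofTerm,
        Free.op_ofTerm x fun i => t (g i), Free.mkQ_eq_of_sub_rel (Rel.act g x t), map_sign_smul]
      simp_rw [ht]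
      rfl
  op_comp {r s} i x y a n ha := by
    have h := Free.multilinear_ext (f := (freeAlgebra P V).eval (P.comp i x y))
      (g := (P.deg y * ∑ k : Fin (r + s) with k.val < i.val, n k).negOnePow •
        multilinearComp i ((freeAlgebra P V).op x) ((freeAlgebra P V).op y)) (n := n)
      (fun t ht => ?_) ha
    · rw [h, multilinear_sign_smul_apply, multilinearComp_apply]
    · rw [multilinear_sign_smul_apply, multilinearComp_apply, Free.op_ofTerm y fun k => t _,
        Free.eval_ofTerm, Free.mkQ_eq_of_sub_rel (Rel.comp i x y t), map_sign_smul]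
      simp_rw [ht]
      congr 1
      change Free.ofTerm _ = _
      rw [← Free.op_ofTerm]
      congr 1
      funext j
      refine Fin.succAboveCases i ?_ (fun j => ?_) j <;> simp

/-- Linear maps on the free algebra which agree on the generators, and whose equality propagates
along operations on homogeneous elements, are equal. -/
lemma Free.linear_ext {f g : Free P V →ₗ[F] A}
    (hvar : ∀ (n : ℤ) (v : V.X n), f (Free.var P V n v) = g (Free.var P V n v))
    (hop : ∀ {r : ℕ} (x : P.ι r) (a : Fin r → Free P V) (n : Fin r → ℤ),
      (∀ i, a i ∈ (freeAlgebra P V).gr (n i)) → (∀ i, f (a i) = g (a i)) →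
        f ((freeAlgebra P V).op x a) = g ((freeAlgebra P V).op x a)) : f = g := by
  refine LinearMap.ext_on Free.span_ofTerm ?_
  rintro _ ⟨t, rfl⟩
  induction t with
  | var n v => exact hvar n v
  | op x a ih =>
    rw [← Free.op_ofTerm]
    exact hop x _ _ (fun i => Free.ofTerm_mem (a i)) ih

/-- The value of a formal composite in an algebra, for given values of the generators. -/
def termEval (X : GradedOps P A) (f : ∀ n : ℤ, V.X n →ₗ[F] A) : Term P V → A
  | .var n v => f n v
  | .op x a => X.op x fun i => termEval X f (a i)

lemma termEval_mem {X : GradedOps P A} (hX : X.IsAlgebra) {f : ∀ n : ℤ, V.X n →ₗ[F] A}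
    (hf : ∀ n v, f n v ∈ X.gr n) (t : Term P V) : termEval X f t ∈ X.gr t.deg := by
  induction t with
  | var n v => exact hf n v
  | op x a ih => exact hX.op_mem x _ _ ih

lemma linearCombination_termEval_of_rel {X : GradedOps P A} (hX : X.IsAlgebra)
    {f : ∀ n : ℤ, V.X n →ₗ[F] A} (hf : ∀ n v, f n v ∈ X.gr n) {z : Term P V →₀ F}
    (hz : Rel P V z) : Finsupp.linearCombination F (termEval X f) z = 0 := by
  have hL : ∀ {r : ℕ} (ρ : P.obj r) (a : Fin r → Term P V),
      Finsupp.linearCombination F (termEval X f) (ρ.mapDomain fun y => Term.op y a) =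
        X.eval ρ fun i => termEval X f (a i) := by
    intro r ρ a
    rw [Finsupp.linearCombination_mapDomain, X.eval_eq_linearExtension]
    rfl
  induction hz with
  | var_add n v w =>
    simp only [map_sub, Finsupp.linearCombination_single, termEval, one_smul, map_add]
    abel
  | var_smul n c v => simp [termEval]
  | one t =>
    simp only [map_sub, Finsupp.linearCombination_single, termEval, one_smul]
    rw [hX.op_one, sub_self]
  | act g x a =>
    rw [map_sub, hL, map_sign_smul, Finsupp.linearCombination_single, one_smul, sub_eq_zero]
    exact hX.op_act g x _ _ fun i => termEval_mem hX hf (a i)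
  | comp i x y a =>
    rw [map_sub, hL, map_sign_smul, Finsupp.linearCombination_single, one_smul, sub_eq_zero,
      hX.op_comp i x y _ _ fun i => termEval_mem hX hf (a i), termEval]
    congr 2
    funext j
    refine Fin.succAboveCases i ?_ (fun j => ?_) j
    · simp [termEval]
    · simp
  | op x a i hz ih =>
    rename_i r z
    have key : ∀ z : Term P V →₀ F, Finsupp.linearCombination F (termEval X f)
        (z.mapDomain fun t => Term.op x (Function.update a i t)) =
        X.op x (Function.update (fun j => termEval X f (a j)) i
          (Finsupp.linearCombination F (termEval X f) z)) := by
      intro z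
      induction z using Finsupp.induction_linear with
      | zero => simp [MultilinearMap.map_update_zero]
      | add z w hz hw =>
        rw [Finsupp.mapDomain_add, map_add, hz, hw, map_add, MultilinearMap.map_update_add]
      | single t c =>
        rw [Finsupp.mapDomain_single, Finsupp.linearCombination_single,
          Finsupp.linearCombination_single, MultilinearMap.map_update_smul, termEval]
        congr 2
        funext j
        by_cases e : j = i
        · subst e
          simp
        · simp [e]
    rw [key, ih, MultilinearMap.map_update_zero]

/-- The morphism out of the free algebra with given values on the generators. -/
def Free.lift {X : GradedOps P A} (hX : X.IsAlgebra) (f : ∀ n : ℤ, V.X n →ₗ[F] A)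
    (hf : ∀ n v, f n v ∈ X.gr n) : Free P V →ₗ[F] A :=
  (relations P V).liftQ (Finsupp.linearCombination F (termEval X f))
    (Submodule.span_le.2 fun _ hz => linearCombination_termEval_of_rel hX hf hz)

variable {X : GradedOps P A} (hX : X.IsAlgebra) (f : ∀ n : ℤ, V.X n →ₗ[F] A)
    (hf : ∀ n v, f n v ∈ X.gr n)

lemma Free.lift_ofTerm (t : Term P V) : Free.lift hX f hf (Free.ofTerm t) = termEval X f t := by
  change Finsupp.linearCombination F (termEval X f) (Finsupp.single t 1) = _
  simp

lemma Free.lift_var (n : ℤ) (v : V.X n) : Free.lift hX f hf (Free.var P V n v) = f n v :=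
  Free.lift_ofTerm hX f hf (Term.var n v)

lemma Free.lift_op {r : ℕ} (x : P.ι r) (a : Fin r → Free P V) :
    Free.lift hX f hf ((freeAlgebra P V).op x a) = X.op x fun i => Free.lift hX f hf (a i) := by
  change ((Free.lift hX f hf).compMultilinearMap ((freeAlgebra P V).op x)) a =
    ((X.op x).compLinearMap fun _ => Free.lift hX f hf) a
  refine multilinear_eq_of_span _ _ (fun _ => Set.range Free.ofTerm) (fun a ha => ?_) a
    fun _ => by rw [Free.span_ofTerm]; exact Submodule.mem_top
  choose t ht using ha
  rw [← funext ht, LinearMap.compMultilinearMap_apply, MultilinearMap.compLinearMap_apply,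
    Free.op_ofTerm, Free.lift_ofTerm]
  simp only [Free.lift_ofTerm]
  rfl

lemma Free.lift_mem (n : ℤ) (a : Free P V) (ha : a ∈ (freeAlgebra P V).gr n) :
    Free.lift hX f hf a ∈ X.gr n := by
  change a ∈ Free.gr P V n at ha
  rw [Free.gr_eq_span] at ha
  refine (Submodule.span_le (p := (X.gr n).comap (Free.lift hX f hf))).2 ?_ ha
  rintro _ ⟨t, rfl, rfl⟩
  change Free.lift hX f hf (Free.ofTerm t) ∈ X.gr t.deg
  rw [Free.lift_ofTerm]
  exact termEval_mem hX hf t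

/-- The free algebra is spanned by the results of a single operation on generators, because
the composition relation merges iterated operations. -/
lemma Free.linear_ext_op_var {B : Type u} [AddCommGroup B] [Module F B] {f g : Free P V →ₗ[F] B}
    (h : ∀ {r : ℕ} (x : P.ι r) (n : Fin r → ℤ) (v : ∀ i, V.X (n i)),
      f ((freeAlgebra P V).op x fun i => Free.var P V (n i) (v i)) =
        g ((freeAlgebra P V).op x fun i => Free.var P V (n i) (v i))) : f = g := by
  classical
  let G : Set (Free P V) := {q | ∃ n v, Free.var P V n v = q}
  let G' : Set (Free P V) := {q | ∃ (r : ℕ) (x : P.ι r) (b : Fin r → Free P V), (∀ i, b i ∈ G) ∧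
    (freeAlgebra P V).op x b = q}
  have hG' : ∀ q ∈ G', f q = g q := by
    rintro _ ⟨r, x, b, hb, rfl⟩
    choose n v hv using hb
    rw [← funext hv]
    exact h x n v
  have hom : ∀ q ∈ G ∪ G', ∃ n, q ∈ (freeAlgebra P V).gr n := by
    rintro q (⟨n, v, rfl⟩ | ⟨r, x, b, hb, rfl⟩)
    · exact ⟨n, Free.var_mem n v⟩
    · choose n v hv using hb
      exact ⟨_, freeAlgebra_isAlgebra.op_mem x b n fun i => hv i ▸ Free.var_mem (n i) (v i)⟩
  have key : ∀ (k : ℕ) {r : ℕ} (x : P.ι r) (b : Fin r → Free P V), (∀ i, b i ∈ G ∪ G') →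
      (∑ i, if b i ∈ G then 0 else 1) = k → (freeAlgebra P V).op x b ∈ Submodule.span F G' := by
    intro k
    induction k with
    | zero =>
      intro r x b _ hk
      refine Submodule.subset_span ⟨r, x, b, fun i => ?_, rfl⟩
      by_contra hi
      have := Finset.sum_eq_zero_iff.1 hk i (Finset.mem_univ i)
      simp [hi] at this
    | succ k ih =>
      intro r x b hb hk
      obtain ⟨i, hi⟩ : ∃ i, b i ∉ G := by
        by_contra! h
        simp [h] at hk
      obtain _ | r := r
      · exact i.elim0
      obtain ⟨s, y, c, hc, hy⟩ := (hb i).resolve_left hi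
      let a : Fin (r + s) → Free P V := fun j =>
        Sum.elim (fun l => b (i.succAbove l)) c ((slotEquiv i).symm j)
      have ha₁ : (fun l => a (slotEquiv i (Sum.inl l))) = fun l => b (i.succAbove l) := by
        funext l
        simp [a]
      have ha₂ : (fun l => a (slotEquiv i (Sum.inr l))) = c := by
        funext l
        simp [a]
      have hab : i.insertNth (α := fun _ => Free P V)
          ((freeAlgebra P V).op y fun k => a (slotEquiv i (Sum.inr k)))
          (fun k => a (slotEquiv i (Sum.inl k))) = b := by
        rw [ha₁, ha₂, hy]
        exact Fin.insertNth_self_removeNth i b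
      have ha : ∀ j, a j ∈ G ∪ G' := by
        intro j
        obtain ⟨l | l, rfl⟩ := (slotEquiv i).surjective j
        · rw [congrFun ha₁ l]
          exact hb _
        · rw [congrFun ha₂ l]
          exact Or.inl (hc l)
      choose n hn using fun j => hom (a j) (ha j)
      have hcomp := freeAlgebra_isAlgebra.op_comp i x y a n hn
      rw [hab] at hcomp
      have hcard : (∑ j, if a j ∈ G then 0 else 1) = k := by
        rw [Fin.sum_univ_succAbove _ i, if_neg hi] at hk
        rw [← Equiv.sum_comp (slotEquiv i), Fintype.sum_sum_type]
        simp only [congrFun ha₁, congrFun ha₂, hc, if_true, Finset.sum_const_zero]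
        omega
      have hmem : (freeAlgebra P V).eval (P.comp i x y) a ∈ Submodule.span F G' := by
        rw [GradedOps.eval_eq_linearExtension]
        exact linearExtension_mem (fun z _ => ih z a ha hcard) (P.deg_comp i x y)
      rw [hcomp] at hmem
      rcases Int.units_eq_one_or
        (P.deg y * ∑ k : Fin (r + s) with k.val < i.val, n k).negOnePow with e | e
      · rwa [e, one_smul] at hmem
      · rw [e] at hmem
        simpa using hmem
  have top : ∀ t : Term P V, Free.ofTerm t ∈ Submodule.span F G' := by
    intro t
    induction t with
    | var n v =>
      rw [Free.ofTerm_var, ← freeAlgebra_isAlgebra.op_one (Free.var P V n v)]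
      exact Submodule.subset_span ⟨1, P.one, _, fun _ => ⟨n, v, rfl⟩, rfl⟩
    | @op r x a ih =>
      rw [← Free.op_ofTerm, ← Submodule.Quotient.mk_eq_zero]
      change ((Submodule.mkQ _).compMultilinearMap ((freeAlgebra P V).op x))
        (fun i => Free.ofTerm (a i)) = (0 : MultilinearMap F (fun _ : Fin r => Free P V) _)
          fun i => Free.ofTerm (a i)
      refine multilinear_eq_of_span _ _ (fun _ => G') (fun b hb => ?_)
        (fun i => Free.ofTerm (a i)) ih
      rw [LinearMap.compMultilinearMap_apply, Submodule.mkQ_apply, zero_apply,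
        Submodule.Quotient.mk_eq_zero]
      exact key _ x b (fun i => Or.inr (hb i)) rfl
  refine LinearMap.ext_on (s := G') ?_ hG'
  rw [eq_top_iff, ← Free.span_ofTerm, Submodule.span_le]
  rintro _ ⟨t, rfl⟩
  exact top t

end FreeAlgebra

/-! ### Sums over the inputs of a partial composite -/

section Slots

lemma slotEquiv_inl_val {r s : ℕ} (i : Fin (r + 1)) (l : Fin r) :
    (slotEquiv (s := s) i (Sum.inl l)).val = if l.val < i.val then l.val else l.val + s := by
  simp only [slotEquiv, Equiv.coe_fn_mk, Sum.elim_inl]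
  split_ifs <;> rfl

lemma slotEquiv_inr_val {r s : ℕ} (i : Fin (r + 1)) (m : Fin s) :
    (slotEquiv i (Sum.inr m)).val = i.val + m.val := rfl

lemma succAbove_val {r : ℕ} (i : Fin (r + 1)) (l : Fin r) :
    (i.succAbove l).val = if l.val < i.val then l.val else l.val + 1 := by
  simp only [Fin.succAbove, Fin.lt_def, Fin.val_castSucc]
  split_ifs <;> rfl

variable {M : Type*} [AddCommMonoid M]

lemma sum_slotEquiv {r s : ℕ} (i : Fin (r + 1)) (f : Fin (r + s) → M) :
    ∑ k, f k = ∑ l, f (slotEquiv i (Sum.inl l)) + ∑ m, f (slotEquiv i (Sum.inr m)) := by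
  rw [← Equiv.sum_comp (slotEquiv i), Fintype.sum_sum_type]

lemma sum_before_slot {r s : ℕ} (i : Fin (r + 1)) (f : Fin (r + s) → M) :
    ∑ k with k.val < i.val, f k =
      ∑ l : Fin r with l.val < i.val, f (slotEquiv i (Sum.inl l)) := by
  simp only [Finset.sum_filter]
  rw [sum_slotEquiv i]
  simp only [slotEquiv_inl_val, slotEquiv_inr_val]
  rw [Finset.sum_eq_zero (s := (Finset.univ : Finset (Fin s))) fun m _ => by simp, add_zero]
  refine Finset.sum_congr rfl fun l _ => ?_
  split_ifs <;> first | rfl | omega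

lemma sum_before_slotEquiv_inl {r s : ℕ} (i : Fin (r + 1)) (f : Fin (r + s) → M) (l : Fin r) :
    ∑ k with k < slotEquiv i (Sum.inl l), f k =
      ∑ l' with l' < l, f (slotEquiv i (Sum.inl l')) +
        if l.val < i.val then 0 else ∑ m, f (slotEquiv i (Sum.inr m)) := by
  simp only [Finset.sum_filter, Fin.lt_def]
  rw [sum_slotEquiv i]
  simp only [slotEquiv_inl_val, slotEquiv_inr_val]
  congr 1
  · refine Finset.sum_congr rfl fun l' _ => ?_
    split_ifs <;> first | rfl | omega
  · split_ifs
    · exact Finset.sum_eq_zero fun m _ => if_neg (by omega)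
    · exact Finset.sum_congr rfl fun m _ => if_pos (by omega)

lemma sum_before_slotEquiv_inr {r s : ℕ} (i : Fin (r + 1)) (f : Fin (r + s) → M) (m : Fin s) :
    ∑ k with k < slotEquiv i (Sum.inr m), f k =
      ∑ l : Fin r with l.val < i.val, f (slotEquiv i (Sum.inl l)) +
        ∑ m' with m' < m, f (slotEquiv i (Sum.inr m')) := by
  simp only [Finset.sum_filter, Fin.lt_def]
  rw [sum_slotEquiv i]
  simp only [slotEquiv_inl_val, slotEquiv_inr_val]
  congr 1
  · refine Finset.sum_congr rfl fun l' _ => ?_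
    split_ifs <;> first | rfl | omega
  · refine Finset.sum_congr rfl fun l' _ => ?_
    simp only [Nat.add_lt_add_iff_left]

lemma sum_before_insertNth {r : ℕ} (i : Fin (r + 1)) (c : M) (f : Fin r → M) :
    ∑ j with j < i, i.insertNth (α := fun _ => M) c f j = ∑ l : Fin r with l.val < i.val, f l := by
  simp only [Finset.sum_filter, Fin.lt_def]
  rw [Fin.sum_univ_succAbove _ i]
  simp only [succAbove_val, Fin.insertNth_apply_same, Fin.insertNth_apply_succAbove, lt_irrefl,
    if_false, zero_add]
  refine Finset.sum_congr rfl fun l' _ => ?_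
  split_ifs <;> first | rfl | omega

lemma sum_before_succAbove_insertNth {r : ℕ} (i : Fin (r + 1)) (c : M) (f : Fin r → M)
    (l : Fin r) : ∑ j with j < i.succAbove l, i.insertNth (α := fun _ => M) c f j =
      ∑ l' with l' < l, f l' + if l.val < i.val then 0 else c := by
  simp only [Finset.sum_filter, Fin.lt_def]
  rw [Fin.sum_univ_succAbove _ i, add_comm]
  simp only [succAbove_val, Fin.insertNth_apply_same, Fin.insertNth_apply_succAbove]
  congr 1
  · refine Finset.sum_congr rfl fun l' _ => ?_
    split_ifs <;> first | rfl | omega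
  · split_ifs <;> first | rfl | omega

lemma sum_filter_update_add_one {κ : Type*} [Fintype κ] [DecidableEq κ] (p : κ → Prop)
    [DecidablePred p] (m : κ → ℤ) (k : κ) :
    ∑ l with p l, Function.update m k (m k + 1) l =
      ∑ l with p l, m l + if p k then 1 else 0 := by
  have e : ∀ l, Function.update m k (m k + 1) l = m l + if l = k then 1 else 0 := by
    intro l
    by_cases h : l = k
    · subst h
      simp
    · simp [h]
  simp only [e, Finset.sum_add_distrib, Finset.sum_ite_eq', Finset.mem_filter, Finset.mem_univ,
    true_and]

lemma koszulSign_eq_negOnePow {r : ℕ} (g : Equiv.Perm (Fin r)) (n : Fin r → ℤ) :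
    koszulSign g n =
      (∑ p, ∑ q, if p < q ∧ g q < g p then n (g p) * n (g q) else 0).negOnePow := by
  have h : ∀ (s : Finset (Fin r × Fin r)) (f : Fin r × Fin r → ℤ),
      ∏ p ∈ s, (f p).negOnePow = (∑ p ∈ s, f p).negOnePow := by
    intro s f
    induction s using Finset.induction_on with
    | empty => simp
    | insert i s hi ih => rw [Finset.sum_insert hi, Finset.prod_insert hi, Int.negOnePow_add, ih]
  rw [koszulSign, h, Finset.sum_filter, Fintype.sum_prod_type]

/-- Change of the Koszul sign when the degree of one of the elements is raised by one. -/
lemma koszulSign_update {r : ℕ} (g : Equiv.Perm (Fin r)) (n : Fin r → ℤ) (l : Fin r) :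
    (∑ j with j < g l, n j).negOnePow * koszulSign g (Function.update n (g l) (n (g l) + 1)) =
      koszulSign g n * (∑ p with p < l, n (g p)).negOnePow := by
  rw [koszulSign_eq_negOnePow, koszulSign_eq_negOnePow, ← Int.negOnePow_add, ← Int.negOnePow_add]
  refine negOnePow_congr ?_
  have e : ∀ p, Function.update n (g l) (n (g l) + 1) (g p) = n (g p) + if p = l then 1 else 0 := by
    intro p
    by_cases h : p = l
    · subst h
      simp
    · simp [h]
  simp only [e, Finset.sum_filter]
  rw [← Equiv.sum_comp g]
  have two : (2 : ZMod 2) = 0 := rfl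
  have e₁ : ∀ p q : Fin r, (if p < q ∧ g q < g p then
      (n (g p) + if p = l then 1 else 0) * (n (g q) + if q = l then 1 else 0) else 0) =
      (if p < q ∧ g q < g p then n (g p) * n (g q) else 0) +
      (if p = l then (if l < q ∧ g q < g l then n (g q) else 0) else 0) +
      (if q = l then (if p < l ∧ g l < g p then n (g p) else 0) else 0) := by
    intro p q
    by_cases hp : p = l <;> by_cases hq : q = l
    · subst hp; subst hq; simp
    · subst hp; simp [hq]; split_ifs <;> ring
    · subst hq; simp [hp]; split_ifs <;> ring
    · simp [hp, hq]
  simp only [e₁, Finset.sum_add_distrib, Finset.sum_ite_eq', Finset.mem_univ, if_true]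
  have e₂ : ∀ f : Fin r → ℤ, ∑ p, ∑ q, (if p = l then f q else 0) = ∑ q, f q := by
    intro f
    rw [Finset.sum_comm]
    simp
  rw [e₂ fun q => if l < q ∧ g q < g l then n (g q) else 0]
  push_cast
  rw [← sub_eq_zero]
  have e₃ : ∀ p : Fin r, ((if p < l then (n (g p) : ZMod 2) else 0)) =
      (if g p < g l then (n (g p) : ZMod 2) else 0) +
      (if l < p ∧ g p < g l then (n (g p) : ZMod 2) else 0) +
      (if p < l ∧ g l < g p then (n (g p) : ZMod 2) else 0) := by
    intro p
    rcases lt_trichotomy p l with h | h | h <;> rcases lt_trichotomy (g p) (g l) with h' | h' | h'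
    all_goals first
      | (exfalso; exact h.ne (g.injective h'))
      | (exfalso; exact h.ne' (g.injective h'))
      | (subst h; exact absurd h' (lt_irrefl _))
      | skip
    · simp [h, h', h.not_gt, h'.not_gt]
    · simp [h, h', h.not_gt, h'.not_gt]
    · subst h; simp
    · simp only [h, h', h.not_gt, h'.not_gt, if_true, if_false, and_self]
      linear_combination -(n (g p) : ZMod 2) * two
    · simp [h, h', h.not_gt, h'.not_gt]
  simp only [e₃, Finset.sum_add_distrib]
  ring

end Slots

/-! ### Differential graded operads and derivations of free algebras -/

section Derivation

variable {F : Type u} [Field F]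

/-- The laws of a differential graded operad that relate the differential to the other structure
maps; the maps given on basis elements are extended linearly. -/
structure OperadData.HasDifferential (P : OperadData F) : Prop where
  d_one : P.d P.one = 0
  d_act : ∀ {r : ℕ} (g : Equiv.Perm (Fin r)) (x : P.ι r),
    linearExtension P.d (P.act g x) = linearExtension (P.act g) (P.d x)
  d_comp : ∀ {r s : ℕ} (i : Fin (r + 1)) (x : P.ι (r + 1)) (y : P.ι s),
    linearExtension P.d (P.comp i x y) = linearExtension (fun x' => P.comp i x' y) (P.d x) +
      (P.deg x).negOnePow • linearExtension (fun y' => P.comp i x y') (P.d y)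
  d_sq : ∀ {r : ℕ} (x : P.ι r), linearExtension P.d (P.d x) = 0

variable {P : OperadData F} {A : Type u} [AddCommGroup A] [Module F A]

lemma linearExtension_single {ι : Type} {M : Type u} [AddCommGroup M] [Module F M] (f : ι → M)
    (x : ι) : linearExtension (F := F) f (Finsupp.single x 1) = f x := by
  rw [Finsupp.linearCombination_single, one_smul]

lemma GradedOps.IsAlgebra.eval_act {X : GradedOps P A} (hX : X.IsAlgebra) {r : ℕ}
    (g : Equiv.Perm (Fin r)) (ρ : P.obj r) {a : Fin r → A} {n : Fin r → ℤ}
    (ha : ∀ i, a i ∈ X.gr (n i)) :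
    X.eval (linearExtension (P.act g) ρ) a = koszulSign g n • X.eval ρ fun i => a (g i) := by
  have : X.evalAt a ∘ₗ linearExtension (P.act g) =
      koszulSign g n • X.evalAt fun i => a (g i) := by
    refine Finsupp.lhom_ext' fun x => LinearMap.ext_ring ?_
    simp only [LinearMap.comp_apply, Finsupp.lsingle_apply, linearExtension_single]
    rw [Units.smul_def, LinearMap.smul_apply, GradedOps.evalAt_single, ← Units.smul_def]
    exact hX.op_act g x a n ha
  have := LinearMap.congr_fun this ρ
  rwa [LinearMap.comp_apply, Units.smul_def, LinearMap.smul_apply, ← Units.smul_def] at this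

lemma GradedOps.IsAlgebra.eval_comp_left {X : GradedOps P A} (hX : X.IsAlgebra) {r s : ℕ}
    (i : Fin (r + 1)) (ρ : P.obj (r + 1)) (y : P.ι s) {a : Fin (r + s) → A}
    {n : Fin (r + s) → ℤ} (ha : ∀ k, a k ∈ X.gr (n k)) :
    X.eval (linearExtension (fun x => P.comp i x y) ρ) a =
      (P.deg y * ∑ k : Fin (r + s) with k.val < i.val, n k).negOnePow •
        X.eval ρ (i.insertNth (α := fun _ => A) (X.op y fun k => a (slotEquiv i (Sum.inr k)))
          fun k => a (slotEquiv i (Sum.inl k))) := by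
  have : X.evalAt a ∘ₗ linearExtension (fun x => P.comp i x y) =
      (P.deg y * ∑ k : Fin (r + s) with k.val < i.val, n k).negOnePow • X.evalAt
        (i.insertNth (α := fun _ => A) (X.op y fun k => a (slotEquiv i (Sum.inr k)))
          fun k => a (slotEquiv i (Sum.inl k))) := by
    refine Finsupp.lhom_ext' fun x => LinearMap.ext_ring ?_
    simp only [LinearMap.comp_apply, Finsupp.lsingle_apply, linearExtension_single]
    rw [Units.smul_def, LinearMap.smul_apply, GradedOps.evalAt_single, ← Units.smul_def]
    exact hX.op_comp i x y a n ha
  have := LinearMap.congr_fun this ρ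
  rwa [LinearMap.comp_apply, Units.smul_def, LinearMap.smul_apply, ← Units.smul_def] at this

/-- The composition law of an algebra, for arbitrary elements of the operad. -/
lemma GradedOps.IsAlgebra.eval_comp {X : GradedOps P A} (hX : X.IsAlgebra) {r s : ℕ}
    (i : Fin (r + 1)) (ρ : P.obj (r + 1)) {σ : P.obj s} {e : ℤ}
    (hσ : σ ∈ Finsupp.supported F F {y | P.deg y = e}) {a : Fin (r + s) → A}
    {n : Fin (r + s) → ℤ} (ha : ∀ k, a k ∈ X.gr (n k)) :
    X.eval (linearExtension (fun y => linearExtension (fun x => P.comp i x y) ρ) σ) a =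
      (e * ∑ k : Fin (r + s) with k.val < i.val, n k).negOnePow •
        X.eval ρ (i.insertNth (α := fun _ => A) (X.eval σ fun k => a (slotEquiv i (Sum.inr k)))
          fun k => a (slotEquiv i (Sum.inl k))) := by
  have := eq_of_mem_supported (f := X.evalAt a ∘ₗ
      linearExtension (fun y => linearExtension (fun x => P.comp i x y) ρ))
    (g := (e * ∑ k : Fin (r + s) with k.val < i.val, n k).negOnePow •
      ((X.eval ρ).toLinearMap (i.insertNth (α := fun _ => A) 0
        fun k => a (slotEquiv i (Sum.inl k))) i ∘ₗ
          X.evalAt fun k => a (slotEquiv i (Sum.inr k)))) (fun y hy => ?_) hσ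
  · rw [LinearMap.comp_apply, Units.smul_def, LinearMap.smul_apply, ← Units.smul_def,
      LinearMap.comp_apply, MultilinearMap.toLinearMap_apply, Fin.update_insertNth] at this
    exact this
  · rw [LinearMap.comp_apply, Units.smul_def, LinearMap.smul_apply, ← Units.smul_def,
      LinearMap.comp_apply, MultilinearMap.toLinearMap_apply, Fin.update_insertNth,
      linearExtension_single, GradedOps.evalAt_single, GradedOps.evalAt_apply,
      hX.eval_comp_left i ρ y ha]
    rw [show P.deg y = e from hy]

lemma GradedOps.IsAlgebra.eval_comp_right {X : GradedOps P A} (hX : X.IsAlgebra) {r s : ℕ}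
    (i : Fin (r + 1)) (x : P.ι (r + 1)) {σ : P.obj s} {e : ℤ}
    (hσ : σ ∈ Finsupp.supported F F {y | P.deg y = e}) {a : Fin (r + s) → A}
    {n : Fin (r + s) → ℤ} (ha : ∀ k, a k ∈ X.gr (n k)) :
    X.eval (linearExtension (fun y => P.comp i x y) σ) a =
      (e * ∑ k : Fin (r + s) with k.val < i.val, n k).negOnePow •
        X.op x (i.insertNth (α := fun _ => A) (X.eval σ fun k => a (slotEquiv i (Sum.inr k)))
          fun k => a (slotEquiv i (Sum.inl k))) := by
  have := hX.eval_comp i (Finsupp.single x 1) hσ ha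
  simp only [linearExtension_single] at this
  rwa [X.eval_single_one] at this

/-- The right-hand side of the derivation relation for the element `ρ` of degree `e`, when the
values of the derivation at the arguments `aᵢ` of degree `nᵢ` are `bᵢ`. -/
def GradedOps.leibnizSum (X : GradedOps P A) {r : ℕ} (ρ : P.obj r) (e : ℤ) (n : Fin r → ℤ)
    (a b : Fin r → A) : A :=
  X.eval (linearExtension P.d ρ) a +
    ∑ i : Fin r, (e + ∑ j : Fin r with j < i, n j).negOnePow • X.eval ρ (Function.update a i (b i))

lemma mem_gr_update {gr : ℤ → Submodule F A} {r : ℕ} {a : Fin r → A} {n : Fin r → ℤ}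
    (ha : ∀ i, a i ∈ gr (n i)) {i : Fin r} {v : A} {m : ℤ} (hv : v ∈ gr m) (j : Fin r) :
    Function.update a i v j ∈ gr (Function.update n i m j) := by
  by_cases h : j = i
  · subst h
    rwa [Function.update_self, Function.update_self]
  · rw [Function.update_of_ne h, Function.update_of_ne h]
    exact ha j

lemma GradedOps.IsAlgebra.leibnizSum_act {X : GradedOps P A} (hX : X.IsAlgebra)
    (hP : P.HasDifferential) {r : ℕ} (g : Equiv.Perm (Fin r)) (x : P.ι r) {n : Fin r → ℤ}
    {a b : Fin r → A} (ha : ∀ i, a i ∈ X.gr (n i)) (hb : ∀ i, b i ∈ X.gr (n i + 1)) :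
    X.leibnizSum (P.act g x) (P.deg x) n a b = koszulSign g n •
      X.leibnizSum (Finsupp.single x 1) (P.deg x) (fun i => n (g i)) (fun i => a (g i))
        fun i => b (g i) := by
  rw [GradedOps.leibnizSum, GradedOps.leibnizSum, hP.d_act, hX.eval_act g _ ha,
    linearExtension_single, smul_add]
  congr 1
  rw [Finset.smul_sum, ← Equiv.sum_comp g]
  refine Finset.sum_congr rfl fun l _ => ?_
  rw [hX.op_act g x _ _ (mem_gr_update ha (hb (g l))), smul_smul, smul_smul, Int.negOnePow_add,
    mul_assoc, koszulSign_update, X.eval_single_one, Int.negOnePow_add,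
    mul_left_comm]
  congr 2
  funext p
  by_cases h : p = l
  · subst h
    simp
  · simp [h]

lemma GradedOps.IsAlgebra.leibnizSum_comp {X : GradedOps P A} (hX : X.IsAlgebra)
    (hP : P.HasDifferential) {r s : ℕ} (i : Fin (r + 1)) (x : P.ι (r + 1)) (y : P.ι s)
    {n : Fin (r + s) → ℤ} {a b : Fin (r + s) → A}
    (ha : ∀ k, a k ∈ X.gr (n k)) (hb : ∀ k, b k ∈ X.gr (n k + 1)) :
    X.leibnizSum (P.comp i x y) (P.deg x + P.deg y) n a b =
      (P.deg y * ∑ k : Fin (r + s) with k.val < i.val, n k).negOnePow •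
        X.leibnizSum (Finsupp.single x 1) (P.deg x)
          (i.insertNth (α := fun _ => ℤ) (∑ k, n (slotEquiv i (Sum.inr k)) - P.deg y)
            fun k => n (slotEquiv i (Sum.inl k)))
          (i.insertNth (α := fun _ => A) (X.op y fun k => a (slotEquiv i (Sum.inr k)))
            fun k => a (slotEquiv i (Sum.inl k)))
          (i.insertNth (α := fun _ => A) (X.leibnizSum (Finsupp.single y 1) (P.deg y)
            (fun k => n (slotEquiv i (Sum.inr k))) (fun k => a (slotEquiv i (Sum.inr k)))
            fun k => b (slotEquiv i (Sum.inr k))) fun k => b (slotEquiv i (Sum.inl k))) := by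
  simp only [GradedOps.leibnizSum, linearExtension_single]
  rw [hP.d_comp, X.eval_add, add_apply, hX.eval_comp_left i _ y ha,
    X.eval_sign_smul, multilinear_sign_smul_apply, hX.eval_comp_right i x (P.deg_d y) ha,
    smul_add, add_assoc]
  congr 1
  rw [Fin.sum_univ_succAbove _ i, sum_slotEquiv i]
  simp only [Fin.insertNth_apply_same, Fin.insertNth_apply_succAbove, sum_before_insertNth,
    sum_before_succAbove_insertNth, sum_before_slotEquiv_inl, sum_before_slotEquiv_inr,
    X.eval_single_one, Fin.update_insertNth]
  rw [add_left_comm, add_comm, smul_add]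
  have two : (2 : ZMod 2) = 0 := rfl
  congr 1
  · have hL : ∀ v, X.op x (i.insertNth (α := fun _ => A) v fun k => a (slotEquiv i (Sum.inl k))) =
        (X.op x).toLinearMap (i.insertNth (α := fun _ => A) 0
          fun k => a (slotEquiv i (Sum.inl k))) i v := by
      intro v
      rw [MultilinearMap.toLinearMap_apply, Fin.update_insertNth]
    rw [hL, hL, map_add, smul_add, smul_add, smul_smul, smul_smul, ← Int.negOnePow_add,
      ← Int.negOnePow_add, map_sum, Finset.smul_sum, Finset.smul_sum, sum_before_slot (M := ℤ) i]
    congr 1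
    · congr 1
      refine negOnePow_congr ?_
      push_cast
      linear_combination -(∑ l : Fin r with l.val < i.val,
        (n (slotEquiv i (Sum.inl l)) : ZMod 2)) * two
    · refine Finset.sum_congr rfl fun m _ => ?_
      rw [hX.op_comp i x y _ _ (mem_gr_update ha (hb _)), update_slotEquiv_inr,
        update_slotEquiv_inr_inl, sum_before_slot (M := ℤ) i, map_sign_smul, ← hL, smul_smul, smul_smul, smul_smul,
        ← Int.negOnePow_add, ← Int.negOnePow_add, ← Int.negOnePow_add]
      congr 2
      have e : ∀ j, Function.update n (slotEquiv i (Sum.inr m)) (n (slotEquiv i (Sum.inr m)) + 1)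
          (slotEquiv i (Sum.inl j)) = n (slotEquiv i (Sum.inl j)) :=
        congrFun (update_slotEquiv_inr_inl i n m (n (slotEquiv i (Sum.inr m)) + 1))
      simp only [e]
      ring
  · rw [Finset.smul_sum]
    refine Finset.sum_congr rfl fun l _ => ?_
    rw [hX.op_comp i x y _ _ (mem_gr_update ha (hb _)), update_slotEquiv_inl,
      update_slotEquiv_inl_inr, sum_before_slot (M := ℤ) i, sum_before_slot (M := ℤ) i, Fin.insertNth_update,
      smul_smul, smul_smul, ← Int.negOnePow_add, ← Int.negOnePow_add]
    congr 1
    have e : ∀ j, Function.update n (slotEquiv i (Sum.inl l)) (n (slotEquiv i (Sum.inl l)) + 1)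
        (slotEquiv i (Sum.inl j)) = Function.update (fun j => n (slotEquiv i (Sum.inl j))) l
          (n (slotEquiv i (Sum.inl l)) + 1) j :=
      congrFun (update_slotEquiv_inl i n l _)
    simp only [e]
    rw [sum_filter_update_add_one (fun j : Fin r => j.val < i.val)
      (fun j => n (slotEquiv i (Sum.inl j))) l]
    refine negOnePow_congr ?_
    split_ifs
    · push_cast
      linear_combination (P.deg y : ZMod 2) * two
    · push_cast
      linear_combination (P.deg y : ZMod 2) * two

end Derivation

section Derivation

variable {F : Type u} [Field F] {P : OperadData F} {V : CochainComplex (ModuleCat.{u} F) ℤ}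
  {A : Type u} [AddCommGroup A] [Module F A]

/-- The value on formal composites of the derivation of the free algebra with given values on the
generators. -/
def termDer (h : ∀ n : ℤ, V.X n →ₗ[F] Free P V) : Term P V → Free P V
  | .var n v => h n v
  | .op x a => (freeAlgebra P V).leibnizSum (Finsupp.single x 1) (P.deg x) (fun i => (a i).deg)
      (fun i => Free.ofTerm (a i)) fun i => termDer h (a i)

lemma GradedOps.IsAlgebra.leibnizSum_mem {X : GradedOps P A} (hX : X.IsAlgebra) {r : ℕ}
    (x : P.ι r) {n : Fin r → ℤ} {a b : Fin r → A} (ha : ∀ i, a i ∈ X.gr (n i))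
    (hb : ∀ i, b i ∈ X.gr (n i + 1)) :
    X.leibnizSum (Finsupp.single x 1) (P.deg x) n a b ∈ X.gr (∑ i, n i - P.deg x + 1) := by
  refine add_mem ?_ (Submodule.sum_mem _ fun i _ => units_smul_mem F _ _ ?_)
  · rw [linearExtension_single]
    have := hX.eval_mem (P.deg_d x) ha
    rwa [← sub_add] at this
  · rw [X.eval_single_one]
    have := hX.op_mem x (Function.update a i (b i)) _ (mem_gr_update ha (hb i))
    rwa [Finset.sum_update_of_mem (Finset.mem_univ i), add_right_comm, ← Finset.sum_update_of_mem
      (Finset.mem_univ i), Function.update_eq_self, add_sub_right_comm] at this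

lemma termDer_mem {h : ∀ n : ℤ, V.X n →ₗ[F] Free P V}
    (hh : ∀ n v, h n v ∈ (freeAlgebra P V).gr (n + 1)) (t : Term P V) :
    termDer h t ∈ (freeAlgebra P V).gr (t.deg + 1) := by
  induction t with
  | var n v => exact hh n v
  | op x a ih =>
    exact freeAlgebra_isAlgebra.leibnizSum_mem x (fun i => Free.ofTerm_mem (a i)) ih

lemma ofTerm_update {r : ℕ} (a : Fin r → Term P V) (i : Fin r) (t : Term P V) :
    (fun j => Free.ofTerm (Function.update a i t j)) =
      Function.update (fun j => Free.ofTerm (a j)) i (Free.ofTerm t) := by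
  funext j
  by_cases e : j = i
  · subst e
    simp
  · simp [e]

lemma linearCombination_termDer_op (h : ∀ n : ℤ, V.X n →ₗ[F] Free P V) {r : ℕ} {ρ : P.obj r} {e : ℤ}
    (hρ : ρ ∈ Finsupp.supported F F {y | P.deg y = e}) (a : Fin r → Term P V) :
    Finsupp.linearCombination F (termDer h) (ρ.mapDomain fun y => Term.op y a) =
      (freeAlgebra P V).leibnizSum ρ e (fun i => (a i).deg) (fun i => Free.ofTerm (a i))
        fun i => termDer h (a i) := by
  let R : P.obj r →ₗ[F] Free P V :=
    (freeAlgebra P V).evalAt (fun i => Free.ofTerm (a i)) ∘ₗ linearExtension P.d +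
      ∑ i : Fin r, (e + ∑ j : Fin r with j < i, (a j).deg).negOnePow •
        (freeAlgebra P V).evalAt
          (Function.update (fun i => Free.ofTerm (a i)) i (termDer h (a i)))
  have hR : ∀ ρ, R ρ = (freeAlgebra P V).leibnizSum ρ e (fun i => (a i).deg)
      (fun i => Free.ofTerm (a i)) fun i => termDer h (a i) := by
    intro ρ
    simp only [R, LinearMap.add_apply, LinearMap.sum_apply, LinearMap.comp_apply, Units.smul_def,
      LinearMap.smul_apply, GradedOps.evalAt_apply, GradedOps.leibnizSum]
  rw [← hR, Finsupp.linearCombination_mapDomain]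
  refine eq_of_mem_supported (f := Finsupp.linearCombination F
    (termDer h ∘ fun y : P.ι r => Term.op y a)) (fun x hx => ?_) hρ
  rw [hR, Finsupp.linearCombination_single, one_smul, ← show P.deg x = e from hx]
  rfl

lemma linearCombination_termDer_of_rel (hP : P.HasDifferential)
    {h : ∀ n : ℤ, V.X n →ₗ[F] Free P V} (hh : ∀ n v, h n v ∈ (freeAlgebra P V).gr (n + 1))
    {z : Term P V →₀ F} (hz : Rel P V z) :
    Finsupp.linearCombination F (termDer h) z = 0 := by
  induction hz with
  | var_add n v w =>
    simp only [map_sub, Finsupp.linearCombination_single, termDer, one_smul, map_add]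
    abel
  | var_smul n c v => simp [termDer]
  | one t =>
    simp only [map_sub, Finsupp.linearCombination_single, termDer, one_smul, sub_eq_zero,
      GradedOps.leibnizSum, hP.d_one, GradedOps.eval_zero, GradedOps.eval_single_one,
      zero_apply, zero_add, P.deg_one, Finset.univ_unique, Finset.sum_singleton]
    have e : Function.update (fun _ : Fin 1 => Free.ofTerm t) default (termDer h t) =
        fun _ => termDer h t := by
      funext i
      rw [Subsingleton.elim i default, Function.update_self]
    rw [e, freeAlgebra_isAlgebra.op_one]
    simp
  | act g x a =>
    rw [map_sub, linearCombination_termDer_op h (P.deg_act g x), map_sign_smul,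
      Finsupp.linearCombination_single, one_smul, sub_eq_zero]
    exact freeAlgebra_isAlgebra.leibnizSum_act hP g x (fun i => Free.ofTerm_mem (a i))
      fun i => termDer_mem hh (a i)
  | comp i x y a =>
    rw [map_sub, linearCombination_termDer_op h (P.deg_comp i x y), map_sign_smul,
      Finsupp.linearCombination_single, one_smul, sub_eq_zero,
      freeAlgebra_isAlgebra.leibnizSum_comp hP i x y (fun i => Free.ofTerm_mem (a i))
      fun i => termDer_mem hh (a i), termDer]
    congr 2
    · funext j
      refine Fin.succAboveCases i ?_ (fun j => ?_) j
      · simp [Term.deg]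
      · simp
    · funext j
      refine Fin.succAboveCases i ?_ (fun j => ?_) j
      · rw [Fin.insertNth_apply_same, Fin.insertNth_apply_same, Free.op_ofTerm]
      · simp
    · funext j
      refine Fin.succAboveCases i ?_ (fun j => ?_) j
      · simp [termDer]
      · simp
  | op x a i hz ih =>
    rename_i r z
    obtain ⟨m, hm⟩ := Rel.homogeneous hz
    -- The derivation relation at `x(a₁, …, z, …, a_r)`, as a linear map in the argument `z`.
    let R : (Term P V →₀ F) →ₗ[F] Free P V :=
      ((freeAlgebra P V).eval (P.d x)).toLinearMap (fun j => Free.ofTerm (a j)) i ∘ₗ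
          (relations P V).mkQ +
        ∑ j : Fin r, (P.deg x + ∑ k : Fin r with k < j,
          Function.update (fun k => (a k).deg) i m k).negOnePow •
          if j = i then ((freeAlgebra P V).op x).toLinearMap (fun j => Free.ofTerm (a j)) i ∘ₗ
              Finsupp.linearCombination F (termDer h)
            else ((freeAlgebra P V).op x).toLinearMap
              (Function.update (fun j => Free.ofTerm (a j)) j (termDer h (a j))) i ∘ₗ
                (relations P V).mkQ
    have hR : Finsupp.linearCombination F (termDer h)
        (z.mapDomain fun t => Term.op x (Function.update a i t)) = R z := by
      rw [Finsupp.linearCombination_mapDomain]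
      refine eq_of_mem_supported (f := Finsupp.linearCombination F
        (termDer h ∘ fun t => Term.op x (Function.update a i t))) (fun t ht => ?_) hm
      have ht : t.deg = m := ht
      have hdeg : (fun j => (Function.update a i t j).deg) =
          Function.update (fun k => (a k).deg) i m := by
        funext j
        by_cases e : j = i
        · subst e
          simpa using ht
        · simp [e]
      rw [Finsupp.linearCombination_single, one_smul, Function.comp_apply, termDer]
      simp only [R, LinearMap.add_apply, LinearMap.sum_apply, LinearMap.comp_apply,
        Units.smul_def, LinearMap.smul_apply, GradedOps.leibnizSum, linearExtension_single,
        ofTerm_update, MultilinearMap.toLinearMap_apply, GradedOps.eval_single_one]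
      congr 1
      refine Finset.sum_congr rfl fun j _ => ?_
      rw [← hdeg]
      congr 1
      by_cases e : j = i
      · subst e
        rw [if_pos rfl, LinearMap.comp_apply, MultilinearMap.toLinearMap_apply,
          Finsupp.linearCombination_single, one_smul, Function.update_self, Function.update_idem]
      · rw [if_neg e, LinearMap.comp_apply, MultilinearMap.toLinearMap_apply,
          Function.update_of_ne e, Function.update_comm e]
        rfl
    have hz' : (relations P V).mkQ z = 0 := by
      rw [Submodule.mkQ_apply, Submodule.Quotient.mk_eq_zero]
      exact Submodule.subset_span hz
    rw [hR]
    simp only [R, LinearMap.add_apply, LinearMap.sum_apply, LinearMap.comp_apply, hz', map_zero,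
      zero_add, Units.smul_def, LinearMap.smul_apply]
    refine Finset.sum_eq_zero fun j _ => ?_
    split_ifs
    · rw [LinearMap.comp_apply, ih, map_zero, smul_zero]
    · rw [LinearMap.comp_apply, hz', map_zero, smul_zero]

/-- The derivation of the free algebra with given values on the generators. -/
def Free.der (hP : P.HasDifferential) (h : ∀ n : ℤ, V.X n →ₗ[F] Free P V)
    (hh : ∀ n v, h n v ∈ (freeAlgebra P V).gr (n + 1)) : Free P V →ₗ[F] Free P V :=
  (relations P V).liftQ (Finsupp.linearCombination F (termDer h))
    (Submodule.span_le.2 fun _ hz => linearCombination_termDer_of_rel hP hh hz)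

/-- The derivation relation of degree one, without the condition that the square vanishes. -/
structure GradedOps.IsDerivation (X : GradedOps P A) (d : A →ₗ[F] A) : Prop where
  mem : ∀ (n : ℤ) (a : A), a ∈ X.gr n → d a ∈ X.gr (n + 1)
  leibniz : ∀ {r : ℕ} (x : P.ι r) (a : Fin r → A) (n : Fin r → ℤ), (∀ i, a i ∈ X.gr (n i)) →
    d (X.op x a) = X.leibnizSum (Finsupp.single x 1) (P.deg x) n a fun i => d (a i)

lemma GradedOps.IsDifferential.isDerivation {X : GradedOps P A} {d : A →ₗ[F] A}
    (hd : X.IsDifferential d) : X.IsDerivation d where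
  mem := hd.mem
  leibniz x a n ha := by
    rw [GradedOps.leibnizSum, linearExtension_single, X.eval_single_one]
    exact hd.leibniz x a n ha

lemma GradedOps.IsDerivation.isDifferential {X : GradedOps P A} {d : A →ₗ[F] A}
    (hd : X.IsDerivation d) (sq : ∀ a, d (d a) = 0) : X.IsDifferential d where
  mem := hd.mem
  sq := sq
  leibniz x a n ha := by
    have := hd.leibniz x a n ha
    rwa [GradedOps.leibnizSum, linearExtension_single, X.eval_single_one] at this

/-- The derivation relation for arbitrary homogeneous elements of the operad. -/
lemma GradedOps.IsDerivation.eval {X : GradedOps P A} {d : A →ₗ[F] A} (hd : X.IsDerivation d)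
    {r : ℕ} {ρ : P.obj r} {e : ℤ} (hρ : ρ ∈ Finsupp.supported F F {y | P.deg y = e})
    {a : Fin r → A} {n : Fin r → ℤ} (ha : ∀ i, a i ∈ X.gr (n i)) :
    d (X.eval ρ a) = X.leibnizSum ρ e n a fun i => d (a i) := by
  let R : P.obj r →ₗ[F] A := X.evalAt a ∘ₗ linearExtension P.d +
      ∑ i : Fin r, (e + ∑ j : Fin r with j < i, n j).negOnePow •
        X.evalAt (Function.update a i (d (a i)))
  have hR : ∀ ρ, R ρ = X.leibnizSum ρ e n a fun i => d (a i) := by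
    intro ρ
    simp only [R, LinearMap.add_apply, LinearMap.sum_apply, LinearMap.comp_apply, Units.smul_def,
      LinearMap.smul_apply, GradedOps.evalAt_apply, GradedOps.leibnizSum]
  rw [← hR, ← X.evalAt_apply, ← LinearMap.comp_apply]
  refine eq_of_mem_supported (fun x hx => ?_) hρ
  rw [hR, LinearMap.comp_apply, X.evalAt_single, hd.leibniz x a n ha,
    ← show P.deg x = e from hx]

variable (hP : P.HasDifferential) (h : ∀ n : ℤ, V.X n →ₗ[F] Free P V)
    (hh : ∀ n v, h n v ∈ (freeAlgebra P V).gr (n + 1))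

lemma Free.der_ofTerm (t : Term P V) : Free.der hP h hh (Free.ofTerm t) = termDer h t := by
  change Finsupp.linearCombination F (termDer h) (Finsupp.single t 1) = _
  simp

lemma Free.der_var (n : ℤ) (v : V.X n) : Free.der hP h hh (Free.var P V n v) = h n v :=
  Free.der_ofTerm hP h hh (Term.var n v)

lemma Free.der_isDerivation : (freeAlgebra P V).IsDerivation (Free.der hP h hh) where
  mem n a ha := by
    change a ∈ Free.gr P V n at ha
    rw [Free.gr_eq_span] at ha
    refine (Submodule.span_le (p := ((freeAlgebra P V).gr (n + 1)).comap
      (Free.der hP h hh))).2 ?_ ha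
    rintro _ ⟨t, rfl, rfl⟩
    change Free.der hP h hh (Free.ofTerm t) ∈ (freeAlgebra P V).gr (t.deg + 1)
    rw [Free.der_ofTerm]
    exact termDer_mem hh t
  leibniz {r} x a n ha := by
    have := Free.multilinear_ext
      (f := (Free.der hP h hh).compMultilinearMap ((freeAlgebra P V).op x))
      (g := (freeAlgebra P V).eval (P.d x) +
        ∑ i : Fin r, (P.deg x + ∑ j : Fin r with j < i, n j).negOnePow •
          multilinearAt ((freeAlgebra P V).op x) (Free.der hP h hh) i) (n := n) (fun t ht => ?_) ha
    · rw [LinearMap.compMultilinearMap_apply] at this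
      rw [this]
      simp only [add_apply, _root_.sum_apply, multilinear_sign_smul_apply, multilinearAt_apply,
        GradedOps.leibnizSum, linearExtension_single, GradedOps.eval_single_one]
    · simp only [← ht, add_apply, _root_.sum_apply, multilinear_sign_smul_apply, multilinearAt_apply,
        LinearMap.compMultilinearMap_apply, Free.op_ofTerm, Free.der_ofTerm, termDer,
        GradedOps.leibnizSum, linearExtension_single, GradedOps.eval_single_one]

/-- Two derivations of the free algebra which agree on the generators are equal. -/
lemma Free.derivation_ext {d d' : Free P V →ₗ[F] Free P V}
    (hd : (freeAlgebra P V).IsDerivation d) (hd' : (freeAlgebra P V).IsDerivation d')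
    (h : ∀ (n : ℤ) (v : V.X n), d (Free.var P V n v) = d' (Free.var P V n v)) : d = d' := by
  refine Free.linear_ext h fun x a n ha e => ?_
  rw [hd.leibniz x a n ha, hd'.leibniz x a n ha]
  simp only [e]

/-- The square of a derivation of degree one vanishes on an operation as soon as it vanishes on the
arguments. -/
lemma GradedOps.IsDerivation.sq_op {X : GradedOps P A} {d : A →ₗ[F] A} (hd : X.IsDerivation d)
    (hP : P.HasDifferential) {r : ℕ} (x : P.ι r) {a : Fin r → A} {n : Fin r → ℤ}
    (ha : ∀ i, a i ∈ X.gr (n i)) (hsq : ∀ i, d (d (a i)) = 0) : d (d (X.op x a)) = 0 := by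
  have hup : ∀ i j, Function.update a i (d (a i)) j ∈ X.gr (Function.update n i (n i + 1) j) :=
    fun i => mem_gr_update ha (hd.mem _ _ (ha i))
  rw [hd.leibniz x a n ha, GradedOps.leibnizSum, linearExtension_single, X.eval_single_one,
    map_add, hd.eval (P.deg_d x) ha, GradedOps.leibnizSum, hP.d_sq, X.eval_zero, zero_apply,
    zero_add, map_sum]
  simp only [map_sign_smul]
  have e₁ : ∀ i, d (X.op x (Function.update a i (d (a i)))) =
      X.eval (P.d x) (Function.update a i (d (a i))) +
        ∑ j, if j = i then 0 else (P.deg x + (∑ k with k < j, n k + if i < j then 1 else 0)).negOnePow •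
          X.op x (Function.update (Function.update a i (d (a i))) j (d (a j))) := by
    intro i
    rw [hd.leibniz x _ _ (hup i), GradedOps.leibnizSum, linearExtension_single, X.eval_single_one]
    congr 1
    refine Finset.sum_congr rfl fun j _ => ?_
    by_cases e : j = i
    · subst e
      rw [if_pos rfl, Function.update_self, hsq, MultilinearMap.map_update_zero, smul_zero]
    · rw [if_neg e, Function.update_of_ne e, sum_filter_update_add_one (fun k => k < j) n i]
  simp only [e₁, smul_add, Finset.sum_add_distrib, Finset.smul_sum]
  rw [← add_assoc]
  have e₂ : ∑ i, (P.deg x - 1 + ∑ j with j < i, n j).negOnePow •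
      X.eval (P.d x) (Function.update a i (d (a i))) +
      ∑ i, (P.deg x + ∑ j with j < i, n j).negOnePow •
        X.eval (P.d x) (Function.update a i (d (a i))) = 0 := by
    rw [← Finset.sum_add_distrib]
    refine Finset.sum_eq_zero fun i _ => ?_
    have : (P.deg x + ∑ j with j < i, n j) = (P.deg x - 1 + ∑ j with j < i, n j) + 1 := by ring
    rw [this, Int.negOnePow_succ, Units.neg_smul, add_neg_cancel]
  rw [e₂, zero_add]
  -- The terms in which two different arguments are differentiated cancel in pairs.
  rw [← Fintype.sum_prod_type']
  refine Finset.sum_involution (fun p _ => (p.2, p.1)) (fun p _ => ?_) (fun p _ hp => ?_)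
    (fun _ _ => Finset.mem_univ _) fun _ _ => rfl
  · by_cases e : p.2 = p.1
    · simp [e]
    · rw [if_neg e, if_neg (Ne.symm e), smul_smul, smul_smul, ← Int.negOnePow_add,
        ← Int.negOnePow_add, Function.update_comm e]
      obtain ⟨i, j⟩ := p
      simp only at e ⊢
      have hs : ∀ (m m' : ℤ) (v : A), m = m' + 1 → m.negOnePow • v + m'.negOnePow • v = 0 := by
        rintro m m' v rfl
        rw [Int.negOnePow_succ, Units.neg_smul, neg_add_cancel]
      rcases lt_or_gt_of_ne e with h | h
      · rw [if_neg h.not_gt, if_pos h, add_comm]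
        exact hs _ _ _ (by ring)
      · rw [if_pos h, if_neg h.not_gt]
        exact hs _ _ _ (by ring)
  · intro e
    have : p.2 = p.1 := congrArg Prod.fst e
    simp [this] at hp

end Derivation

/-! ### Suspension and desuspension of algebras -/

section Suspension

variable {F : Type u} [Field F] {P : OperadData F} {A B : Type u} [AddCommGroup A] [Module F A]
  [AddCommGroup B] [Module F B]

/-- The exponent of the sign that relates an operation of degree `d` on `A` and on `Σ^*A`, where
`n j` is the degree of the argument `j` in `Σ^*A`. -/
def suspExponent (r : ℕ) (d : ℤ) (n : Fin r → ℤ) : ℤ :=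
  ((r : ℤ) - 1) * d + ∑ j : Fin r, ((r : ℤ) - 1 - j.val) * n j

lemma GradedOps.suspension_op (X : GradedOps P A) {r : ℕ} (x : P.ι r) {a : Fin r → A}
    {n : Fin r → ℤ} (ha : ∀ i, a i ∈ X.gr (n i - 1)) :
    X.suspension.op (r := r) x a = (suspExponent r (P.deg x) n).negOnePow • X.op x a := by
  change ((((r : ℤ) - 1) * P.deg x).negOnePow • (X.op (r := r) x).compLinearMap fun j =>
      parity (fun n => X.gr (n - 1)) (internal_shift X.gr X.internal) ^ (r - 1 - j.val)) a = _
  rw [multilinear_sign_smul_apply, MultilinearMap.compLinearMap_apply]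
  simp only [parity_pow_apply (gr := fun n => X.gr (n - 1)) (internal_shift X.gr X.internal) (ha _)]
  rw [multilinear_map_sign_smul, smul_smul, ← Int.negOnePow_add, suspExponent]
  congr 3
  refine Finset.sum_congr rfl fun j _ => ?_
  rw [Nat.sub_sub, Nat.cast_sub (by omega)]
  push_cast
  ring

lemma GradedOps.suspension_eval (X : GradedOps P A) {r : ℕ} {ρ : P.obj r} {e : ℤ}
    (hρ : ρ ∈ Finsupp.supported F F {y | P.deg y = e}) {a : Fin r → A}
    {n : Fin r → ℤ} (ha : ∀ i, a i ∈ X.gr (n i - 1)) :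
    X.suspension.eval (r := r) ρ a = (suspExponent r e n).negOnePow • X.eval ρ a := by
  let f : (P.ι r →₀ F) →ₗ[F] A := X.suspension.evalAt a
  let g : (P.ι r →₀ F) →ₗ[F] A := ((suspExponent r e n).negOnePow : ℤ) • X.evalAt a
  have hf : ∀ x : P.ι r, f (Finsupp.single x 1) = X.suspension.op (r := r) x a := fun x =>
    X.suspension.evalAt_single (r := r) a x
  have hfg : ∀ x ∈ {x : P.ι r | P.deg x = e}, f (Finsupp.single x 1) = g (Finsupp.single x 1) := by
    intro x hx
    rw [hf, X.suspension_op x ha, LinearMap.smul_apply, X.evalAt_single, Units.smul_def,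
      show P.deg x = e from hx]
  exact eq_of_mem_supported hfg hρ

lemma sign_smul_eq_iff {s₁ s₂ s₃ : ℤˣ} {a b : A} (h : s₂ = s₁ * s₃) :
    s₁ • a = s₂ • b ↔ a = s₃ • b := by
  rw [h, mul_smul]
  exact (MulAction.injective s₁).eq_iff

lemma sign_smul_mem_iff (p : Submodule F A) (s : ℤˣ) {a : A} : s • a ∈ p ↔ a ∈ p := by
  rcases Int.units_eq_one_or s with rfl | rfl <;> simp

lemma sum_lt_one {r : ℕ} (i : ℕ) (hi : i ≤ r) : (∑ l : Fin r with l.val < i, (1 : ℤ)) = i := by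
  rw [Finset.sum_const, nsmul_eq_mul, mul_one, Nat.cast_inj, Fin.card_filter_val_lt]
  omega

lemma sign_eq_negOnePow {r : ℕ} (g : Equiv.Perm (Fin r)) :
    Equiv.Perm.sign g = (∑ p, ∑ q, if p < q ∧ g q < g p then (1 : ℤ) else 0).negOnePow := by
  have := koszulSign_eq_negOnePow g fun _ => 1
  simp only [mul_one] at this
  rw [← this, koszulSign, g.sign_eq_prod_prod_Ioi]
  simp only [mul_one, Int.negOnePow_one]
  rw [Finset.prod_filter, Fintype.prod_prod_type]
  refine Finset.prod_congr rfl fun p _ => ?_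
  rw [← Finset.filter_lt_eq_Ioi, Finset.prod_filter]
  refine Finset.prod_congr rfl fun q _ => ?_
  by_cases h : p < q
  · rcases lt_or_gt_of_ne (g.injective.ne h.ne) with h' | h' <;> simp [h, h', h'.not_gt]
  · simp [h]

/-- The signs of the suspension turn the Koszul signs of a permutation of the arguments in `A` into
those for `Σ^*A`, up to the signature. -/
lemma suspExponent_act {r : ℕ} (g : Equiv.Perm (Fin r)) (d : ℤ) (n : Fin r → ℤ) :
    koszulSign g n * (suspExponent r d fun i => n (g i)).negOnePow =
      Equiv.Perm.sign g * (suspExponent r d n).negOnePow * koszulSign g fun i => n i - 1 := by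
  have two : (2 : ZMod 2) = 0 := rfl
  rw [sign_eq_negOnePow, koszulSign_eq_negOnePow, koszulSign_eq_negOnePow, suspExponent,
    suspExponent, ← Equiv.sum_comp g fun j => ((r : ℤ) - 1 - j.val) * n j]
  simp only [← Int.negOnePow_add]
  refine negOnePow_congr ?_
  -- The number of inversions of `g` at `p` is congruent to `g p - p`.
  have hinv : ∀ p : Fin r, (((g p).val : ZMod 2) + p.val) =
      ∑ q, ((if p < q ∧ g q < g p then 1 else 0) + if q < p ∧ g p < g q then 1 else 0) := by
    intro p
    have h₁ : ((p.val : ℤ) : ZMod 2) = ∑ q : Fin r, if q < p then 1 else 0 := by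
      rw [← sum_lt_one p.val p.2.le, Finset.sum_filter]
      push_cast
      rfl
    have h₂ : (((g p).val : ℤ) : ZMod 2) = ∑ q : Fin r, if g q < g p then 1 else 0 := by
      rw [← sum_lt_one (g p).val (g p).2.le, Finset.sum_filter, ← Equiv.sum_comp g]
      push_cast
      rfl
    push_cast at h₁ h₂
    rw [h₁, h₂, ← Finset.sum_add_distrib]
    refine Finset.sum_congr rfl fun q _ => ?_
    rcases lt_trichotomy p q with h | h | h
    · rcases lt_or_gt_of_ne (g.injective.ne h.ne) with h' | h' <;>
        simp [h, h', h.not_gt, h'.not_gt]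
    · subst h
      simp
    · rcases lt_or_gt_of_ne (g.injective.ne h.ne) with h' | h'
      · simp only [h, h', h.not_gt, h'.not_gt, if_true, false_and, and_false, if_false]
        linear_combination two
      · simp [h, h', h.not_gt, h'.not_gt]
  have hK : ∑ p, ∑ q, (if p < q ∧ g q < g p then ((n (g p) : ZMod 2) - 1) * (n (g q) - 1) else 0) =
      ∑ p, ∑ q, (if p < q ∧ g q < g p then (n (g p) : ZMod 2) * n (g q) else 0) +
      ∑ p, ∑ q, (if p < q ∧ g q < g p then 1 else 0) +
        ∑ p, (n (g p) : ZMod 2) * ((g p).val + p.val) := by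
    have : ∑ p, (n (g p) : ZMod 2) * ((g p).val + p.val) =
        ∑ p, ∑ q, (if p < q ∧ g q < g p then (n (g p) : ZMod 2) + n (g q) else 0) := by
      simp only [hinv, Finset.mul_sum, mul_add, Finset.sum_add_distrib]
      rw [Finset.sum_comm (f := fun p q : Fin r =>
        (n (g p) : ZMod 2) * if q < p ∧ g p < g q then 1 else 0)]
      rw [← Finset.sum_add_distrib]
      refine Finset.sum_congr rfl fun p _ => ?_
      rw [← Finset.sum_add_distrib]
      refine Finset.sum_congr rfl fun q _ => ?_
      split_ifs <;> ring
    rw [this, ← Finset.sum_add_distrib, ← Finset.sum_add_distrib]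
    refine Finset.sum_congr rfl fun p _ => ?_
    rw [← Finset.sum_add_distrib, ← Finset.sum_add_distrib]
    refine Finset.sum_congr rfl fun q _ => ?_
    split_ifs
    · linear_combination -((n (g p) : ZMod 2) + n (g q)) * two
    · ring
  push_cast
  rw [hK]
  have hS : ∑ p, ((r : ZMod 2) - 1 - p.val) * n (g p) =
      ∑ p, ((r : ZMod 2) - 1 - (g p).val) * n (g p) +
        ∑ p, (n (g p) : ZMod 2) * ((g p).val + p.val) := by
    rw [← Finset.sum_add_distrib]
    refine Finset.sum_congr rfl fun p _ => ?_
    linear_combination -(p.val * n (g p) : ZMod 2) * two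
  rw [hS]
  linear_combination -(∑ p, ∑ q, (if p < q ∧ g q < g p then (1 : ZMod 2) else 0)) * two

/-- The signs of the suspension turn the Koszul sign of a partial composite in `A` into the one for
`Σ^*A`, up to the sign of the partial composite in `Λ^*P`. -/
lemma suspExponent_comp {r s : ℕ} (i : Fin (r + 1)) (dx dy : ℤ) (n : Fin (r + s) → ℤ) :
    ((dy + (s - 1)) * ∑ k : Fin (r + s) with k.val < i.val, n k).negOnePow *
        (suspExponent (r + 1) dx (i.insertNth (α := fun _ => ℤ)
          (∑ k, n (slotEquiv i (Sum.inr k)) - (dy + (s - 1)))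
            fun k => n (slotEquiv i (Sum.inl k)))).negOnePow *
          (suspExponent s dy fun k => n (slotEquiv i (Sum.inr k))).negOnePow =
      (((s : ℤ) - 1) * (dx + r - i.val)).negOnePow *
        (suspExponent (r + s) (dx + dy) n).negOnePow *
          (dy * ∑ k : Fin (r + s) with k.val < i.val, (n k - 1)).negOnePow := by
  simp only [← Int.negOnePow_add]
  refine negOnePow_congr ?_
  have two : (2 : ZMod 2) = 0 := rfl
  have hU : ∑ k : Fin (r + s) with k.val < i.val, (n k - 1) =
      ∑ k : Fin (r + s) with k.val < i.val, n k - i.val := by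
    rw [Finset.sum_sub_distrib, sum_lt_one i.val (by omega)]
  have hQ : ∑ l : Fin r, (((r + s : ℕ) : ℤ) - 1 - (slotEquiv (s := s) i (Sum.inl l)).val) *
        n (slotEquiv i (Sum.inl l)) =
      ∑ l : Fin r, (((r + 1 : ℕ) : ℤ) - 1 - (i.succAbove l).val) * n (slotEquiv i (Sum.inl l)) +
        (s - 1) * ∑ k : Fin (r + s) with k.val < i.val, n k := by
    rw [sum_before_slot, Finset.sum_filter, Finset.mul_sum, ← Finset.sum_add_distrib]
    refine Finset.sum_congr rfl fun l _ => ?_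
    rw [slotEquiv_inl_val, succAbove_val]
    split_ifs <;> (push_cast; ring)
  have hR : ∑ m : Fin s, (((r + s : ℕ) : ℤ) - 1 - (slotEquiv (r := r) i (Sum.inr m)).val) *
        n (slotEquiv i (Sum.inr m)) =
      ∑ m : Fin s, ((s : ℤ) - 1 - m.val) * n (slotEquiv i (Sum.inr m)) +
        (r - i.val) * ∑ m, n (slotEquiv i (Sum.inr m)) := by
    rw [Finset.mul_sum, ← Finset.sum_add_distrib]
    refine Finset.sum_congr rfl fun l _ => ?_
    rw [slotEquiv_inr_val]
    push_cast
    ring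
  rw [suspExponent, suspExponent, suspExponent,
    sum_slotEquiv i fun j : Fin (r + s) => (((r + s : ℕ) : ℤ) - 1 - j.val) * n j, hQ, hR, hU,
    Fin.sum_univ_succAbove _ i]
  simp only [Fin.insertNth_apply_same, Fin.insertNth_apply_succAbove]
  generalize ∑ l : Fin r, (((r + 1 : ℕ) : ℤ) - 1 - (i.succAbove l).val) *
    n (slotEquiv i (Sum.inl l)) = Q
  generalize ∑ m : Fin s, ((s : ℤ) - 1 - m.val) * n (slotEquiv i (Sum.inr m)) = R
  generalize ∑ m, n (slotEquiv i (Sum.inr m)) = N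
  generalize ∑ k : Fin (r + s) with k.val < i.val, n k = U
  push_cast
  linear_combination -(((s : ZMod 2) - 1) * dx + ((r : ZMod 2) - i.val) * dy +
    ((s : ZMod 2) - 1) * (r - i.val)) * two

lemma GradedOps.suspension_op_mem_iff (X : GradedOps P A) {r : ℕ} (x : P.ι r) {a : Fin r → A}
    {n : Fin r → ℤ} (ha : ∀ i, a i ∈ X.gr (n i - 1)) :
    X.suspension.op (r := r) x a ∈ X.suspension.gr (∑ i, n i - P.suspension.deg (r := r) x) ↔
      X.op x a ∈ X.gr (∑ i, (n i - 1) - P.deg x) := by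
  rw [X.suspension_op x ha]
  change _ ∈ X.gr (∑ i, n i - (P.deg x + (r - 1)) - 1) ↔ _
  rw [sign_smul_mem_iff, Finset.sum_sub_distrib]
  simp only [Finset.sum_const, Finset.card_univ, Fintype.card_fin, nsmul_eq_mul, mul_one]
  have : ∑ i, n i - (P.deg x + (r - 1)) - 1 = ∑ i, n i - r - P.deg x := by ring
  rw [this]

lemma GradedOps.suspension_op_act_iff (X : GradedOps P A) {r : ℕ} (g : Equiv.Perm (Fin r))
    (x : P.ι r) {a : Fin r → A} {n : Fin r → ℤ} (ha : ∀ i, a i ∈ X.gr (n i - 1)) :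
    X.suspension.eval (P.suspension.act (r := r) g x) a =
        koszulSign g n • X.suspension.op (r := r) x (fun i => a (g i)) ↔
      X.eval (P.act g x) a = koszulSign g (fun i => n i - 1) • X.op x fun i => a (g i) := by
  have h : X.suspension.eval (P.suspension.act (r := r) g x) a =
      Equiv.Perm.sign g • X.suspension.eval (r := r) (P.act g x) a :=
    (DFunLike.congr_fun (X.suspension.eval_sign_smul _ _) a).trans
      (multilinear_sign_smul_apply _ _ _)
  rw [h, X.suspension_eval (P.deg_act g x) ha,
    X.suspension_op x fun i => ha (g i), smul_smul, smul_smul]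
  exact sign_smul_eq_iff (suspExponent_act g (P.deg x) n)

lemma GradedOps.suspension_op_comp_iff (X : GradedOps P A) {r s : ℕ} (i : Fin (r + 1))
    (x : P.ι (r + 1)) (y : P.ι s) {a : Fin (r + s) → A} {n : Fin (r + s) → ℤ}
    (ha : ∀ i, a i ∈ X.gr (n i - 1))
    (hy : X.op y (fun k => a (slotEquiv i (Sum.inr k))) ∈
      X.gr (∑ k, (n (slotEquiv i (Sum.inr k)) - 1) - P.deg y)) :
    X.suspension.eval (P.suspension.comp (r := r) (s := s) i x y) a =
        (P.suspension.deg (r := s) y * ∑ k : Fin (r + s) with k.val < i.val, n k).negOnePow •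
        X.suspension.op (r := r + 1) x (i.insertNth (α := fun _ => A)
          (X.suspension.op (r := s) y fun k => a (slotEquiv i (Sum.inr k)))
          fun k => a (slotEquiv i (Sum.inl k))) ↔
      X.eval (P.comp i x y) a =
        (P.deg y * ∑ k : Fin (r + s) with k.val < i.val, (n k - 1)).negOnePow •
        X.op x (i.insertNth (α := fun _ => A) (X.op y fun k => a (slotEquiv i (Sum.inr k)))
          fun k => a (slotEquiv i (Sum.inl k))) := by
  have hL : ∀ v, X.op x (i.insertNth (α := fun _ => A) v fun k => a (slotEquiv i (Sum.inl k))) =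
      (X.op x).toLinearMap (i.insertNth (α := fun _ => A) 0
        fun k => a (slotEquiv i (Sum.inl k))) i v := by
    intro v
    rw [MultilinearMap.toLinearMap_apply, Fin.update_insertNth]
  have hins : ∀ j, i.insertNth (α := fun _ => A)
      ((suspExponent s (P.deg y) fun k => n (slotEquiv i (Sum.inr k))).negOnePow •
        X.op y fun k => a (slotEquiv i (Sum.inr k))) (fun k => a (slotEquiv i (Sum.inl k))) j ∈
      X.gr (i.insertNth (α := fun _ => ℤ)
          (∑ k, n (slotEquiv i (Sum.inr k)) - (P.deg y + (s - 1)))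
            (fun k => n (slotEquiv i (Sum.inl k))) j - 1) := by
    intro j
    refine Fin.succAboveCases i ?_ (fun j => ?_) j
    · rw [Fin.insertNth_apply_same, Fin.insertNth_apply_same, sign_smul_mem_iff]
      rw [Finset.sum_sub_distrib] at hy
      simp only [Finset.sum_const, Finset.card_univ, Fintype.card_fin, nsmul_eq_mul, mul_one] at hy
      convert hy using 2
      ring
    · rw [Fin.insertNth_apply_succAbove, Fin.insertNth_apply_succAbove]
      exact ha _
  have h : X.suspension.eval (P.suspension.comp (r := r) (s := s) i x y) a =
      (((s : ℤ) - 1) * (P.deg x + r - i.val)).negOnePow •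
        X.suspension.eval (r := r + s) (P.comp i x y) a :=
    (DFunLike.congr_fun (X.suspension.eval_sign_smul _ _) a).trans
      (multilinear_sign_smul_apply _ _ _)
  have hdeg : P.suspension.deg (r := s) y = P.deg y + (s - 1) := rfl
  rw [h, hdeg, X.suspension_eval (P.deg_comp i x y) ha, X.suspension_op y fun k => ha _,
    X.suspension_op x hins, hL, map_sign_smul, ← hL, smul_smul, smul_smul, smul_smul]
  exact sign_smul_eq_iff (suspExponent_comp i (P.deg x) (P.deg y) n)

lemma GradedOps.suspension_op_one (X : GradedOps P A) (a : A) :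
    X.suspension.op (r := 1) P.suspension.one (fun _ => a) = X.op P.one fun _ => a := by
  change ((((1 : ℕ) : ℤ) - 1) * P.deg P.one).negOnePow • (X.op P.one (fun j : Fin 1 =>
    (parity (fun n => X.gr (n - 1)) (internal_shift X.gr X.internal) ^ (1 - 1 - j.val)) a)) = _
  simp

/-- The suspensions of the `P`-algebras are `Λ^*P`-algebras. -/
lemma GradedOps.IsAlgebra.suspension {X : GradedOps P A} (hX : X.IsAlgebra) :
    X.suspension.IsAlgebra where
  op_mem x a _ ha := (X.suspension_op_mem_iff x ha).2 (hX.op_mem x a _ ha)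
  op_one a := (X.suspension_op_one a).trans (hX.op_one a)
  op_act g x a _ ha := (X.suspension_op_act_iff g x ha).2 (hX.op_act g x a _ ha)
  op_comp i x y a _ ha := (X.suspension_op_comp_iff i x y ha
    (hX.op_mem y _ _ fun _ => ha _)).2 (hX.op_comp i x y a _ ha)

/-- An algebra structure whose suspension satisfies the laws of a `Λ^*P`-algebra satisfies the laws of
a `P`-algebra. -/
lemma GradedOps.IsAlgebra.of_suspension {X : GradedOps P A} (hX : X.suspension.IsAlgebra) :
    X.IsAlgebra := by
  have hs : ∀ {r : ℕ} {a : Fin r → A} {n : Fin r → ℤ}, (∀ i, a i ∈ X.gr (n i)) →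
      ∀ i, a i ∈ X.gr ((fun i => n i + 1) i - 1) := by
    intro r a n ha i
    simpa using ha i
  have hmem : ∀ {r : ℕ} (x : P.ι r) (a : Fin r → A) (n : Fin r → ℤ), (∀ i, a i ∈ X.gr (n i)) →
    X.op x a ∈ X.gr (∑ i, n i - P.deg x) := by
    intro r x a n ha
    simpa using (X.suspension_op_mem_iff x (hs ha)).1 (hX.op_mem (r := r) x a _ (hs ha))
  refine ⟨hmem, fun a => ?_, fun {r} g x a _ ha => ?_, fun {r s} i x y a _ ha => ?_⟩
  · exact (X.suspension_op_one a).symm.trans (hX.op_one a)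
  · simpa using (X.suspension_op_act_iff g x (hs ha)).1 (hX.op_act (r := r) g x a _ (hs ha))
  · simpa using (X.suspension_op_comp_iff i x y (hs ha)
      (by simpa using hmem y _ _ fun _ => ha _)).1
        (hX.op_comp (r := r) (s := s) i x y a _ (hs ha))

lemma GradedOps.suspension_leibnizSum (X : GradedOps P A) {r : ℕ} (x : P.ι r) {n : Fin r → ℤ}
    {a b : Fin r → A} (ha : ∀ i, a i ∈ X.gr (n i - 1)) (hb : ∀ i, b i ∈ X.gr (n i)) :
    X.suspension.leibnizSum (r := r) (Finsupp.single x 1) (P.suspension.deg (r := r) x) n a b =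
      (suspExponent r (P.deg x) n).negOnePow •
        X.leibnizSum (Finsupp.single x 1) (P.deg x) (fun i => n i - 1) a b := by
  have two : (2 : ZMod 2) = 0 := rfl
  rw [GradedOps.leibnizSum, GradedOps.leibnizSum, smul_add, linearExtension_single (P.d (r := r))]
  congr 1
  · have h : X.suspension.eval (r := r) (linearExtension P.suspension.d (Finsupp.single x (1 : F))) a =
        ((r : ℤ) - 1).negOnePow • X.suspension.eval (r := r) (P.d x) a :=
      (congrArg (fun ρ => X.suspension.eval ρ a)
        (linearExtension_single (P.suspension.d (r := r)) x)).trans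
        ((DFunLike.congr_fun (X.suspension.eval_sign_smul _ _) a).trans
          (multilinear_sign_smul_apply _ _ _))
    rw [h, X.suspension_eval (P.deg_d x) ha, smul_smul, ← Int.negOnePow_add]
    congr 1
    refine negOnePow_congr ?_
    rw [suspExponent, suspExponent]
    push_cast
    ring
  · rw [Finset.smul_sum]
    refine Finset.sum_congr rfl fun i _ => ?_
    have h' : ∀ j, Function.update a i (b i) j ∈ X.gr (Function.update n i (n i + 1) j - 1) := by
      intro j
      by_cases h : j = i
      · subst h
        simpa using hb j
      · simpa [h] using ha j
    have hE : suspExponent r (P.deg x) (Function.update n i (n i + 1)) =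
        suspExponent r (P.deg x) n + (r - 1 - i.val) := by
      rw [suspExponent, suspExponent, add_assoc]
      congr 1
      rw [← Finset.add_sum_erase _ _ (Finset.mem_univ i),
        ← Finset.add_sum_erase _ _ (Finset.mem_univ i), Function.update_self]
      rw [Finset.sum_congr rfl fun j hj => by rw [Function.update_of_ne (Finset.ne_of_mem_erase hj)]]
      ring
    have h : X.suspension.eval (r := r) (Finsupp.single x (1 : F)) = X.suspension.op (r := r) x :=
      X.suspension.eval_single_one (r := r) x
    rw [h, X.eval_single_one, X.suspension_op x h', smul_smul,
      smul_smul, ← Int.negOnePow_add, ← Int.negOnePow_add, hE, Finset.sum_sub_distrib]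
    simp only [Fin.lt_def]
    rw [sum_lt_one i.val (by omega)]
    change ((P.deg x + (r - 1)) + _ + _).negOnePow • _ = _
    congr 1
    refine negOnePow_congr ?_
    push_cast
    linear_combination ((r : ZMod 2) - 1) * two

lemma GradedOps.IsDerivation.suspension {X : GradedOps P A} {d : A →ₗ[F] A}
    (hd : X.IsDerivation d) : X.suspension.IsDerivation d where
  mem n a ha := by
    have := hd.mem (n - 1) a ha
    rw [sub_add_cancel] at this
    change d a ∈ X.gr (n + 1 - 1)
    rwa [add_sub_cancel_right]
  leibniz {r} x a n ha := by
    rw [X.suspension_leibnizSum x ha fun i => by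
      have := hd.mem (n i - 1) (a i) (ha i)
      rwa [sub_add_cancel] at this, X.suspension_op x ha, map_sign_smul, hd.leibniz x a _ ha]

lemma GradedOps.IsDerivation.of_suspension {X : GradedOps P A} {d : A →ₗ[F] A}
    (hd : X.suspension.IsDerivation d) : X.IsDerivation d := by
  have hmem : ∀ (n : ℤ) (a : A), a ∈ X.gr n → d a ∈ X.gr (n + 1) := by
    intro n a ha
    have := hd.mem (n + 1) a (by change a ∈ X.gr (n + 1 - 1); rwa [add_sub_cancel_right])
    change d a ∈ X.gr (n + 1 + 1 - 1) at this
    rwa [add_sub_cancel_right] at this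
  refine ⟨hmem, fun {r} x a n ha => ?_⟩
  have hs : ∀ i, a i ∈ X.gr ((fun i => n i + 1) i - 1) := fun i => by simpa using ha i
  have := hd.leibniz (r := r) x a _ hs
  rw [X.suspension_leibnizSum x hs fun i => hmem _ _ (ha i), X.suspension_op x hs,
    map_sign_smul] at this
  simpa using sign_smul_injective _ this

lemma GradedOps.IsDGAlgebra.suspension {X : GradedOps P A} {d : A →ₗ[F] A}
    (h : X.IsDGAlgebra d) : X.suspension.IsDGAlgebra d :=
  ⟨h.1.suspension, h.2.isDerivation.suspension.isDifferential h.2.sq⟩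

lemma GradedOps.IsDGAlgebra.of_suspension {X : GradedOps P A} {d : A →ₗ[F] A}
    (h : X.suspension.IsDGAlgebra d) : X.IsDGAlgebra d :=
  ⟨.of_suspension h.1, h.2.isDerivation.of_suspension.isDifferential h.2.sq⟩

/-- A morphism of algebras is determined by homogeneous elements. -/
lemma IsDGHom.of_homogeneous {X : GradedOps P A} {dX : A →ₗ[F] A} {Y : GradedOps P B}
    {dY : B →ₗ[F] B} {f : A →ₗ[F] B} (mem : ∀ (n : ℤ) (a : A), a ∈ X.gr n → f a ∈ Y.gr n)
    (op : ∀ {r : ℕ} (x : P.ι r) (a : Fin r → A) (n : Fin r → ℤ), (∀ i, a i ∈ X.gr (n i)) →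
      f (X.op x a) = Y.op x fun i => f (a i))
    (d : ∀ a : A, f (dX a) = dY (f a)) : IsDGHom X dX Y dY f where
  mem := mem
  op {r} x a := by
    have : f.compMultilinearMap (X.op x) = (Y.op x).compLinearMap fun _ => f :=
      multilinear_ext_homogeneous X.internal fun a n ha => op x a n ha
    exact DFunLike.congr_fun this a
  d := d

lemma isDGHom_suspension_iff {X : GradedOps P A} {dX : A →ₗ[F] A} {Y : GradedOps P B}
    {dY : B →ₗ[F] B} {f : A →ₗ[F] B} :
    IsDGHom X.suspension dX Y.suspension dY f ↔ IsDGHom X dX Y dY f := by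
  constructor
  · intro h
    have hmem : ∀ (n : ℤ) (a : A), a ∈ X.gr n → f a ∈ Y.gr n := by
      intro n a ha
      have := h.mem (n + 1) a (by change a ∈ X.gr (n + 1 - 1); rwa [add_sub_cancel_right])
      change f a ∈ Y.gr (n + 1 - 1) at this
      rwa [add_sub_cancel_right] at this
    refine .of_homogeneous hmem (fun {r} x a n ha => ?_) h.d
    have hs : ∀ i, a i ∈ X.gr ((fun i => n i + 1) i - 1) := fun i => by simpa using ha i
    have := h.op (r := r) x a
    rw [X.suspension_op x hs, Y.suspension_op x fun i => hmem _ _ (hs i), map_sign_smul] at this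
    exact sign_smul_injective _ this
  · intro h
    refine .of_homogeneous (fun n a ha => h.mem _ a ha) (fun {r} x a n ha => ?_) h.d
    rw [X.suspension_op x ha, Y.suspension_op x fun i => h.mem _ _ (ha i), map_sign_smul]
    exact congrArg _ (h.op (r := r) x a)

lemma GradedOps.ext_gr_op {X Y : GradedOps P A} (hgr : X.gr = Y.gr)
    (hop : ∀ {r : ℕ} (x : P.ι r), X.op x = Y.op x) : X = Y := by
  obtain ⟨gr, internal, op⟩ := X
  obtain ⟨gr', internal', op'⟩ := Y
  obtain rfl : gr = gr' := hgr
  congr 1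
  funext r x
  exact hop x

lemma internal_unshift (gr : ℤ → Submodule F A) (h : DirectSum.IsInternal gr) :
    DirectSum.IsInternal fun n => gr (n + 1) := by
  rw [DirectSum.isInternal_submodule_iff_iSupIndep_and_iSup_eq_top] at h ⊢
  refine ⟨h.1.comp (f := fun n : ℤ => n + 1) fun a b hab => by simpa using hab, ?_⟩
  rw [← h.2]
  exact (Equiv.addRight (1 : ℤ)).iSup_congr fun _ => rfl

/-- The algebra structure over `P` whose suspension is a given algebra structure over `Λ^*P`. -/
def GradedOps.desuspension (Z : GradedOps P.suspension A) : GradedOps P A where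
  gr n := Z.gr (n + 1)
  internal := internal_unshift Z.gr Z.internal
  op {r} x := (((r : ℤ) - 1) * P.deg x).negOnePow •
    (Z.op (r := r) x).compLinearMap fun j => parity Z.gr Z.internal ^ (r - 1 - j.val)

lemma GradedOps.suspension_desuspension (Z : GradedOps P.suspension A) :
    Z.desuspension.suspension = Z := by
  have hgr : Z.desuspension.suspension.gr = Z.gr := by
    funext n
    change Z.gr (n - 1 + 1) = Z.gr n
    rw [sub_add_cancel]
  refine GradedOps.ext_gr_op hgr fun {r} x => ?_
  refine multilinear_ext_homogeneous Z.internal fun a n ha => ?_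
  have ha' : ∀ i, a i ∈ Z.desuspension.gr (n i - 1) := by
    intro i
    change a i ∈ Z.gr (n i - 1 + 1)
    rw [sub_add_cancel]
    exact ha i
  rw [Z.desuspension.suspension_op x ha']
  change _ • ((((r : ℤ) - 1) * P.deg (r := r) x).negOnePow • (Z.op (r := r) x).compLinearMap
    fun j => parity Z.gr Z.internal ^ (r - 1 - j.val)) a = _
  rw [multilinear_sign_smul_apply, MultilinearMap.compLinearMap_apply]
  simp only [parity_pow_apply Z.internal (ha _)]
  rw [multilinear_map_sign_smul, smul_smul, smul_smul, ← Int.negOnePow_add, ← Int.negOnePow_add,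
    suspExponent]
  have : ∑ i : Fin r, ((r - 1 - i.val : ℕ) : ℤ) * n i = ∑ j : Fin r, ((r : ℤ) - 1 - j.val) * n j := by
    refine Finset.sum_congr rfl fun j _ => ?_
    rw [Nat.sub_sub, Nat.cast_sub (by omega)]
    push_cast
    ring
  rw [this, add_assoc, ← two_mul, Int.negOnePow_two_mul, one_smul]

end Suspension

/-! ### Chains of lists: boundary, shuffle product and diagonal -/

section Lists

/-- Formal integral combinations of lists. -/
abbrev ListChain (α : Type) : Type := List α →₀ ℤ

variable {α β γ : Type} {M : Type*} [AddCommGroup M]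

/-- Prepending a letter. -/
abbrev consMap (a : α) : ListChain α →ₗ[ℤ] ListChain α := Finsupp.lmapDomain ℤ ℤ (List.cons a)

lemma consMap_single (a : α) (l : List α) (c : ℤ) :
    consMap a (Finsupp.single l c) = Finsupp.single (a :: l) c := by
  rw [consMap, Finsupp.lmapDomain_apply, Finsupp.mapDomain_single]

/-- The linear extension of a function on lists. -/
abbrev listExtension (f : List α → M) : ListChain α →ₗ[ℤ] M := Finsupp.linearCombination ℤ f

lemma listExtension_single (f : List α → M) (l : List α) :
    listExtension f (Finsupp.single l 1) = f l := by
  rw [listExtension, Finsupp.linearCombination_single, one_smul]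

lemma listExtension_consMap (f : List α → M) (a : α) (z : ListChain α) :
    listExtension f (consMap a z) = listExtension (fun l => f (a :: l)) z := by
  rw [listExtension, consMap, Finsupp.lmapDomain_apply, Finsupp.linearCombination_mapDomain]
  rfl

/-- Linear maps which agree on the lists in a set agree on their combinations. -/
lemma listChain_eq_of_supported {f g : ListChain α →ₗ[ℤ] M} {s : Set (List α)}
    (h : ∀ l ∈ s, f (Finsupp.single l 1) = g (Finsupp.single l 1)) {z : ListChain α}
    (hz : z ∈ Finsupp.supported ℤ ℤ s) : f z = g z := by
  rw [Finsupp.supported_eq_span_single] at hz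
  induction hz using Submodule.span_induction with
  | mem z hz =>
    obtain ⟨x, hx, rfl⟩ := hz
    exact h x hx
  | zero => simp
  | add z w _ _ hz hw => rw [map_add, map_add, hz, hw]
  | smul c z _ hz => rw [map_smul, map_smul, hz]

lemma listChain_ext {f g : ListChain α →ₗ[ℤ] M}
    (h : ∀ l, f (Finsupp.single l 1) = g (Finsupp.single l 1)) (z : ListChain α) : f z = g z :=
  listChain_eq_of_supported (s := Set.univ) (fun l _ => h l) (by simp)

/-- The augmented simplicial boundary of a list, `∑ᵢ (-1)ⁱ (l without its entry i)`; the boundary of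
a list of length one is the empty list. -/
def listBoundary : List α → ListChain α
  | [] => 0
  | a :: l => Finsupp.single l 1 - consMap a (listBoundary l)

/-- The linear extension of `listBoundary`. -/
abbrev boundary : ListChain α →ₗ[ℤ] ListChain α := listExtension listBoundary

lemma boundary_consMap (a : α) (z : ListChain α) :
    boundary (consMap a z) = z - consMap a (boundary z) := by
  have := listChain_ext (f := boundary ∘ₗ consMap a)
    (g := LinearMap.id - consMap a ∘ₗ boundary) (fun l => ?_) z
  · exact this
  · rw [LinearMap.comp_apply, consMap_single, listExtension_single, LinearMap.sub_apply,
      LinearMap.comp_apply, listExtension_single, LinearMap.id_apply, listBoundary]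

lemma listBoundary_mem (l : List α) :
    listBoundary l ∈ Finsupp.supported ℤ ℤ {m : List α | m.length + 1 = l.length} := by
  induction l with
  | nil => exact zero_mem _
  | cons a l ih =>
    refine sub_mem (Finsupp.single_mem_supported ℤ 1 (by simp)) ?_
    classical
    intro m hm
    obtain ⟨m', hm', rfl⟩ := Finset.mem_image.1 (Finsupp.mapDomain_support hm)
    have := ih hm'
    simp only [Set.mem_ofPred_eq] at this
    simp [this]

lemma listBoundary_eq_sum (l : List α) :
    listBoundary l =
      ∑ i ∈ range l.length, (i : ℤ).negOnePow • Finsupp.single (l.eraseIdx i) (1 : ℤ) := by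
  induction l with
  | nil => simp [listBoundary]
  | cons a l ih =>
    rw [listBoundary, List.length_cons, Finset.sum_range_succ', ih, map_sum, add_comm,
      sub_eq_add_neg, ← Finset.sum_neg_distrib]
    congr 1
    · simp
    · refine Finset.sum_congr rfl fun i _ => ?_
      rw [Units.smul_def, map_zsmul, consMap_single, Nat.cast_add, Nat.cast_one,
        Int.negOnePow_succ, List.eraseIdx_cons_succ, Units.smul_def, Units.val_neg, neg_smul]

lemma boundary_boundary (z : ListChain α) : boundary (boundary z) = 0 := by
  have := listChain_ext (f := boundary ∘ₗ boundary) (g := (0 : ListChain α →ₗ[ℤ] ListChain α))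
    (fun l => ?_) z
  · exact this
  · rw [LinearMap.comp_apply, listExtension_single, LinearMap.zero_apply]
    induction l with
    | nil => simp [listBoundary]
    | cons a l ih =>
      rw [listBoundary, map_sub, boundary_consMap, listExtension_single, ih, map_zero, sub_zero,
        sub_self]

lemma listBoundary_append (l m : List α) : listBoundary (l ++ m) =
    Finsupp.lmapDomain ℤ ℤ (· ++ m) (listBoundary l) +
      (l.length : ℤ).negOnePow • Finsupp.lmapDomain ℤ ℤ (l ++ ·) (listBoundary m) := by
  induction l with
  | nil =>
    have : (fun x : List α => [] ++ x) = id := rfl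
    rw [listBoundary, map_zero, this]
    simp
  | cons a l ih =>
    have h₁ : ∀ z : ListChain α, consMap a (Finsupp.lmapDomain ℤ ℤ (· ++ m) z) =
        Finsupp.lmapDomain ℤ ℤ (· ++ m) (consMap a z) := by
      intro z
      simp only [consMap, Finsupp.lmapDomain_apply, ← Finsupp.mapDomain_comp]
      rfl
    have h₂ : ∀ z : ListChain α, consMap a (Finsupp.lmapDomain ℤ ℤ (l ++ ·) z) =
        Finsupp.lmapDomain ℤ ℤ (a :: l ++ ·) z := by
      intro z
      simp only [consMap, Finsupp.lmapDomain_apply, ← Finsupp.mapDomain_comp]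
      rfl
    rw [List.cons_append, listBoundary, ih, map_add, h₁, Units.smul_def, map_zsmul, h₂, listBoundary,
      map_sub, List.length_cons, Nat.cast_add, Nat.cast_one, Int.negOnePow_succ, Units.smul_def,
      Units.val_neg, neg_smul, Finsupp.lmapDomain_apply _ _ _ (Finsupp.single l 1),
      Finsupp.mapDomain_single]
    abel

lemma boundary_mapDomain_map (f : α → β) (z : ListChain α) :
    boundary (Finsupp.lmapDomain ℤ ℤ (List.map f) z) =
      Finsupp.lmapDomain ℤ ℤ (List.map f) (boundary z) := by
  have := listChain_ext (f := boundary ∘ₗ Finsupp.lmapDomain ℤ ℤ (List.map f))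
    (g := Finsupp.lmapDomain ℤ ℤ (List.map f) ∘ₗ boundary) (fun l => ?_) z
  · exact this
  · rw [LinearMap.comp_apply, LinearMap.comp_apply, Finsupp.lmapDomain_apply,
      Finsupp.mapDomain_single, listExtension_single, listExtension_single]
    induction l with
    | nil => simp [listBoundary]
    | cons a l ih =>
      rw [List.map_cons, listBoundary, listBoundary, map_sub, ih, Finsupp.lmapDomain_apply _ _ _
        (Finsupp.single l 1), Finsupp.mapDomain_single]
      congr 1
      simp only [consMap, Finsupp.lmapDomain_apply, ← Finsupp.mapDomain_comp]
      rfl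

/-- The coefficient of the empty list. -/
abbrev listAug : ListChain α →ₗ[ℤ] ℤ := Finsupp.lapply []

lemma listAug_consMap (a : α) (z : ListChain α) : listAug (consMap a z) = 0 := by
  rw [listAug, Finsupp.lapply_apply, consMap, Finsupp.lmapDomain_apply,
    Finsupp.mapDomain_of_notMem_range]
  simp

/-- The bilinear extension of the shuffle product. -/
def shuffleMap : ListChain α →ₗ[ℤ] ListChain β →ₗ[ℤ] ListChain (α × β) :=
  listExtension fun l => listExtension fun m => shuffle l m

lemma shuffleMap_single (l : List α) (m : List β) :
    shuffleMap (Finsupp.single l 1) (Finsupp.single m 1) = shuffle l m := by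
  rw [shuffleMap, listExtension_single, listExtension_single]

lemma shuffle_nil_left (m : List β) : shuffle ([] : List α) m = 0 := by rw [shuffle]

lemma shuffle_nil_right (l : List α) : shuffle l ([] : List β) = 0 := by
  cases l <;> rw [shuffle]

lemma shuffle_singleton (x : α) (y : β) : shuffle [x] [y] = Finsupp.single [(x, y)] 1 := by
  rw [shuffle]

lemma shuffle_cons_cons_of_ne {x : α} {xs : List α} {y : β} {ys : List β}
    (h : xs = [] → ys = [] → False) : shuffle (x :: xs) (y :: ys) =
      consMap (x, y) (shuffle xs (y :: ys) + (xs.length : ℤ).negOnePow • shuffle (x :: xs) ys) := by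
  rw [shuffle]
  · rfl
  · exact h

/-- The recursion of the shuffle product, in a form that includes the product of two lists of length
one, through the last term. -/
lemma shuffle_cons_cons (x : α) (xs : List α) (y : β) (ys : List β) :
    shuffle (x :: xs) (y :: ys) = consMap (x, y) (shuffle xs (y :: ys) +
      (xs.length : ℤ).negOnePow • shuffle (x :: xs) ys +
        (listAug (Finsupp.single xs 1) * listAug (Finsupp.single ys 1)) • Finsupp.single [] 1) := by
  rcases xs with _ | ⟨x', xs⟩
  · rcases ys with _ | ⟨y', ys⟩
    · rw [shuffle_singleton, shuffle_nil_left, shuffle_nil_right]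
      simp
    · rw [shuffle_cons_cons_of_ne (by simp)]
      simp
  · rw [shuffle_cons_cons_of_ne (by simp)]
    simp

/-- Bilinear form of `shuffle_cons_cons`. -/
lemma shuffleMap_consMap (x : α) (y : β) {p : ℤ} {X : ListChain α}
    (hX : X ∈ Finsupp.supported ℤ ℤ {l : List α | (l.length : ℤ) = p}) (Y : ListChain β) :
    shuffleMap (consMap x X) (consMap y Y) = consMap (x, y) (shuffleMap X (consMap y Y) +
      p.negOnePow • shuffleMap (consMap x X) Y + (listAug X * listAug Y) • Finsupp.single [] 1) := by
  have h₁ : ∀ l ∈ {l : List α | (l.length : ℤ) = p}, ∀ Y : ListChain β,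
      shuffleMap (consMap x (Finsupp.single l 1)) (consMap y Y) =
        consMap (x, y) (shuffleMap (Finsupp.single l 1) (consMap y Y) +
          (p.negOnePow : ℤ) • shuffleMap (consMap x (Finsupp.single l 1)) Y +
            (listAug (Finsupp.single l 1) * listAug Y) • Finsupp.single [] 1) := by
    intro l hl Y
    let f : ListChain β →ₗ[ℤ] ListChain (α × β) :=
      shuffleMap (consMap x (Finsupp.single l 1)) ∘ₗ consMap y
    let g : ListChain β →ₗ[ℤ] ListChain (α × β) :=
      consMap (x, y) ∘ₗ (shuffleMap (Finsupp.single l 1) ∘ₗ consMap y +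
        (p.negOnePow : ℤ) • shuffleMap (consMap x (Finsupp.single l 1)) +
          (listAug (Finsupp.single l 1) • listAug).smulRight (Finsupp.single [] 1))
    refine listChain_ext (f := f) (g := g) (fun m => ?_) Y
    change shuffleMap _ (consMap y _) = consMap (x, y) (shuffleMap _ (consMap y _) +
      (p.negOnePow : ℤ) • shuffleMap _ _ + (listAug _ * listAug _) • _)
    rw [consMap_single, consMap_single, shuffleMap_single, shuffleMap_single, shuffleMap_single,
      shuffle_cons_cons, ← show (l.length : ℤ) = p from hl]
    rfl
  let f : ListChain α →ₗ[ℤ] ListChain (α × β) := shuffleMap.flip (consMap y Y) ∘ₗ consMap x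
  let g : ListChain α →ₗ[ℤ] ListChain (α × β) := consMap (x, y) ∘ₗ (shuffleMap.flip (consMap y Y) +
    (p.negOnePow : ℤ) • (shuffleMap.flip Y ∘ₗ consMap x) +
      (listAug Y • listAug).smulRight (Finsupp.single [] 1))
  refine listChain_eq_of_supported (f := f) (g := g) (fun l hl => ?_) hX |>.trans ?_
  · refine (h₁ l hl Y).trans ?_
    rw [mul_comm]
    rfl
  · rw [mul_comm]
    rfl

/-- The shuffle product is a chain map, up to the empty list. -/
lemma boundary_shuffle (l : List α) (m : List β) :
    boundary (shuffle l m) = shuffleMap (listBoundary l) (Finsupp.single m 1) -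
      (l.length : ℤ).negOnePow • shuffleMap (Finsupp.single l 1) (listBoundary m) +
        (listAug (listBoundary l) * listAug (listBoundary m)) • Finsupp.single [] 1 := by
  induction l, m using shuffle.induct with
  | case1 m =>
    have : shuffleMap (Finsupp.single ([] : List α) 1) (listBoundary m) = 0 := by
      have := listChain_ext (f := shuffleMap (Finsupp.single ([] : List α) 1))
        (g := (0 : ListChain β →ₗ[ℤ] ListChain (α × β))) (fun m => by
          rw [shuffleMap_single, shuffle_nil_left]; rfl) (listBoundary m)
      exact this
    rw [shuffle_nil_left, this]
    simp [listBoundary]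
  | case2 a l =>
    have : shuffleMap (listBoundary (a :: l)) (Finsupp.single ([] : List β) 1) = 0 := by
      have := listChain_ext (f := shuffleMap.flip (Finsupp.single ([] : List β) 1))
        (g := (0 : ListChain α →ₗ[ℤ] ListChain (α × β))) (fun m => by
          rw [LinearMap.flip_apply, shuffleMap_single, shuffle_nil_right]; rfl)
          (listBoundary (a :: l))
      exact this
    rw [shuffle_nil_right, this]
    simp [listBoundary]
  | case3 x y =>
    rw [shuffle, listExtension_single]
    simp only [listBoundary, map_zero, sub_zero]
    rw [shuffleMap_single, shuffleMap_single, shuffle_nil_left, shuffle_nil_right]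
    simp
  | case4 x xs y ys _ ih₁ ih₂ =>
    have hx : listBoundary xs ∈ Finsupp.supported ℤ ℤ
        {l : List α | (l.length : ℤ) = (xs.length : ℤ) - 1} := by
      refine Finsupp.supported_mono (fun l hl => ?_) (listBoundary_mem xs)
      simp only [Set.mem_ofPred_eq] at hl ⊢
      omega
    have hx' : Finsupp.single xs 1 ∈ Finsupp.supported ℤ ℤ
        {l : List α | (l.length : ℤ) = (xs.length : ℤ)} := Finsupp.single_mem_supported ℤ 1 rfl
    have e₁ := shuffleMap_consMap x y hx (Finsupp.single ys 1)
    have e₂ := shuffleMap_consMap x y hx' (listBoundary ys)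
    have hs : ((xs.length : ℤ) - 1).negOnePow = -(xs.length : ℤ).negOnePow := by
      rw [← neg_inj, neg_neg, ← Int.negOnePow_succ, sub_add_cancel]
    have hs' : (((x :: xs).length : ℕ) : ℤ).negOnePow = -(xs.length : ℤ).negOnePow := by
      rw [List.length_cons, Nat.cast_add, Nat.cast_one, Int.negOnePow_succ]
    rw [hs] at e₁
    rw [consMap_single] at e₁ e₂
    have d₁ : listBoundary (x :: xs) = Finsupp.single xs 1 - consMap x (listBoundary xs) := rfl
    have d₂ : listBoundary (y :: ys) = Finsupp.single ys 1 - consMap y (listBoundary ys) := rfl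
    rw [hs'] at ih₂ ⊢
    have hnil : boundary (Finsupp.single ([] : List (α × β)) (1 : ℤ)) = 0 := by
      rw [listExtension_single]
      rfl
    rw [shuffle_cons_cons, boundary_consMap, map_add, map_add, map_smul, hnil, smul_zero,
      map_zero, add_zero, map_add, ih₁, Units.smul_def, map_smul, ih₂, d₁, d₂]
    simp only [map_sub, LinearMap.sub_apply, listAug_consMap, sub_zero, e₁, e₂, shuffleMap_single]
    generalize ((xs.length : ℤ).negOnePow) = s
    rcases Int.units_eq_one_or s with rfl | rfl
    · simp only [one_smul, Units.neg_smul, map_add, map_sub, map_neg, map_smul, Units.val_one]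
      module
    · simp only [one_smul, Units.neg_smul, map_add, map_sub, map_neg, map_smul, Units.val_one,
        Units.val_neg, neg_smul, neg_neg]
      module

/-- The sum of the values of a function of two arguments on the terms of the diagonal
`l ↦ ∑ₖ (l₀, …, l_k) ⊗ (l_k, …, l_n)`. -/
def diagonalSum (B : List α → List α → M) (l : List α) : M :=
  ∑ k ∈ range l.length, B (l.take (k + 1)) (l.drop k)

lemma diagonalSum_cons (B : List α → List α → M) (a : α) (l : List α) :
    diagonalSum B (a :: l) = B [a] (a :: l) + diagonalSum (fun p q => B (a :: p) q) l := by
  rw [diagonalSum, List.length_cons, Finset.sum_range_succ', add_comm]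
  rfl

/-- The bilinear extension of a function of two lists. -/
abbrev listExtension₂ (B : List α → List α → M) : ListChain α →ₗ[ℤ] ListChain α →ₗ[ℤ] M :=
  listExtension fun p => listExtension (B p)

lemma listExtension₂_consMap (B : List α → List α → M) (a : α) (z w : ListChain α) :
    listExtension₂ B (consMap a z) w = listExtension₂ (fun p q => B (a :: p) q) z w := by
  rw [listExtension₂, listExtension_consMap]

/-- The diagonal of a shuffle product is the shuffle product of the diagonals.  The sign comes from
moving the second factor of the diagonal of `l`, of dimension `l.length - 1 - a`, past the first
factor of the diagonal of `m`, of dimension `b`. -/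
lemma diagonalSum_shuffle (B : List (α × β) → List (α × β) → M) (l : List α) (m : List β) :
    listExtension (diagonalSum B) (shuffle l m) =
      ∑ a ∈ range l.length, ∑ b ∈ range m.length,
        (((l.length : ℤ) - 1 - a) * b).negOnePow •
          listExtension₂ B (shuffle (l.take (a + 1)) (m.take (b + 1)))
            (shuffle (l.drop a) (m.drop b)) := by
  induction l, m using shuffle.induct generalizing B with
  | case1 m => simp [shuffle_nil_left]
  | case2 a l => simp [shuffle_nil_right]
  | case3 x y =>
    rw [shuffle, listExtension_single]
    simp [diagonalSum, shuffle]
  | case4 x xs y ys h ih₁ ih₂ =>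
    have hZ := shuffle_cons_cons_of_ne (x := x) (y := y) h
    have hL : listExtension (diagonalSum B) (shuffle (x :: xs) (y :: ys)) =
        listExtension₂ B (Finsupp.single [(x, y)] 1) (shuffle (x :: xs) (y :: ys)) +
          (listExtension (diagonalSum fun p q => B ((x, y) :: p) q) (shuffle xs (y :: ys)) +
            (xs.length : ℤ).negOnePow •
              listExtension (diagonalSum fun p q => B ((x, y) :: p) q) (shuffle (x :: xs) ys)) := by
      rw [Units.smul_def, ← map_zsmul, ← map_add, ← Units.smul_def, listExtension_single, hZ,
        listExtension_consMap, listExtension_consMap]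
      generalize shuffle xs (y :: ys) + (xs.length : ℤ).negOnePow • shuffle (x :: xs) ys = Z
      have := listChain_ext (f := listExtension fun l => diagonalSum B ((x, y) :: l))
        (g := listExtension (fun l => B [(x, y)] ((x, y) :: l)) +
          listExtension (diagonalSum fun p q => B ((x, y) :: p) q)) (fun l => ?_) Z
      · exact this
      · rw [LinearMap.add_apply, listExtension_single, listExtension_single, listExtension_single,
          diagonalSum_cons]
    rw [hL, ih₁, ih₂, List.length_cons, List.length_cons, Finset.sum_range_succ']
    simp only [Finset.sum_range_succ', Finset.sum_add_distrib]
    have ne : ∀ {γ : Type} (l : List γ) (k : ℕ), k ∈ range l.length → l.take (k + 1) ≠ [] := by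
      intro γ l k hk
      rw [Finset.mem_range] at hk
      rw [← List.length_pos_iff_ne_nil, List.length_take]
      omega
    have h₁₁ : ∀ k ∈ range xs.length, ∀ b ∈ range ys.length,
        ((((xs.length + 1 : ℕ) : ℤ) - 1 - ((k + 1 : ℕ) : ℤ)) * ((b + 1 : ℕ) : ℤ)).negOnePow •
          listExtension₂ B (shuffle ((x :: xs).take (k + 1 + 1)) ((y :: ys).take (b + 1 + 1)))
            (shuffle ((x :: xs).drop (k + 1)) ((y :: ys).drop (b + 1))) =
        (((xs.length : ℤ) - 1 - k) * ((b + 1 : ℕ) : ℤ)).negOnePow •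
          listExtension₂ (fun p q => B ((x, y) :: p) q)
            (shuffle (xs.take (k + 1)) ((y :: ys).take (b + 1 + 1)))
            (shuffle (xs.drop k) ((y :: ys).drop (b + 1))) +
        (xs.length : ℤ).negOnePow • ((((xs.length + 1 : ℕ) : ℤ) - 1 - ((k + 1 : ℕ) : ℤ)) *
          (b : ℤ)).negOnePow •
          listExtension₂ (fun p q => B ((x, y) :: p) q)
            (shuffle ((x :: xs).take (k + 1 + 1)) (ys.take (b + 1)))
            (shuffle ((x :: xs).drop (k + 1)) (ys.drop b)) := by
      intro k hk b hb
      have hlen : ((xs.take (k + 1)).length : ℤ) = k + 1 := by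
        rw [List.length_take]
        have := Finset.mem_range.1 hk
        omega
      simp only [List.take_succ_cons, List.drop_succ_cons]
      rw [shuffle_cons_cons_of_ne fun h => absurd h (ne xs k hk), listExtension₂_consMap, map_add,
        Units.smul_def ((xs.take (k + 1)).length : ℤ).negOnePow, map_zsmul, LinearMap.add_apply,
        LinearMap.smul_apply, ← Units.smul_def, smul_add, smul_smul, smul_smul,
        ← Int.negOnePow_add, ← Int.negOnePow_add, hlen]
      congr 3
      · push_cast
        ring
      · push_cast
        ring
    have h₀₁ : ∀ b ∈ range ys.length,
        ((((xs.length + 1 : ℕ) : ℤ) - 1 - ((0 : ℕ) : ℤ)) * ((b + 1 : ℕ) : ℤ)).negOnePow •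
          listExtension₂ B (shuffle ((x :: xs).take (0 + 1)) ((y :: ys).take (b + 1 + 1)))
            (shuffle ((x :: xs).drop 0) ((y :: ys).drop (b + 1))) =
        (xs.length : ℤ).negOnePow • ((((xs.length + 1 : ℕ) : ℤ) - 1 - ((0 : ℕ) : ℤ)) *
          (b : ℤ)).negOnePow •
          listExtension₂ (fun p q => B ((x, y) :: p) q)
            (shuffle ((x :: xs).take (0 + 1)) (ys.take (b + 1)))
            (shuffle ((x :: xs).drop 0) (ys.drop b)) := by
      intro b hb
      simp only [List.take_succ_cons, List.drop_succ_cons, List.take_zero]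
      rw [shuffle_cons_cons_of_ne fun _ h => absurd h (ne ys b hb), listExtension₂_consMap,
        shuffle_nil_left, zero_add, smul_smul, ← Int.negOnePow_add]
      simp only [List.length_nil, Nat.cast_zero, Int.negOnePow_zero, one_smul]
      congr 2
      push_cast
      ring
    have h₁₀ : ∀ k ∈ range xs.length,
        ((((xs.length + 1 : ℕ) : ℤ) - 1 - ((k + 1 : ℕ) : ℤ)) * ((0 : ℕ) : ℤ)).negOnePow •
          listExtension₂ B (shuffle ((x :: xs).take (k + 1 + 1)) ((y :: ys).take (0 + 1)))
            (shuffle ((x :: xs).drop (k + 1)) ((y :: ys).drop 0)) =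
        (((xs.length : ℤ) - 1 - k) * ((0 : ℕ) : ℤ)).negOnePow •
          listExtension₂ (fun p q => B ((x, y) :: p) q)
            (shuffle (xs.take (k + 1)) ((y :: ys).take (0 + 1)))
            (shuffle (xs.drop k) ((y :: ys).drop 0)) := by
      intro k hk
      simp only [List.take_succ_cons, List.drop_succ_cons, List.take_zero]
      rw [shuffle_cons_cons_of_ne fun h => absurd h (ne xs k hk), listExtension₂_consMap,
        shuffle_nil_right, smul_zero, add_zero]
      simp
    rw [Finset.sum_congr rfl fun k hk => Finset.sum_congr rfl (h₁₁ k hk),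
      Finset.sum_congr rfl h₀₁, Finset.sum_congr rfl h₁₀]
    simp only [Finset.sum_add_distrib, smul_add, Finset.smul_sum, List.take_succ_cons,
      List.take_zero, shuffle_singleton, List.drop_zero, Nat.cast_zero, mul_zero,
      Int.negOnePow_zero, one_smul]
    abel

end Lists

/-! ### Signs of words and the cocycles `ε_r` -/

section Words

variable {α β : Type}

/-- The number of pairs of entries of `l` and `m` in the wrong order. -/
def crossInv {n : ℕ} (l m : List (Fin n)) : ℕ := (l.map fun a => m.countP (· < a)).sum

/-- The number of inversions of a word. -/
def wordInv {n : ℕ} : List (Fin n) → ℕ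
  | [] => 0
  | a :: l => l.countP (· < a) + wordInv l

open Classical in
/-- The signature of a word, as a function on all words; it is zero if the word is not a
permutation of the letters. -/
def wordSign {n : ℕ} (l : List (Fin n)) : ℤ :=
  if l.length = n ∧ l.Nodup then ((wordInv l : ℤ).negOnePow : ℤ) else 0

lemma crossInv_cons_left {n : ℕ} (a : Fin n) (l m : List (Fin n)) :
    crossInv (a :: l) m = m.countP (· < a) + crossInv l m := by
  simp [crossInv]

lemma crossInv_nil_left {n : ℕ} (m : List (Fin n)) : crossInv [] m = 0 := rfl

lemma crossInv_append_right {n : ℕ} (l m m' : List (Fin n)) :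
    crossInv l (m ++ m') = crossInv l m + crossInv l m' := by
  induction l with
  | nil => rfl
  | cons a l ih =>
    simp only [crossInv_cons_left, ih, List.countP_append]
    ring

lemma wordInv_append {n : ℕ} (l m : List (Fin n)) :
    wordInv (l ++ m) = wordInv l + wordInv m + crossInv l m := by
  induction l with
  | nil => simp [wordInv, crossInv_nil_left]
  | cons a l ih =>
    rw [List.cons_append, wordInv, wordInv, ih, crossInv_cons_left, List.countP_append]
    ring

lemma wordInv_singleton {n : ℕ} (a : Fin n) : wordInv [a] = 0 := rfl

lemma wordSign_of_not_nodup {n : ℕ} {l : List (Fin n)} (h : ¬ l.Nodup) : wordSign l = 0 :=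
  if_neg fun h' => h h'.2

lemma wordSign_of_length_ne {n : ℕ} {l : List (Fin n)} (h : l.length ≠ n) : wordSign l = 0 :=
  if_neg fun h' => h h'.1

lemma wordSign_eq {n : ℕ} {l : List (Fin n)} (h : l.length = n) (h' : l.Nodup) :
    wordSign l = ((wordInv l : ℤ).negOnePow : ℤ) := if_pos ⟨h, h'⟩

lemma wordInv_ofFn {m n : ℕ} (f : Fin m → Fin n) :
    (wordInv (List.ofFn f) : ℤ) = ∑ p, ∑ q, if p < q ∧ f q < f p then 1 else 0 := by
  induction m with
  | zero => simp [wordInv]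
  | succ m ih =>
    rw [List.ofFn_succ, wordInv, Nat.cast_add, ih, Fin.sum_univ_succ, Fin.sum_univ_succ]
    simp only [Fin.sum_univ_succ (n := m), lt_self_iff_false, false_and, if_false, zero_add,
      Fin.succ_pos, true_and, Fin.not_lt_zero, Fin.succ_lt_succ_iff]
    congr 1
    have : ∀ (m : ℕ) (g : Fin m → Fin n) (a : Fin n),
        ((List.ofFn g).countP (· < a) : ℤ) = ∑ q, if g q < a then 1 else 0 := by
      intro m g a
      induction m with
      | zero => simp
      | succ m ih =>
        rw [List.ofFn_succ, List.countP_cons, Fin.sum_univ_succ, Nat.cast_add, ih, add_comm]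
        congr 1
        split_ifs <;> simp_all
    exact this m _ _

/-- The value of `ε_r` on a simplex is the signature of the word of its first letters. -/
lemma epsilon_eq_wordSign {r : ℕ} (z : Fin r) (hz : z.val = 0) (w : List (Equiv.Perm (Fin r))) :
    epsilon w = wordSign (w.map fun g => g z) := by
  by_cases hw : w.length = r
  · have hword : (w.map fun g => g z) =
        List.ofFn fun k : Fin r => (w.get (k.cast hw.symm)) ⟨0, k.pos⟩ := by
      refine List.ext_getElem (by simp [hw]) fun k h₁ h₂ => ?_
      simp only [List.getElem_map, List.getElem_ofFn]
      congr 1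
      exact Fin.ext hz
    rw [epsilon, dif_pos hw]
    split_ifs with hf
    · have hnd : (w.map fun g => g z).Nodup := by
        rw [hword, List.nodup_ofFn]
        exact hf.1
      rw [wordSign_eq (by simp [hw]) hnd, sign_eq_negOnePow, hword, wordInv_ofFn]
      rfl
    · rw [wordSign_of_not_nodup]
      rw [hword, List.nodup_ofFn]
      exact fun h => hf (Finite.injective_iff_bijective.1 h)
  · rw [epsilon, dif_neg hw, wordSign_of_length_ne (by simpa using hw)]

lemma epsilon_of_length_ne {r : ℕ} {w : List (Equiv.Perm (Fin r))} (h : w.length ≠ r) :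
    epsilon w = 0 := dif_neg h

lemma epsilon_map_mul {r : ℕ} (g : Equiv.Perm (Fin r)) (w : List (Equiv.Perm (Fin r))) :
    epsilon (w.map (g * ·)) = Equiv.Perm.sign g * epsilon w := by
  by_cases hw : w.length = r
  · have hw' : (w.map (g * ·)).length = r := by simpa using hw
    have hfun : (fun k : Fin r => ((w.map (g * ·)).get (k.cast hw'.symm)) ⟨0, k.pos⟩) =
        g ∘ fun k : Fin r => (w.get (k.cast hw.symm)) ⟨0, k.pos⟩ := by
      funext k
      simp
    have hbij : (Function.Bijective fun k : Fin r =>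
        ((w.map (g * ·)).get (k.cast hw'.symm)) ⟨0, k.pos⟩) ↔
        Function.Bijective fun k : Fin r => (w.get (k.cast hw.symm)) ⟨0, k.pos⟩ := by
      rw [hfun]
      exact g.bijective.of_comp_iff' _
    rw [epsilon, epsilon, dif_pos hw, dif_pos hw']
    by_cases h : Function.Bijective fun k : Fin r => (w.get (k.cast hw.symm)) ⟨0, k.pos⟩
    · rw [dif_pos h, dif_pos (hbij.2 h)]
      have : Equiv.ofBijective _ (hbij.2 h) = g * Equiv.ofBijective _ h := by
        ext k
        simp
      rw [this, Equiv.Perm.sign_mul, Units.val_mul]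
    · rw [dif_neg h, dif_neg fun h' => h (hbij.1 h'), mul_zero]
  · rw [epsilon_of_length_ne hw, epsilon_of_length_ne (by simpa using hw), mul_zero]

/-- Moving a letter from the end of a block that does not contain it to its beginning. -/
lemma wordSign_move {n : ℕ} (A B C : List (Fin n)) (c : Fin n) (hc : c ∉ B) :
    wordSign (A ++ (B ++ c :: C)) = ((B.length : ℤ).negOnePow : ℤ) * wordSign (A ++ c :: (B ++ C)) := by
  have hperm : (A ++ (B ++ c :: C)).Perm (A ++ c :: (B ++ C)) :=
    List.Perm.append_left A List.perm_middle
  by_cases h : (A ++ (B ++ c :: C)).length = n ∧ (A ++ (B ++ c :: C)).Nodup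
  · rw [wordSign_eq h.1 h.2, wordSign_eq (hperm.length_eq ▸ h.1) (hperm.nodup_iff.1 h.2),
      ← Units.val_mul, ← Int.negOnePow_add]
    congr 1
    have hB : ∀ B : List (Fin n), c ∉ B →
        crossInv B [c] + B.countP (· < c) = B.length := by
      intro B hB
      induction B with
      | nil => simp [crossInv_nil_left]
      | cons b B ih =>
        rw [List.mem_cons, not_or] at hB
        have := ih hB.2
        rw [crossInv_cons_left, List.countP_cons, List.length_cons, ← this]
        rcases lt_or_gt_of_ne hB.1 with h | h <;> simp [h, h.not_gt] <;> ring
    have hB' := hB B hc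
    have e₁ : A ++ (B ++ c :: C) = A ++ (B ++ ([c] ++ C)) := rfl
    have e₂ : A ++ c :: (B ++ C) = A ++ ([c] ++ (B ++ C)) := rfl
    rw [e₁, e₂]
    simp only [wordInv_append, crossInv_append_right, wordInv_singleton]
    have e₃ : crossInv [c] B = B.countP (· < c) := by simp [crossInv]
    rw [e₃, ← hB']
    rw [Int.negOnePow_eq_iff]
    exact ⟨-(B.countP (· < c) : ℤ), by push_cast; ring⟩
  · have h' : ¬ ((A ++ c :: (B ++ C)).length = n ∧ (A ++ c :: (B ++ C)).Nodup) := by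
      rwa [← hperm.length_eq, ← hperm.nodup_iff]
    rw [wordSign, if_neg h, wordSign, if_neg h', mul_zero]

lemma listExtension_lmapDomain {M : Type*} [AddCommGroup M] (f : List β → M)
    (g : List α → List β) (z : ListChain α) :
    listExtension f (Finsupp.lmapDomain ℤ ℤ g z) = listExtension (fun l => f (g l)) z := by
  rw [Finsupp.lmapDomain_apply, listExtension, Finsupp.linearCombination_mapDomain]
  rfl

lemma listExtension_eq_zero {M : Type*} [AddCommGroup M] {f : List α → M} {s : Set (List α)}
    (h : ∀ l ∈ s, f l = 0) {z : ListChain α} (hz : z ∈ Finsupp.supported ℤ ℤ s) :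
    listExtension f z = 0 := by
  refine listChain_eq_of_supported (g := (0 : ListChain α →ₗ[ℤ] M)) (fun l hl => ?_) hz
  rw [listExtension_single, h l hl]
  rfl

/-- The cocycle property of the signature: a word with one letter too many has exactly one
repetition, and the two ways to remove it contribute opposite signs. -/
lemma wordSign_listBoundary {n : ℕ} (l : List (Fin n)) (hl : l.length = n + 1) :
    listExtension wordSign (listBoundary l) = 0 := by
  have hdup : ¬ l.Nodup := by
    intro h
    have := h.length_le_card
    rw [Fintype.card_fin] at this
    omega
  obtain ⟨c, A, B, C, rfl, hc⟩ : ∃ c A B C, l = A ++ c :: (B ++ c :: C) ∧ c ∉ B := by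
    clear hl
    induction l with
    | nil => simp at hdup
    | cons a l ih =>
      by_cases ha : a ∈ l
      · obtain ⟨B, C, rfl, hB⟩ := List.eq_append_cons_of_mem ha
        exact ⟨a, [], B, C, rfl, hB⟩
      · rw [List.nodup_cons] at hdup
        obtain ⟨c, A, B, C, rfl, hc⟩ := ih fun h => hdup ⟨ha, h⟩
        exact ⟨c, a :: A, B, C, rfl, hc⟩
  have hzero : ∀ (f : List (Fin n) → List (Fin n)), (∀ m, ¬ (f m).Nodup) → ∀ z : ListChain (Fin n),
      listExtension (fun m => wordSign (f m)) z = 0 := fun f hf z =>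
    listExtension_eq_zero (s := Set.univ) (fun m _ => wordSign_of_not_nodup (hf m)) (by simp)
  have h₁ := hzero (fun m => m ++ c :: (B ++ c :: C)) (fun m h => by
    simp [List.nodup_append, List.nodup_cons] at h)
  have h₂ := hzero (fun m => A ++ c :: (m ++ c :: C)) (fun m h => by
    simp [List.nodup_append, List.nodup_cons] at h)
  have h₃ := hzero (fun m => A ++ c :: (B ++ c :: m)) (fun m h => by
    simp [List.nodup_append, List.nodup_cons] at h)
  rw [listBoundary_append, map_add, listExtension_lmapDomain, h₁, zero_add, Units.smul_def,
    map_zsmul, listExtension_lmapDomain, listBoundary, map_sub, listExtension_single,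
    listExtension_consMap, listBoundary_append, map_add, listExtension_lmapDomain, h₂, zero_add,
    Units.smul_def, map_zsmul, listExtension_lmapDomain, listBoundary, map_sub,
    listExtension_single, listExtension_consMap, h₃, sub_zero, wordSign_move A B C c hc,
    smul_eq_mul (a := ((B.length : ℤ).negOnePow : ℤ)), sub_self, smul_zero]

/-! ### The signature of a shuffle of words -/

/-- The sum of a function over the terms of the shuffle of two words, after the letters have been
combined by `c`. -/
def shuffleSum {γ : Type} {M : Type*} [AddCommGroup M] (c : α → β → γ) (φ : List γ → M)
    (X : List α) (Y : List β) : M :=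
  listExtension (fun p => φ (p.map fun q => c q.1 q.2)) (shuffle X Y)

section ShuffleSum

variable {γ : Type} {M : Type*} [AddCommGroup M] {c : α → β → γ} {φ : List γ → M}

lemma shuffleSum_nil_left (Y : List β) : shuffleSum c φ [] Y = 0 := by
  rw [shuffleSum, shuffle_nil_left, map_zero]

lemma shuffleSum_nil_right (X : List α) : shuffleSum c φ X [] = 0 := by
  rw [shuffleSum, shuffle_nil_right, map_zero]

lemma shuffleSum_singleton (x : α) (y : β) : shuffleSum c φ [x] [y] = φ [c x y] := by
  rw [shuffleSum, shuffle_singleton, listExtension_single]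
  rfl

lemma shuffleSum_cons_cons {x : α} {X : List α} {y : β} {Y : List β}
    (h : X = [] → Y = [] → False) : shuffleSum c φ (x :: X) (y :: Y) =
      shuffleSum c (fun l => φ (c x y :: l)) X (y :: Y) +
        (X.length : ℤ).negOnePow • shuffleSum c (fun l => φ (c x y :: l)) (x :: X) Y := by
  rw [shuffleSum, shuffle_cons_cons_of_ne h, listExtension_consMap, map_add, Units.smul_def,
    map_zsmul]
  rfl

/-- All the terms of the shuffle begin with the same letter. -/
lemma shuffleSum_eq_zero_of_head {x : α} {X : List α} {y : β} {Y : List β}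
    (h : ∀ l, φ (c x y :: l) = 0) : shuffleSum c φ (x :: X) (y :: Y) = 0 := by
  rw [shuffleSum, shuffle_cons_cons, listExtension_consMap]
  refine listExtension_eq_zero (s := Set.univ) (fun l _ => ?_) (by simp)
  rw [List.map_cons, h]

/-- If the letter combined with `x ≠ i` does not depend on the second word, and repetitions are
excluded, then the first word has to move on at `x`. -/
lemma shuffleSum_cons_cons_of_const {x : α} {X : List α} {y : β} {Y : List β} {d : γ}
    (hx : ∀ y, c x y = d) (hφ : ∀ l, ¬ l.Nodup → φ l = 0) (h : X = [] → Y = [] → False) :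
    shuffleSum c φ (x :: X) (y :: Y) = shuffleSum c (fun l => φ (d :: l)) X (y :: Y) := by
  rw [shuffleSum_cons_cons h, hx]
  rcases Y with _ | ⟨y', Y⟩
  · rw [shuffleSum_nil_right, smul_zero, add_zero]
  · rw [shuffleSum_eq_zero_of_head (x := x) (y := y'), smul_zero, add_zero]
    intro l
    rw [hx]
    exact hφ _ (by simp)

lemma not_nodup_cons {d : γ} {l : List γ} (h : ¬ l.Nodup) : ¬ (d :: l).Nodup :=
  fun h' => h h'.of_cons

/-- If the second word only matters at the letter `i`, which does not occur in the first word, then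
the second word has to be of length one. -/
lemma shuffleSum_of_notMem {i : α} {f : α → γ} (hf : ∀ x y, x ≠ i → c x y = f x)
    {X : List α} (hX : i ∉ X) (hX' : X ≠ []) (hφ : ∀ l, ¬ l.Nodup → φ l = 0) (Y : List β) :
    shuffleSum c φ X Y = if Y.length = 1 then φ (X.map f) else 0 := by
  rcases Y with _ | ⟨y, Y⟩
  · simp [shuffleSum_nil_right]
  induction X generalizing φ with
  | nil => exact absurd rfl hX'
  | cons x X ih =>
    rw [List.mem_cons, not_or] at hX
    have hx := hf x
    by_cases h : X = [] ∧ Y = []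
    · obtain ⟨rfl, rfl⟩ := h
      rw [shuffleSum_singleton, hx y (Ne.symm hX.1)]
      simp
    · rw [shuffleSum_cons_cons_of_const (fun y => hx y (Ne.symm hX.1)) hφ fun h₁ h₂ => h ⟨h₁, h₂⟩]
      rcases eq_or_ne X [] with rfl | hne
      · have : Y ≠ [] := fun e => h ⟨rfl, e⟩
        rw [shuffleSum_nil_left, if_neg]
        simpa using this
      · rw [ih hX.2 hne fun l hl => hφ _ (not_nodup_cons hl)]
        rfl

/-- If the letter `i`, at which the second word matters, occurs exactly once in the first word, then
the second word has to be read entirely at this letter. -/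
lemma shuffleSum_of_mem {i : α} {f : α → γ} {g : β → γ} (hf : ∀ x y, x ≠ i → c x y = f x)
    (hg : ∀ y, c i y = g y) {X₁ X₂ : List α} (h₁ : i ∉ X₁) (h₂ : i ∉ X₂)
    (hφ : ∀ l, ¬ l.Nodup → φ l = 0) {Y : List β} (hY : Y ≠ []) :
    shuffleSum c φ (X₁ ++ i :: X₂) Y =
      ((X₂.length : ℤ) * (Y.length - 1)).negOnePow • φ (X₁.map f ++ (Y.map g ++ X₂.map f)) := by
  induction X₁ generalizing φ with
  | nil =>
    simp only [List.nil_append, List.map_nil]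
    induction Y generalizing φ with
    | nil => exact absurd rfl hY
    | cons y Y ih =>
      have hφ' : ∀ l, ¬ l.Nodup → φ (g y :: l) = 0 := fun l hl => hφ _ (not_nodup_cons hl)
      rcases eq_or_ne Y [] with rfl | hne
      · rcases eq_or_ne X₂ [] with rfl | hX₂
        · rw [shuffleSum_singleton, hg]
          simp
        · rw [shuffleSum_cons_cons fun h => absurd h hX₂, shuffleSum_nil_right, hg,
            shuffleSum_of_notMem hf h₂ hX₂ hφ']
          simp
      · have hz : shuffleSum c (fun l => φ (g y :: l)) X₂ (y :: Y) = 0 := by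
          rcases eq_or_ne X₂ [] with rfl | hX₂
          · rw [shuffleSum_nil_left]
          · rw [shuffleSum_of_notMem hf h₂ hX₂ hφ', if_neg]
            simpa using hne
        rw [shuffleSum_cons_cons fun _ h => absurd h hne, hg, hz, zero_add, ih hne hφ', smul_smul,
          ← Int.negOnePow_add, List.length_cons]
        congr 2
        push_cast
        ring
  | cons x X ih =>
    rw [List.mem_cons, not_or] at h₁
    rcases Y with _ | ⟨y, Y⟩
    · exact absurd rfl hY
    rw [List.cons_append, shuffleSum_cons_cons_of_const (fun y => hf x y (Ne.symm h₁.1)) hφ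
      (by simp), ih h₁.2 fun l hl => hφ _ (not_nodup_cons hl)]
    rfl

lemma shuffleSum_of_mem_of_head {i : α} {f : α → γ} (hf : ∀ x y, x ≠ i → c x y = f x)
    {X : List α} (hX : i ∈ X) {y : β} {Y : List β} (hφ : ∀ l, ¬ l.Nodup → φ l = 0)
    (hφ' : ∀ l, c i y ∈ l → φ l = 0) : shuffleSum c φ X (y :: Y) = 0 := by
  induction X generalizing φ with
  | nil => simp at hX
  | cons x X ih =>
    by_cases hx : x = i
    · subst hx
      exact shuffleSum_eq_zero_of_head fun l => hφ' _ List.mem_cons_self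
    · have hX' : i ∈ X := (List.mem_cons.1 hX).resolve_left (Ne.symm hx)
      rw [shuffleSum_cons_cons_of_const (fun y => hf x y hx) hφ fun h => by simp [h] at hX']
      exact ih hX' (fun l hl => hφ _ (not_nodup_cons hl)) fun l hl =>
        hφ' _ (List.mem_cons_of_mem _ hl)

/-- If the letter `i` occurs more than once in the first word, then each term of the shuffle has a
repetition. -/
lemma shuffleSum_of_mem_of_mem {i : α} {f : α → γ} (hf : ∀ x y, x ≠ i → c x y = f x)
    {X₁ X₂ : List α} (h₁ : i ∉ X₁) (h₂ : i ∈ X₂) (hφ : ∀ l, ¬ l.Nodup → φ l = 0) (Y : List β) :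
    shuffleSum c φ (X₁ ++ i :: X₂) Y = 0 := by
  induction X₁ generalizing φ with
  | nil =>
    rw [List.nil_append]
    induction Y generalizing φ with
    | nil => exact shuffleSum_nil_right _
    | cons y Y ih =>
      rw [shuffleSum_cons_cons fun h => by simp [h] at h₂,
        ih fun l hl => hφ _ (not_nodup_cons hl), smul_zero, add_zero]
      exact shuffleSum_of_mem_of_head hf h₂ (fun l hl => hφ _ (not_nodup_cons hl)) fun l hl =>
        hφ _ fun h => (List.nodup_cons.1 h).1 hl
  | cons x X ih =>
    rw [List.mem_cons, not_or] at h₁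
    rcases Y with _ | ⟨y, Y⟩
    · exact shuffleSum_nil_right _
    rw [List.cons_append, shuffleSum_cons_cons_of_const (fun y => hf x y (Ne.symm h₁.1)) hφ
      (by simp)]
    exact ih h₁.2 fun l hl => hφ _ (not_nodup_cons hl)

end ShuffleSum

end Words

/-! ### The cocycles `ε_r` and the composition products -/

section Blocks

variable {r s : ℕ}

/-- The letters outside of the slot `i`, after the substitution of a nonempty block of length `s`
in this slot. -/
def outerLetter (hs : s ≠ 0) (i x : Fin (r + 1)) : Fin (r + s) :=
  if x < i then ⟨x.val, by omega⟩ else ⟨x.val + s - 1, by omega⟩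

/-- The letter `x`, respectively `y` in the block which is substituted for the letter `i`. -/
def blockLetter (hs : s ≠ 0) (i x : Fin (r + 1)) (y : Fin s) : Fin (r + s) :=
  if x = i then slotEquiv i (Sum.inr y) else outerLetter hs i x

lemma outerLetter_val (hs : s ≠ 0) (i x : Fin (r + 1)) :
    (outerLetter hs i x).val = if x.val < i.val then x.val else x.val + s - 1 := by
  unfold outerLetter
  simp only [Fin.lt_def]
  split_ifs <;> rfl

lemma outerLetter_lt_iff (hs : s ≠ 0) {i x y : Fin (r + 1)} (hx : x ≠ i) (hy : y ≠ i) :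
    outerLetter hs i x < outerLetter hs i y ↔ x < y := by
  rw [← Fin.val_ne_iff] at hx hy
  rw [Fin.lt_def, outerLetter_val, outerLetter_val, Fin.lt_def]
  split_ifs <;> omega

lemma outerLetter_lt_block_iff (hs : s ≠ 0) {i x : Fin (r + 1)} (k : Fin s) :
    outerLetter hs i x < slotEquiv i (Sum.inr k) ↔ x < i := by
  rw [Fin.lt_def, outerLetter_val, slotEquiv_inr_val, Fin.lt_def]
  split_ifs <;> omega

lemma block_lt_outerLetter_iff (hs : s ≠ 0) {i x : Fin (r + 1)} (hx : x ≠ i) (k : Fin s) :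
    slotEquiv i (Sum.inr k) < outerLetter hs i x ↔ i < x := by
  rw [← Fin.val_ne_iff] at hx
  rw [Fin.lt_def, outerLetter_val, slotEquiv_inr_val, Fin.lt_def]
  split_ifs <;> omega

lemma block_lt_block_iff {i : Fin (r + 1)} (k l : Fin s) :
    slotEquiv i (Sum.inr k) < slotEquiv i (Sum.inr l) ↔ k < l := by
  rw [Fin.lt_def, slotEquiv_inr_val, slotEquiv_inr_val, Fin.lt_def]
  omega

lemma outerLetter_injOn (hs : s ≠ 0) {i x y : Fin (r + 1)} (hx : x ≠ i) (hy : y ≠ i)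
    (h : outerLetter hs i x = outerLetter hs i y) : x = y := by
  have h₁ := outerLetter_lt_iff hs hx hy
  have h₂ := outerLetter_lt_iff hs hy hx
  rw [h] at h₁ h₂
  simp only [lt_self_iff_false, false_iff, not_lt] at h₁ h₂
  exact le_antisymm h₂ h₁

lemma outerLetter_ne_block (hs : s ≠ 0) {i x : Fin (r + 1)} (hx : x ≠ i) (k : Fin s) :
    outerLetter hs i x ≠ slotEquiv i (Sum.inr k) := by
  intro h
  have h₁ := outerLetter_lt_block_iff hs (i := i) (x := x) k
  have h₂ := block_lt_outerLetter_iff hs hx k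
  rw [h] at h₁ h₂
  simp only [lt_self_iff_false, false_iff, not_lt] at h₁ h₂
  exact hx (le_antisymm h₂ h₁)

lemma crossInv_map {m n : ℕ} {l l' : List (Fin m)} {f g : Fin m → Fin n}
    (h : ∀ x ∈ l, ∀ y ∈ l', g y < f x ↔ y < x) :
    crossInv (l.map f) (l'.map g) = crossInv l l' := by
  unfold crossInv
  rw [List.map_map]
  congr 1
  refine List.map_congr_left fun x hx => ?_
  rw [Function.comp_apply, List.countP_map]
  refine List.countP_congr fun y hy => ?_
  simpa using h x hx y hy

lemma wordInv_map {m n : ℕ} {l : List (Fin m)} {f : Fin m → Fin n}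
    (h : ∀ x ∈ l, ∀ y ∈ l, f y < f x ↔ y < x) : wordInv (l.map f) = wordInv l := by
  induction l with
  | nil => rfl
  | cons a l ih =>
    have hc := crossInv_map (l := [a]) (l' := l) (f := f) (g := f) fun x hx y hy => h x (by
      rw [List.mem_singleton] at hx
      simp [hx]) y (List.mem_cons_of_mem _ hy)
    rw [List.map_singleton] at hc
    have e : ∀ (k : ℕ) (b : Fin k) (l : List (Fin k)),
        wordInv (b :: l) = crossInv [b] l + wordInv l := fun k b l => by
      simp [wordInv, crossInv]
    rw [List.map_cons, e, e, hc, ih fun x hx y hy =>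
      h x (List.mem_cons_of_mem _ hx) y (List.mem_cons_of_mem _ hy)]

/-- Each letter of the block is in the same position as `i` with respect to the other letters. -/
lemma crossInv_outer_block (hs : s ≠ 0) {i : Fin (r + 1)} {X : List (Fin (r + 1))} (hX : i ∉ X)
    (Y : List (Fin s)) :
    crossInv (X.map (outerLetter hs i)) (Y.map fun y => slotEquiv i (Sum.inr y)) =
      Y.length * crossInv X [i] := by
  induction X with
  | nil => simp [crossInv]
  | cons x X ih =>
    rw [List.mem_cons, not_or] at hX
    rw [List.map_cons, crossInv_cons_left, ih hX.2, crossInv_cons_left, mul_add, List.countP_map]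
    congr 1
    by_cases h : i < x
    · rw [List.countP_eq_length.2]
      · simp [h]
      · intro y _
        simpa using (block_lt_outerLetter_iff hs (Ne.symm hX.1) y).2 h
    · rw [List.countP_eq_zero.2]
      · simp [h]
      · intro y _
        simpa using fun h' => h ((block_lt_outerLetter_iff hs (Ne.symm hX.1) y).1 h')

lemma crossInv_block_outer (hs : s ≠ 0) {i : Fin (r + 1)} {X : List (Fin (r + 1))}
    (Y : List (Fin s)) :
    crossInv (Y.map fun y => slotEquiv i (Sum.inr y)) (X.map (outerLetter hs i)) =
      Y.length * crossInv [i] X := by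
  induction Y with
  | nil => simp [crossInv]
  | cons y Y ih =>
    rw [List.map_cons, crossInv_cons_left, ih, List.length_cons, add_mul, one_mul, add_comm,
      List.countP_map]
    congr 1
    rw [crossInv_cons_left, crossInv_nil_left, add_zero]
    refine List.countP_congr fun x _ => ?_
    simpa using outerLetter_lt_block_iff hs y

/-- In a permutation word, the letters greater than `i` on its left, the letters less than `i` on
its right and the letters on its right are together `r - i`, up to an even number. -/
lemma crossInv_letter {i : Fin (r + 1)} {X₁ X₂ : List (Fin (r + 1))}
    (hnd : (X₁ ++ i :: X₂).Nodup) (hlen : (X₁ ++ i :: X₂).length = r + 1) :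
    crossInv X₁ [i] + crossInv [i] X₂ + X₂.length = r - i.val + 2 * X₂.countP (· < i) := by
  classical
  have hcount : (X₁ ++ i :: X₂).countP (i < ·) = r - i.val := by
    have huniv : (X₁ ++ i :: X₂).toFinset = Finset.univ :=
      Finset.eq_univ_of_card _ (by rw [List.toFinset_card_of_nodup hnd, hlen, Fintype.card_fin])
    rw [List.countP_eq_length_filter, ← List.toFinset_card_of_nodup (hnd.filter _),
      List.toFinset_filter, huniv]
    have : (Finset.univ.filter fun x => decide (i < x) = true) = Finset.Ioi i := by
      ext x
      simp
    rw [this, Fin.card_Ioi]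
    omega
  have h₁ : crossInv X₁ [i] = X₁.countP (i < ·) := by
    clear hnd hlen hcount
    induction X₁ with
    | nil => rfl
    | cons x X ih =>
      simp only [crossInv_cons_left, ih, List.countP_cons, List.countP_nil, decide_eq_true_eq]
      ring
  have h₂ : crossInv [i] X₂ = X₂.countP (· < i) := by simp [crossInv]
  have h₃ : X₂.length = X₂.countP (· < i) + X₂.countP (i < ·) := by
    have hi : i ∉ X₂ := fun h => (List.nodup_cons.1 hnd.of_append_right).1 h
    clear hnd hlen hcount h₂
    induction X₂ with
    | nil => rfl
    | cons x X ih =>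
      rw [List.mem_cons, not_or] at hi
      rw [List.length_cons, ih hi.2, List.countP_cons, List.countP_cons]
      rcases lt_or_gt_of_ne hi.1 with h | h <;> simp [h, h.not_gt] <;> ring
  rw [List.countP_append, List.countP_cons] at hcount
  simp only [lt_self_iff_false, decide_false, Bool.false_eq_true, if_false, add_zero] at hcount
  omega

/-- The substitution of a permutation word for a letter of a permutation word. -/
lemma wordSign_substitution (hs : s ≠ 0) {i : Fin (r + 1)} {X₁ X₂ : List (Fin (r + 1))}
    (h₁ : i ∉ X₁) (h₂ : i ∉ X₂) (Y : List (Fin s)) :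
    ((X₂.length : ℤ) * (Y.length - 1)).negOnePow •
      wordSign (X₁.map (outerLetter hs i) ++
        (Y.map (fun y => slotEquiv i (Sum.inr y)) ++ X₂.map (outerLetter hs i))) =
      (((s : ℤ) - 1) * (r - i.val)).negOnePow • (wordSign (X₁ ++ i :: X₂) * wordSign Y) := by
  have hX : (X₁ ++ i :: X₂).Nodup ↔ (X₁ ++ X₂).Nodup := by
    rw [List.perm_middle.nodup_iff, List.nodup_cons, List.mem_append]
    simp [h₁, h₂]
  by_cases h : ((X₁ ++ i :: X₂).length = r + 1 ∧ (X₁ ++ i :: X₂).Nodup) ∧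
      (Y.length = s ∧ Y.Nodup)
  · obtain ⟨⟨hl, hn⟩, hl', hn'⟩ := h
    have hn₀ := hX.1 hn
    rw [List.nodup_append] at hn₀
    have hmem₁ : ∀ x ∈ X₁, x ≠ i := fun x hx e => h₁ (e ▸ hx)
    have hmem₂ : ∀ x ∈ X₂, x ≠ i := fun x hx e => h₂ (e ▸ hx)
    rw [wordSign_eq hl hn, wordSign_eq hl' hn', wordSign_eq]
    · rw [Units.smul_def, Units.smul_def, smul_eq_mul, smul_eq_mul, ← Units.val_mul,
        ← Units.val_mul, ← Units.val_mul, ← Int.negOnePow_add, ← Int.negOnePow_add,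
        ← Int.negOnePow_add]
      congr 1
      have e₁ : X₁ ++ i :: X₂ = X₁ ++ ([i] ++ X₂) := rfl
      have hc := crossInv_letter hn hl
      have hi : (r : ℤ) - i.val = ((r - i.val : ℕ) : ℤ) := by
        have := i.is_lt
        omega
      rw [e₁]
      simp only [wordInv_append, crossInv_append_right, crossInv_outer_block hs h₁,
        crossInv_block_outer hs, wordInv_singleton]
      rw [wordInv_map fun x hx y hy => outerLetter_lt_iff hs (hmem₁ y hy) (hmem₁ x hx),
        wordInv_map fun x hx y hy => outerLetter_lt_iff hs (hmem₂ y hy) (hmem₂ x hx),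
        crossInv_map fun x hx y hy => outerLetter_lt_iff hs (hmem₂ y hy) (hmem₁ x hx),
        wordInv_map fun x _ y _ => block_lt_block_iff y x, hl', hi]
      generalize r - i.val = k at hc
      have hc' := congrArg (Nat.cast : ℕ → ZMod 2) hc
      push_cast at hc'
      have two : (2 : ZMod 2) = 0 := rfl
      refine negOnePow_congr ?_
      push_cast
      linear_combination ((s : ZMod 2) - 1) * hc' + ((s : ZMod 2) - 1) * (X₂.countP (· < i) : ZMod 2) * two
    · simp only [List.length_append, List.length_map, List.length_cons] at hl ⊢
      omega
    · rw [List.nodup_append, List.nodup_append]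
      refine ⟨hn₀.1.map_on fun x hx y hy h => outerLetter_injOn hs (hmem₁ x hx) (hmem₁ y hy) h,
        ⟨hn'.map fun x y h => by simpa using h,
          hn₀.2.1.map_on fun x hx y hy h => outerLetter_injOn hs (hmem₂ x hx) (hmem₂ y hy) h, ?_⟩, ?_⟩
      · intro a ha b hb
        obtain ⟨y, _, rfl⟩ := List.mem_map.1 ha
        obtain ⟨x, hx, rfl⟩ := List.mem_map.1 hb
        exact (outerLetter_ne_block hs (hmem₂ x hx) y).symm
      · intro a ha b hb
        obtain ⟨x, hx, rfl⟩ := List.mem_map.1 ha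
        rcases List.mem_append.1 hb with hb | hb
        · obtain ⟨y, _, rfl⟩ := List.mem_map.1 hb
          exact outerLetter_ne_block hs (hmem₁ x hx) y
        · obtain ⟨x', hx', rfl⟩ := List.mem_map.1 hb
          exact fun h => hn₀.2.2 x hx x' hx' (outerLetter_injOn hs (hmem₁ x hx) (hmem₂ x' hx') h)
  · have hR : wordSign (X₁ ++ i :: X₂) * wordSign Y = 0 := by
      rw [not_and_or] at h
      rcases h with h | h
      · rw [wordSign, if_neg h, zero_mul]
      · rw [mul_comm, wordSign, if_neg h, zero_mul]
    rw [hR, smul_zero, wordSign, if_neg, smul_zero]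
    rintro ⟨hl, hn⟩
    have hY : Y.Nodup := ((List.nodup_append.1 (List.nodup_append.1 hn).2.1).1).of_map
    have hXX : (X₁ ++ X₂).Nodup := by
      refine List.Nodup.of_map (outerLetter hs i) ?_
      rw [List.map_append]
      exact hn.sublist ((List.sublist_append_right _ _).append_left _)
    have hXi := hX.2 hXX
    have c₁ := hXi.length_le_card
    have c₂ := hY.length_le_card
    rw [Fintype.card_fin] at c₁ c₂
    refine h ⟨⟨?_, hXi⟩, ?_, hY⟩ <;>
    · simp only [List.length_append, List.length_map, List.length_cons] at hl c₁ ⊢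
      omega

/-- The signatures of the terms of a shuffle of words, where the letters of the second word are
substituted for the letter `i` of the first one. -/
lemma shuffleSum_wordSign (hs : s ≠ 0) (i : Fin (r + 1)) (X : List (Fin (r + 1)))
    (Y : List (Fin s)) :
    shuffleSum (blockLetter hs i) wordSign X Y =
      (((s : ℤ) - 1) * (r - i.val)).negOnePow • (wordSign X * wordSign Y) := by
  have hf : ∀ x y, x ≠ i → blockLetter hs i x y = outerLetter hs i x := fun x y h => if_neg h
  have hg : ∀ y, blockLetter hs i i y = slotEquiv i (Sum.inr y) := fun y => if_pos rfl
  have hφ : ∀ l : List (Fin (r + s)), ¬ l.Nodup → wordSign l = 0 := fun l => wordSign_of_not_nodup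
  by_cases hi : i ∈ X
  · obtain ⟨X₁, X₂, rfl, h₁⟩ := List.eq_append_cons_of_mem hi
    by_cases h₂ : i ∈ X₂
    · rw [shuffleSum_of_mem_of_mem hf h₁ h₂ hφ, wordSign_of_not_nodup (l := X₁ ++ i :: X₂),
        zero_mul, smul_zero]
      exact fun h => (List.nodup_cons.1 h.of_append_right).1 h₂
    · rcases eq_or_ne Y [] with rfl | hY
      · rw [shuffleSum_nil_right, wordSign_of_length_ne (l := ([] : List (Fin s))), mul_zero,
          smul_zero]
        exact fun h => hs h.symm
      · rw [shuffleSum_of_mem hf hg h₁ h₂ hφ hY, wordSign_substitution hs h₁ h₂]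
  · have hR : wordSign X = 0 := by
      by_cases hn : X.Nodup
      · refine wordSign_of_length_ne fun hl => ?_
        have := (List.nodup_cons.2 ⟨hi, hn⟩).length_le_card
        rw [Fintype.card_fin, List.length_cons] at this
        omega
      · exact wordSign_of_not_nodup hn
    rw [hR, zero_mul, smul_zero]
    rcases eq_or_ne X [] with rfl | hX
    · exact shuffleSum_nil_left _
    · rw [shuffleSum_of_notMem hf hi hX hφ]
      split_ifs
      · by_cases hn : X.Nodup
        · refine wordSign_of_length_ne fun hl => ?_
          have := (List.nodup_cons.2 ⟨hi, hn⟩).length_le_card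
          rw [Fintype.card_fin, List.length_cons] at this
          rw [List.length_map] at hl
          omega
        · exact wordSign_of_not_nodup fun h => hn h.of_map
      · rfl

/-- The first letter of a substitution of permutations. -/
lemma permComp_first (hs : s ≠ 0) (i : Fin (r + 1)) (w : Equiv.Perm (Fin (r + 1)))
    (u : Equiv.Perm (Fin s)) (z : Fin (r + s)) (hz : z.val = 0) (z' : Fin s) (hz' : z'.val = 0) :
    permComp i w u z = blockLetter hs i (w 0) (u z') := by
  unfold blockLetter
  split_ifs with h
  · have hi : w.symm i = 0 := by rw [← h, Equiv.symm_apply_apply]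
    have hz₁ : z = slotEquiv (w.symm i) (Sum.inr z') := Fin.ext (by
      rw [slotEquiv_inr_val, hi, hz, hz']
      rfl)
    rw [hz₁]
    simp [permComp]
  · have hi : w.symm i ≠ 0 := fun e => h (by rw [← e, Equiv.apply_symm_apply])
    have hpos : 0 < (w.symm i).val := Nat.pos_of_ne_zero fun e => hi (Fin.ext e)
    have hr : 0 < r := by
      have := (w.symm i).is_lt
      omega
    have hz₁ : z = slotEquiv (w.symm i) (Sum.inl ⟨0, hr⟩) := Fin.ext (by
      rw [slotEquiv_inl_val, hz, if_pos hpos])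
    rw [hz₁]
    simp only [permComp, Equiv.trans_apply, Equiv.symm_apply_apply, Equiv.sumCongr_apply,
      Sum.map_inl]
    have key : i.succAbove ((finSuccAboveEquiv i).symm ((w.subtypeEquiv fun _ => not_congr
        (Equiv.eq_symm_apply w)) (finSuccAboveEquiv (w.symm i) ⟨0, hr⟩))) = w 0 := by
      have h₁ := congrArg Subtype.val ((finSuccAboveEquiv i).apply_symm_apply
        ((w.subtypeEquiv fun _ => not_congr (Equiv.eq_symm_apply w))
          (finSuccAboveEquiv (w.symm i) ⟨0, hr⟩)))
      have h₀ : (w.symm i).succAbove ⟨0, hr⟩ = 0 := by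
        refine Fin.ext ?_
        rw [succAbove_val, if_pos hpos]
        rfl
      simp only [finSuccAboveEquiv_apply, Equiv.subtypeEquiv_apply, h₀] at h₁
      simpa only [finSuccAboveEquiv_apply, Equiv.subtypeEquiv_apply, h₀] using h₁
    generalize (finSuccAboveEquiv i).symm _ = q at key
    refine Fin.ext ?_
    have hv := succAbove_val i q
    rw [key] at hv
    rw [slotEquiv_inl_val, outerLetter_val, hv]
    split_ifs <;> omega

/-- The shuffle product is natural. -/
lemma shuffleSum_map {α β α' β' γ : Type} {M : Type*} [AddCommGroup M] (f : α → α') (g : β → β')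
    (c : α' → β' → γ) (φ : List γ → M) (l : List α) (m : List β) :
    shuffleSum c φ (l.map f) (m.map g) = shuffleSum (fun x y => c (f x) (g y)) φ l m := by
  induction l, m using shuffle.induct generalizing φ with
  | case1 m => rw [List.map_nil, shuffleSum_nil_left, shuffleSum_nil_left]
  | case2 a l => rw [List.map_nil, shuffleSum_nil_right, shuffleSum_nil_right]
  | case3 x y => simp only [List.map_cons, List.map_nil, shuffleSum_singleton]
  | case4 x xs y ys h ih₁ ih₂ =>
    rw [List.map_cons, List.map_cons, shuffleSum_cons_cons fun h₁ h₂ => h (by simpa using h₁)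
      (by simpa using h₂), shuffleSum_cons_cons h, ← ih₁, ← ih₂, List.length_map]
    rfl

/-- The value of `ε` on the composites of two simplices. -/
lemma epsilon_shuffle (hs : s ≠ 0) (i : Fin (r + 1)) (l : List (Equiv.Perm (Fin (r + 1))))
    (m : List (Equiv.Perm (Fin s))) :
    listExtension (fun p => epsilon (p.map fun q => permComp i q.1 q.2)) (shuffle l m) =
      (((s : ℤ) - 1) * (r - i.val)).negOnePow • (epsilon l * epsilon m) := by
  obtain ⟨z, hz⟩ : ∃ z : Fin (r + s), z.val = 0 := ⟨⟨0, by omega⟩, rfl⟩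
  obtain ⟨z', hz'⟩ : ∃ z : Fin s, z.val = 0 := ⟨⟨0, by omega⟩, rfl⟩
  rw [epsilon_eq_wordSign 0 rfl, epsilon_eq_wordSign z' hz', ← shuffleSum_wordSign hs i]
  rw [shuffleSum_map]
  unfold shuffleSum
  congr 1
  refine congrArg _ (funext fun p => ?_)
  rw [epsilon_eq_wordSign z hz, List.map_map]
  congr 1
  refine List.map_congr_left fun q _ => ?_
  exact permComp_first hs i q.1 q.2 z hz z' hz'

end Blocks

/-! ### Degenerate simplices -/

section Degenerate

variable {α β γ : Type} {M : Type*} [AddCommGroup M]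

lemma not_isChain_cons {a : α} {l : List α} (h : ¬ (a :: l).IsChain (· ≠ ·)) :
    ¬ l.IsChain (· ≠ ·) ∨ ∃ m, l = a :: m := by
  rcases l with _ | ⟨b, l⟩
  · simp at h
  · rw [List.isChain_cons_cons, not_and_or, not_not] at h
    rcases h with rfl | h
    · exact Or.inr ⟨l, rfl⟩
    · exact Or.inl h

lemma not_isChain_cons_of {a : α} {l : List α} (h : ¬ l.IsChain (· ≠ ·)) :
    ¬ (a :: l).IsChain (· ≠ ·) := fun h' => h h'.of_cons

lemma not_isChain_cons_cons_self {a : α} {l : List α} : ¬ (a :: a :: l).IsChain (· ≠ ·) := by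
  simp [List.isChain_cons_cons]

lemma not_isChain_map (f : α → β) {l : List α} (h : ¬ l.IsChain (· ≠ ·)) :
    ¬ (l.map f).IsChain (· ≠ ·) := by
  rw [List.isChain_map]
  exact fun h' => h (h'.imp fun _ _ hne e => hne (congrArg f e))

/-- The boundary preserves degeneracy. -/
lemma listExtension_listBoundary_eq_zero {φ : List α → M}
    (hφ : ∀ l, ¬ l.IsChain (· ≠ ·) → φ l = 0) {l : List α} (hl : ¬ l.IsChain (· ≠ ·)) :
    listExtension φ (listBoundary l) = 0 := by
  induction l generalizing φ with
  | nil => simp at hl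
  | cons a l ih =>
    rw [listBoundary, map_sub, listExtension_single, listExtension_consMap]
    rcases not_isChain_cons hl with h | ⟨m, rfl⟩
    · rw [hφ l h, ih (fun m hm => hφ _ (not_isChain_cons_of hm)) h, sub_zero]
    · rw [listBoundary, map_sub, listExtension_single, listExtension_consMap,
        listExtension_eq_zero (s := Set.univ) (fun m _ => hφ _ not_isChain_cons_cons_self)
          (by simp), sub_zero, sub_self]

/-- The shuffle product preserves degeneracy in the first factor. -/
lemma shuffleSum_eq_zero_left {c : α → β → γ} {φ : List γ → M}
    (hφ : ∀ l, ¬ l.IsChain (· ≠ ·) → φ l = 0) {l : List α} (hl : ¬ l.IsChain (· ≠ ·))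
    (m : List β) : shuffleSum c φ l m = 0 := by
  induction l, m using shuffle.induct generalizing φ with
  | case1 m => exact shuffleSum_nil_left _
  | case2 a l => exact shuffleSum_nil_right _
  | case3 x y => simp at hl
  | case4 x xs y ys h ih₁ ih₂ =>
    have hφ' : ∀ l, ¬ l.IsChain (· ≠ ·) → φ (c x y :: l) = 0 := fun l hl =>
      hφ _ (not_isChain_cons_of hl)
    rw [shuffleSum_cons_cons h, ih₂ hφ' hl, smul_zero, add_zero]
    rcases not_isChain_cons hl with hl | ⟨m, rfl⟩
    · exact ih₁ hφ' hl
    · exact shuffleSum_eq_zero_of_head fun l => hφ _ not_isChain_cons_cons_self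

/-- The shuffle product preserves degeneracy in the second factor. -/
lemma shuffleSum_eq_zero_right {c : α → β → γ} {φ : List γ → M}
    (hφ : ∀ l, ¬ l.IsChain (· ≠ ·) → φ l = 0) (l : List α) {m : List β}
    (hm : ¬ m.IsChain (· ≠ ·)) : shuffleSum c φ l m = 0 := by
  induction l, m using shuffle.induct generalizing φ with
  | case1 m => exact shuffleSum_nil_left _
  | case2 a l => exact shuffleSum_nil_right _
  | case3 x y => simp at hm
  | case4 x xs y ys h ih₁ ih₂ =>
    have hφ' : ∀ l, ¬ l.IsChain (· ≠ ·) → φ (c x y :: l) = 0 := fun l hl =>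
      hφ _ (not_isChain_cons_of hl)
    rw [shuffleSum_cons_cons h, ih₁ hφ' hm, zero_add]
    rcases not_isChain_cons hm with hm | ⟨m, rfl⟩
    · rw [ih₂ hφ' hm, smul_zero]
    · have hz : shuffleSum c (fun l => φ (c x y :: l)) (x :: xs) (y :: m) = 0 :=
        shuffleSum_eq_zero_of_head fun l => hφ _ not_isChain_cons_cons_self
      rw [hz, smul_zero]

/-- The diagonal preserves degeneracy. -/
lemma diagonalSum_eq_zero {B : List α → List α → M}
    (hB : ∀ p q, ¬ p.IsChain (· ≠ ·) → B p q = 0) (hB' : ∀ p q, ¬ q.IsChain (· ≠ ·) → B p q = 0)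
    {l : List α} (hl : ¬ l.IsChain (· ≠ ·)) : diagonalSum B l = 0 := by
  induction l generalizing B with
  | nil => rfl
  | cons a l ih =>
    rw [diagonalSum_cons, hB' _ _ hl, zero_add]
    rcases not_isChain_cons hl with h | ⟨m, rfl⟩
    · exact ih (fun p q hp => hB _ _ (not_isChain_cons_of hp)) (fun p q hq => hB' _ _ hq) h
    · refine Finset.sum_eq_zero fun k _ => ?_
      rw [List.take_succ_cons]
      exact hB _ _ not_isChain_cons_cons_self

/-- The diagonal is a chain map, up to the terms with an empty factor. -/
lemma diagonalSum_listBoundary (B : List α → List α → M) (l : List α) :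
    listExtension (diagonalSum B) (listBoundary l) =
      ∑ k ∈ range l.length, (listExtension (fun p => B p (l.drop k)) (listBoundary (l.take (k + 1)))
        + (k : ℤ).negOnePow • listExtension (B (l.take (k + 1))) (listBoundary (l.drop k)))
      - B [] l + (l.length : ℤ).negOnePow • B l [] := by
  induction l generalizing B with
  | nil => simp [listBoundary]
  | cons a l ih =>
    have e₁ : listExtension (diagonalSum B) (listBoundary (a :: l)) = diagonalSum B l -
        (listExtension (fun m => B [a] (a :: m)) (listBoundary l) +
          listExtension (diagonalSum fun p q => B (a :: p) q) (listBoundary l)) := by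
      rw [listBoundary, map_sub, listExtension_single, listExtension_consMap]
      congr 1
      have := listChain_ext (f := listExtension fun l => diagonalSum B (a :: l))
        (g := listExtension (fun l => B [a] (a :: l)) +
          listExtension (diagonalSum fun p q => B (a :: p) q)) (fun l => ?_) (listBoundary l)
      · exact this
      · rw [LinearMap.add_apply, listExtension_single, listExtension_single, listExtension_single,
          diagonalSum_cons]
    have e₂ : ∀ k, listExtension (fun p => B p ((a :: l).drop (k + 1)))
          (listBoundary ((a :: l).take (k + 1 + 1))) + ((k + 1 : ℕ) : ℤ).negOnePow •
            listExtension (B ((a :: l).take (k + 1 + 1))) (listBoundary ((a :: l).drop (k + 1))) =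
        B (l.take (k + 1)) (l.drop k) -
          (listExtension (fun p => B (a :: p) (l.drop k)) (listBoundary (l.take (k + 1))) +
          (k : ℤ).negOnePow • listExtension (B (a :: l.take (k + 1))) (listBoundary (l.drop k))) := by
      intro k
      rw [List.take_succ_cons, List.drop_succ_cons, listBoundary, map_sub, listExtension_single,
        listExtension_consMap, Nat.cast_add, Nat.cast_one, Int.negOnePow_succ, Units.neg_smul]
      abel
    rw [e₁, ih, List.length_cons, Finset.sum_range_succ', Finset.sum_congr rfl fun k _ => e₂ k,
      Finset.sum_sub_distrib, Nat.cast_add, Nat.cast_one, Int.negOnePow_succ, Units.neg_smul]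
    simp only [zero_add, List.take_succ_cons, List.take_zero, List.drop_zero, Nat.cast_zero,
      Int.negOnePow_zero, one_smul]
    have e₃ : listExtension (fun p => B p (a :: l)) (listBoundary [a]) = B [] (a :: l) := by
      rw [listBoundary, listBoundary, map_zero, sub_zero, listExtension_single]
    have e₄ : listExtension (B [a]) (listBoundary (a :: l)) =
        B [a] l - listExtension (fun m => B [a] (a :: m)) (listBoundary l) := by
      rw [listBoundary, map_sub, listExtension_single, listExtension_consMap]
    rw [e₃, e₄, diagonalSum]
    abel

end Degenerate

/-! ### The structure maps of the Barratt-Eccles operad on degenerate simplices -/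

section BarrattEccles

variable (F : Type u) [Field F] {r s : ℕ}

lemma chain_of_not_isChain {l : List (Equiv.Perm (Fin r))} (h : ¬ l.IsChain (· ≠ ·)) :
    chain F l = 0 := dif_neg fun h' => h h'.2.2

lemma chain_nil : chain F ([] : List (Equiv.Perm (Fin r))) = 0 := dif_neg fun h => h.2.1 rfl

/-- The list of vertices of a simplex. -/
def Simplex.toList (w : Simplex r) : List (Equiv.Perm (Fin r)) := w.1

/-- The simplex with a given list of vertices. -/
def Simplex.ofList (l : List (Equiv.Perm (Fin r))) (hr : r ≠ 0) (hl : l ≠ [])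
    (hc : l.IsChain (· ≠ ·)) : Simplex r := ⟨l, hr, hl, hc⟩

lemma Simplex.toList_ofList (l : List (Equiv.Perm (Fin r))) (hr : r ≠ 0) (hl : l ≠ [])
    (hc : l.IsChain (· ≠ ·)) : (Simplex.ofList l hr hl hc).toList = l := rfl

lemma Simplex.arity_ne_zero (w : Simplex r) : r ≠ 0 := w.2.1

lemma Simplex.dim_eq (w : Simplex r) : w.dim = (w.toList.length : ℤ) - 1 := rfl

lemma chain_toList (w : Simplex r) : chain F w.toList = Finsupp.single w 1 := dif_pos w.2

/-- A linear map on normalized chains may be computed on all lists of vertices, by a formula that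
vanishes on degenerate lists. -/
lemma linearExtension_chain {M : Type u} [AddCommGroup M] [Module F M] {f : Simplex r → M}
    {g : List (Equiv.Perm (Fin r)) → M} (hr : r ≠ 0) (hfg : ∀ w : Simplex r, f w = g w.toList)
    (hnil : g [] = 0) (hg : ∀ l, ¬ l.IsChain (· ≠ ·) → g l = 0) (l : List (Equiv.Perm (Fin r))) :
    linearExtension f (chain F l) = g l := by
  by_cases hl : l = []
  · rw [hl, chain_nil, map_zero, hnil]
  by_cases hc : l.IsChain (· ≠ ·)
  · have := chain_toList F (Simplex.ofList l hr hl hc)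
    rw [Simplex.toList_ofList] at this
    rw [this, linearExtension_single, hfg, Simplex.toList_ofList]
  · rw [chain_of_not_isChain F hc, map_zero, hg l hc]

lemma linearExtension_listExtension_chain {M : Type u} [AddCommGroup M] [Module F M]
    {f : Simplex r → M} {g : List (Equiv.Perm (Fin r)) → M} (hr : r ≠ 0)
    (hfg : ∀ w : Simplex r, f w = g w.toList) (hnil : g [] = 0)
    (hg : ∀ l, ¬ l.IsChain (· ≠ ·) → g l = 0) (z : ListChain (Equiv.Perm (Fin r))) :
    linearExtension f (listExtension (chain F) z) = listExtension g z := by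
  have := listChain_ext (f := (linearExtension f).toAddMonoidHom.toIntLinearMap ∘ₗ
    listExtension (chain F)) (g := listExtension g) (fun l => ?_) z
  · exact this
  · rw [LinearMap.comp_apply, listExtension_single, listExtension_single]
    exact linearExtension_chain F hr hfg hnil hg l

lemma beD_eq (w : Simplex r) : beD F w = listExtension (chain F) (listBoundary w.toList) := by
  rw [listBoundary_eq_sum, map_sum]
  refine Finset.sum_congr rfl fun i _ => ?_
  rw [Units.smul_def (_ : ℤˣ) (Finsupp.single _ _ : ListChain _), map_zsmul, listExtension_single]
  rfl

lemma beComp_eq (i : Fin (r + 1)) (w : Simplex (r + 1)) (u : Simplex s) :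
    beComp F i w u = shuffleSum (permComp i) (chain F) w.toList u.toList := rfl

lemma linearExtension_beD (hr : r ≠ 0) (z : ListChain (Equiv.Perm (Fin r))) :
    linearExtension (beD F) (listExtension (chain F) z) = listExtension (chain F) (boundary z) := by
  rw [linearExtension_listExtension_chain F (g := fun l => listExtension (chain F) (listBoundary l))
    hr (beD_eq F) rfl fun l hl => listExtension_listBoundary_eq_zero (fun _ => chain_of_not_isChain F) hl]
  have := listChain_ext (f := listExtension fun l => listExtension (chain F) (listBoundary l))
    (g := listExtension (chain F) ∘ₗ boundary) (fun l => ?_) z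
  · exact this
  · rw [LinearMap.comp_apply, listExtension_single, listExtension_single]

lemma linearExtension_beAct (hr : r ≠ 0) (g : Equiv.Perm (Fin r))
    (z : ListChain (Equiv.Perm (Fin r))) :
    linearExtension (beAct F g) (listExtension (chain F) z) =
      listExtension (chain F) (Finsupp.lmapDomain ℤ ℤ (List.map (g * ·)) z) := by
  rw [listExtension_lmapDomain]
  exact linearExtension_listExtension_chain F (g := fun l => chain F (l.map (g * ·))) hr
    (fun w => rfl) (chain_nil F) (fun l hl => chain_of_not_isChain F (not_isChain_map _ hl)) z

lemma linearExtension_beComp_left (i : Fin (r + 1)) (u : Simplex s)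
    (z : ListChain (Equiv.Perm (Fin (r + 1)))) :
    linearExtension (fun w => beComp F i w u) (listExtension (chain F) z) =
      listExtension (fun l => shuffleSum (permComp i) (chain F) l u.toList) z :=
  linearExtension_listExtension_chain F
    (g := fun l => shuffleSum (permComp i) (chain F) l u.toList) (Nat.succ_ne_zero r) (fun _ => rfl)
    (shuffleSum_nil_left _) (fun _ hl => shuffleSum_eq_zero_left (fun _ => chain_of_not_isChain F) hl _) z

lemma linearExtension_beComp_right (hs : s ≠ 0) (i : Fin (r + 1)) (w : Simplex (r + 1))
    (z : ListChain (Equiv.Perm (Fin s))) :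
    linearExtension (fun u => beComp F i w u) (listExtension (chain F) z) =
      listExtension (fun m => shuffleSum (permComp i) (chain F) w.toList m) z :=
  linearExtension_listExtension_chain F
    (g := fun m => shuffleSum (permComp i) (chain F) w.toList m) hs (fun _ => rfl)
    (shuffleSum_nil_right _) (fun _ hl => shuffleSum_eq_zero_right (fun _ => chain_of_not_isChain F) _ hl) z

lemma shuffleSum_eq_listExtension {α β γ : Type} {M : Type*} [AddCommGroup M] (c : α → β → γ)
    (φ : List γ → M) (l : List α) (m : List β) : shuffleSum c φ l m =
      listExtension φ (Finsupp.lmapDomain ℤ ℤ (List.map fun q => c q.1 q.2) (shuffle l m)) := by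
  rw [listExtension_lmapDomain, shuffleSum]

lemma listExtension_shuffleSum_left {α β γ : Type} {M : Type*} [AddCommGroup M] (c : α → β → γ)
    (φ : List γ → M) (z : ListChain α) (m : List β) :
    listExtension (fun l => shuffleSum c φ l m) z =
      listExtension φ (Finsupp.lmapDomain ℤ ℤ (List.map fun q => c q.1 q.2)
        (shuffleMap z (Finsupp.single m 1))) := by
  have := listChain_ext (f := listExtension fun l => shuffleSum c φ l m)
    (g := listExtension φ ∘ₗ (Finsupp.lmapDomain ℤ ℤ (List.map fun q => c q.1 q.2)) ∘ₗ
      shuffleMap.flip (Finsupp.single m 1)) (fun l => ?_) z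
  · exact this
  · rw [listExtension_single, shuffleSum_eq_listExtension, LinearMap.comp_apply,
      LinearMap.comp_apply, LinearMap.flip_apply, shuffleMap_single]

lemma listExtension_shuffleSum_right {α β γ : Type} {M : Type*} [AddCommGroup M] (c : α → β → γ)
    (φ : List γ → M) (l : List α) (z : ListChain β) :
    listExtension (fun m => shuffleSum c φ l m) z =
      listExtension φ (Finsupp.lmapDomain ℤ ℤ (List.map fun q => c q.1 q.2)
        (shuffleMap (Finsupp.single l 1) z)) := by
  have := listChain_ext (f := listExtension fun m => shuffleSum c φ l m)
    (g := listExtension φ ∘ₗ (Finsupp.lmapDomain ℤ ℤ (List.map fun q => c q.1 q.2)) ∘ₗ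
      shuffleMap (Finsupp.single l 1)) (fun m => ?_) z
  · exact this
  · rw [listExtension_single, shuffleSum_eq_listExtension, LinearMap.comp_apply,
      LinearMap.comp_apply, shuffleMap_single]

lemma simplex_add_ne_zero (u : Simplex s) : r + s ≠ 0 := by
  have := u.arity_ne_zero
  omega

lemma beD_beAct (g : Equiv.Perm (Fin r)) (x : Simplex r) :
    linearExtension (beD F) (beAct F g x) = linearExtension (beAct F g) (beD F x) := by
  have e : beAct F g x = listExtension (chain F) (Finsupp.single (x.toList.map (g * ·)) 1) := by
    rw [listExtension_single]
    rfl
  rw [e, beD_eq, linearExtension_beAct F x.arity_ne_zero, linearExtension_beD F x.arity_ne_zero,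
    ← listExtension_single listBoundary x.toList, ← boundary_mapDomain_map,
    Finsupp.lmapDomain_apply, Finsupp.mapDomain_single]

lemma beD_beComp (i : Fin (r + 1)) (x : Simplex (r + 1)) (y : Simplex s) :
    linearExtension (beD F) (beComp F i x y) = linearExtension (fun x' => beComp F i x' y)
      (beD F x) + x.dim.negOnePow • linearExtension (fun y' => beComp F i x y') (beD F y) := by
  rw [beD_eq, beD_eq, linearExtension_beComp_left, linearExtension_beComp_right F y.arity_ne_zero,
    beComp_eq, shuffleSum_eq_listExtension, linearExtension_beD F (simplex_add_ne_zero y),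
    boundary_mapDomain_map, boundary_shuffle]
  have hdim : x.dim.negOnePow = -(x.toList.length : ℤ).negOnePow := by
    rw [Simplex.dim_eq, ← neg_inj, neg_neg, ← Int.negOnePow_succ, sub_add_cancel]
  rw [listExtension_shuffleSum_left, listExtension_shuffleSum_right, hdim, map_add, map_add, map_sub, map_sub, Units.smul_def, map_zsmul,
    map_zsmul, map_zsmul, map_zsmul, Finsupp.lmapDomain_apply _ _ _ (Finsupp.single [] 1), Finsupp.mapDomain_single,
    listExtension_single, List.map_nil, chain_nil, smul_zero, add_zero, Units.smul_def, Units.val_neg, neg_smul, sub_eq_add_neg]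

lemma beD_beD (x : Simplex r) : linearExtension (beD F) (beD F x) = 0 := by
  rw [beD_eq, linearExtension_beD F x.arity_ne_zero, ← listExtension_single listBoundary x.toList,
    boundary_boundary, map_zero]

/-- The Barratt-Eccles operad satisfies the laws of a differential graded operad that involve the
differential. -/
lemma barrattEccles_hasDifferential : (barrattEccles F).HasDifferential where
  d_one := by
    change beD F (Simplex.ofList [1] one_ne_zero (by simp) (by simp)) = 0
    rw [beD_eq, Simplex.toList_ofList, listBoundary, listBoundary, map_zero, sub_zero,
      listExtension_single, chain_nil]
  d_act g x := beD_beAct F g x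
  d_comp i x y := beD_beComp F i x y
  d_sq x := beD_beD F x

/-! ### The cap products with the cocycles `ε_r` -/

lemma epsilon_of_not_isChain {l : List (Equiv.Perm (Fin r))} (hr : r ≠ 0)
    (h : ¬ l.IsChain (· ≠ ·)) : epsilon l = 0 := by
  rw [epsilon_eq_wordSign ⟨0, Nat.pos_of_ne_zero hr⟩ rfl]
  refine wordSign_of_not_nodup fun h' => ?_
  exact not_isChain_map (fun g : Equiv.Perm (Fin r) => g ⟨0, Nat.pos_of_ne_zero hr⟩) h
    (List.Pairwise.isChain h')

lemma epsilon_nil (hr : r ≠ 0) : epsilon ([] : List (Equiv.Perm (Fin r))) = 0 :=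
  epsilon_of_length_ne fun h => hr h.symm

/-- `ε_r` is a cocycle. -/
lemma epsilon_listBoundary (hr : r ≠ 0) (l : List (Equiv.Perm (Fin r))) :
    listExtension epsilon (listBoundary l) = 0 := by
  by_cases hl : l.length = r + 1
  · have h : (epsilon : List (Equiv.Perm (Fin r)) → ℤ) =
        fun w => wordSign (w.map fun g => g ⟨0, Nat.pos_of_ne_zero hr⟩) :=
      funext fun w => epsilon_eq_wordSign ⟨0, Nat.pos_of_ne_zero hr⟩ rfl w
    rw [h, ← listExtension_lmapDomain, ← listExtension_single listBoundary l,
      ← boundary_mapDomain_map, Finsupp.lmapDomain_apply, Finsupp.mapDomain_single,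
      listExtension_single]
    exact wordSign_listBoundary _ (by simpa using hl)
  · refine listExtension_eq_zero (fun m hm => epsilon_of_length_ne fun h => hl ?_)
      (listBoundary_mem l)
    rw [← hm, h]

/-- The cap product of `ε_r` with the class of a list. -/
def capTerm (p q : List (Equiv.Perm (Fin r))) : Simplex r →₀ F := epsilon p • chain F q

lemma capTerm_of_left (hr : r ≠ 0) (p q : List (Equiv.Perm (Fin r)))
    (h : ¬ p.IsChain (· ≠ ·)) : capTerm F p q = 0 := by
  rw [capTerm, epsilon_of_not_isChain hr h, zero_smul]

lemma capTerm_of_right (p q : List (Equiv.Perm (Fin r))) (h : ¬ q.IsChain (· ≠ ·)) :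
    capTerm F p q = 0 := by
  rw [capTerm, chain_of_not_isChain F h, smul_zero]

lemma cap_eq (w : Simplex r) : cap F w = diagonalSum (capTerm F) w.toList := rfl

lemma linearExtension_cap (hr : r ≠ 0) (z : ListChain (Equiv.Perm (Fin r))) :
    linearExtension (cap F) (listExtension (chain F) z) =
      listExtension (diagonalSum (capTerm F)) z :=
  linearExtension_listExtension_chain F hr (cap_eq F) rfl
    (fun _ hl => diagonalSum_eq_zero (capTerm_of_left F hr) (capTerm_of_right F) hl) z

/-- The cap product commutes with the differentials, up to the sign of the suspension. -/
lemma cap_beD (w : Simplex r) : linearExtension (cap F) (beD F w) =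
    ((r : ℤ) - 1).negOnePow • linearExtension (beD F) (cap F w) := by
  have hr := w.arity_ne_zero
  have hd : ∀ q : List (Equiv.Perm (Fin r)), linearExtension (beD F) (chain F q) =
      listExtension (chain F) (listBoundary q) := fun q => by
    rw [← listExtension_single (chain F) q, linearExtension_beD F hr, listExtension_single]
  rw [beD_eq, linearExtension_cap F hr, diagonalSum_listBoundary, cap_eq, diagonalSum, map_sum,
    Finset.smul_sum, capTerm, capTerm, epsilon_nil hr, chain_nil, zero_smul, smul_zero, smul_zero,
    sub_zero, add_zero]
  refine Finset.sum_congr rfl fun k hk => ?_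
  have h₁ : ∀ z : ListChain (Equiv.Perm (Fin r)),
      listExtension (fun p => capTerm F p (w.toList.drop k)) z =
        listExtension epsilon z • chain F (w.toList.drop k) := fun z =>
    listChain_ext (g := (listExtension epsilon).smulRight (chain F (w.toList.drop k)))
      (fun p => by
        rw [listExtension_single, LinearMap.smulRight_apply, listExtension_single]
        rfl) z
  have h₂ : ∀ (p) (z : ListChain (Equiv.Perm (Fin r))),
      listExtension (capTerm F p) z = epsilon p • listExtension (chain F) z := fun p z =>
    listChain_ext (g := epsilon p • listExtension (chain F))
      (fun q => by
        rw [listExtension_single, LinearMap.smul_apply, listExtension_single]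
        rfl) z
  rw [h₁, epsilon_listBoundary hr, zero_smul, zero_add, h₂, capTerm, map_zsmul, hd]
  -- Only the term with a front face of dimension `r - 1` contributes.
  by_cases hk' : k + 1 = r
  · have : (r : ℤ) - 1 = k := by omega
    rw [this]
  · rw [epsilon_of_length_ne, zero_smul, smul_zero, smul_zero]
    rw [List.length_take]
    have := Finset.mem_range.1 hk
    omega

lemma cap_beAct (g : Equiv.Perm (Fin r)) (w : Simplex r) :
    linearExtension (cap F) (beAct F g w) =
      Equiv.Perm.sign g • linearExtension (beAct F g) (cap F w) := by
  have hr := w.arity_ne_zero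
  have e : beAct F g w = listExtension (chain F) (Finsupp.single (w.toList.map (g * ·)) 1) := by
    rw [listExtension_single]
    rfl
  have ha : ∀ q : List (Equiv.Perm (Fin r)), linearExtension (beAct F g) (chain F q) =
      chain F (q.map (g * ·)) := fun q => by
    rw [← listExtension_single (chain F) q, linearExtension_beAct F hr, listExtension_lmapDomain,
      listExtension_single]
  rw [e, linearExtension_cap F hr, listExtension_single, cap_eq, diagonalSum, diagonalSum, map_sum,
    Finset.smul_sum, List.length_map]
  refine Finset.sum_congr rfl fun k _ => ?_
  rw [capTerm, capTerm, ← List.map_take, ← List.map_drop, epsilon_map_mul, map_zsmul, ha,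
    Units.smul_def, smul_smul]

/-- The composition products of the suspension of the Barratt-Eccles operad. -/
lemma linearExtension_suspension_comp (hs : s ≠ 0) (i : Fin (r + 1))
    (l : List (Equiv.Perm (Fin (r + 1)))) (m : List (Equiv.Perm (Fin s))) :
    linearExtension (fun x => linearExtension (fun y =>
      (((s : ℤ) - 1) * (x.dim + r - i.val)).negOnePow • beComp F i x y) (chain F m)) (chain F l) =
      (((s : ℤ) - 1) * ((l.length : ℤ) - 1 + r - i.val)).negOnePow •
        shuffleSum (permComp i) (chain F) l m := by
  refine linearExtension_chain F (g := fun l =>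
    (((s : ℤ) - 1) * ((l.length : ℤ) - 1 + r - i.val)).negOnePow •
        shuffleSum (permComp i) (chain F) l m) (Nat.succ_ne_zero r) (fun x => ?_) ?_ ?_ l
  · refine linearExtension_chain F (g := fun m =>
      (((s : ℤ) - 1) * ((x.toList.length : ℤ) - 1 + r - i.val)).negOnePow •
        shuffleSum (permComp i) (chain F) x.toList m) hs (fun y => rfl) ?_ ?_ m
    · rw [shuffleSum_nil_right, smul_zero]
    · intro m hm
      rw [shuffleSum_eq_zero_right (fun _ => chain_of_not_isChain F) _ hm, smul_zero]
  · rw [shuffleSum_nil_left, smul_zero]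
  · intro l hl
    rw [shuffleSum_eq_zero_left (fun _ => chain_of_not_isChain F) hl, smul_zero]

lemma diagonalSum_map {α β : Type} {M : Type*} [AddCommGroup M] (B : List β → List β → M)
    (f : α → β) : (fun p : List α => diagonalSum B (p.map f)) =
      diagonalSum fun p p' => B (p.map f) (p'.map f) := by
  funext p
  rw [diagonalSum, diagonalSum, List.length_map]
  simp only [List.map_take, List.map_drop]

lemma listExtension₂_capTerm {α : Type} (f : α → Equiv.Perm (Fin r)) (z w : ListChain α) :
    listExtension₂ (fun p p' => capTerm F (p.map f) (p'.map f)) z w =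
      listExtension (fun p => epsilon (p.map f)) z •
        listExtension (fun p => chain F (p.map f)) w := by
  have h := listChain_ext
    (f := (listExtension₂ fun p p' => capTerm F (p.map f) (p'.map f)).flip w)
    (g := (listExtension (fun p => epsilon (p.map f))).smulRight
      (listExtension (fun p => chain F (p.map f)) w)) (fun p => ?_) z
  · exact h
  rw [LinearMap.flip_apply, LinearMap.smulRight_apply, listExtension_single,
    listExtension_single]
  have h' := listChain_ext (f := listExtension fun p' => capTerm F (p.map f) (p'.map f))
    (g := epsilon (p.map f) • listExtension (fun p => chain F (p.map f))) (fun p' => ?_) w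
  · exact h'
  rw [LinearMap.smul_apply, listExtension_single, listExtension_single]
  rfl

lemma cap_beComp (i : Fin (r + 1)) (x : Simplex (r + 1)) (y : Simplex s) :
    linearExtension (cap F) (beComp F i x y) =
      linearExtension (fun x' => linearExtension (fun y' =>
        (((s : ℤ) - 1) * (x'.dim + r - i.val)).negOnePow • beComp F i x' y') (cap F y))
          (cap F x) := by
  have hs := y.arity_ne_zero
  let C : (Simplex (r + 1) →₀ F) →ₗ[F] (Simplex s →₀ F) →ₗ[F] (Simplex (r + s) →₀ F) :=
    Finsupp.linearCombination F fun x' => Finsupp.linearCombination F fun y' =>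
        (((s : ℤ) - 1) * (x'.dim + r - i.val)).negOnePow • beComp F i x' y'
  have hC : ∀ (ρ : Simplex (r + 1) →₀ F) (σ : Simplex s →₀ F),
      linearExtension (fun x' => linearExtension (fun y' =>
        (((s : ℤ) - 1) * (x'.dim + r - i.val)).negOnePow • beComp F i x' y') σ) ρ = C ρ σ := by
    intro ρ σ
    have : linearExtension (fun x' => linearExtension (fun y' =>
        (((s : ℤ) - 1) * (x'.dim + r - i.val)).negOnePow • beComp F i x' y') σ) = C.flip σ := by
      refine Finsupp.lhom_ext' fun x' => LinearMap.ext_ring ?_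
      simp only [LinearMap.comp_apply, Finsupp.lsingle_apply, linearExtension_single,
        LinearMap.flip_apply, C]
      rw [Finsupp.linearCombination_single, one_smul]
    rw [this, LinearMap.flip_apply]
  rw [hC, cap_eq, cap_eq, diagonalSum, diagonalSum, map_sum C, LinearMap.sum_apply,
    beComp_eq, shuffleSum_eq_listExtension, linearExtension_cap F (simplex_add_ne_zero y),
    listExtension_lmapDomain]
  have hB := diagonalSum_map (capTerm F)
    fun q : Equiv.Perm (Fin (r + 1)) × Equiv.Perm (Fin s) => permComp i q.1 q.2
  have hB' := listExtension₂_capTerm F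
    fun q : Equiv.Perm (Fin (r + 1)) × Equiv.Perm (Fin s) => permComp i q.1 q.2
  rw [hB, diagonalSum_shuffle]
  refine Finset.sum_congr rfl fun a ha => ?_
  rw [map_sum]
  refine Finset.sum_congr rfl fun b hb => ?_
  have hlen : ((x.toList.drop a).length : ℤ) = x.toList.length - a := by
    rw [List.length_drop]
    have := Finset.mem_range.1 ha
    omega
  rw [hB', epsilon_shuffle hs, capTerm, capTerm, map_zsmul, map_zsmul, LinearMap.smul_apply, ← hC,
    linearExtension_suspension_comp F hs, hlen]
  by_cases hb' : b + 1 = s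
  · subst hb'
    have hsign : (((b + 1 : ℕ) : ℤ) - 1) * ((x.toList.length : ℤ) - a - 1 + r - i.val) =
        ((x.toList.length : ℤ) - 1 - a) * b + (((b + 1 : ℕ) : ℤ) - 1) * (r - i.val) := by
      push_cast
      ring
    rw [hsign, Int.negOnePow_add]
    simp only [Units.smul_def, smul_smul, smul_eq_mul, Units.val_mul, shuffleSum]
    congr 1
    ring
  · have : epsilon (y.toList.take (b + 1)) = 0 := by
      refine epsilon_of_length_ne ?_
      rw [List.length_take]
      have := Finset.mem_range.1 hb
      omega
    rw [this, mul_zero, smul_zero, zero_smul, zero_smul, smul_zero]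

lemma cap_one : cap F (barrattEccles F).one = Finsupp.single (barrattEccles F).one 1 := by
  change cap F (Simplex.ofList [1] one_ne_zero (by simp) (by simp)) =
    Finsupp.single (Simplex.ofList [1] one_ne_zero (by simp) (by simp)) 1
  rw [← chain_toList, cap_eq, Simplex.toList_ofList, diagonalSum]
  have : epsilon [(1 : Equiv.Perm (Fin 1))] = 1 := by
    rw [epsilon_eq_wordSign 0 rfl, wordSign_eq (by simp) (by simp)]
    simp [wordInv]
  simp [capTerm, this]

lemma cap_mem (w : Simplex r) : cap F w ∈
    Finsupp.supported F F {y : Simplex r | y.dim + ((r : ℤ) - 1) = w.dim} := by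
  refine Submodule.sum_mem _ fun k hk => ?_
  by_cases hk' : k + 1 = r
  · refine zsmul_mem (Finsupp.supported_mono ?_ (chain_mem F _)) _
    intro y hy
    have := Finset.mem_range.1 hk
    simp only [Set.mem_ofPred_eq, Simplex.dim, List.length_drop] at hy ⊢
    omega
  · rw [epsilon_of_length_ne, zero_smul]
    · exact zero_mem _
    · rw [List.length_take]
      have := Finset.mem_range.1 hk
      omega

end BarrattEccles

/-! ### Morphisms of operads and restriction of structure -/

section Restriction

variable {F : Type u} [Field F] {P Q : OperadData F} {A B : Type u} [AddCommGroup A] [Module F A]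
  [AddCommGroup B] [Module F B]

lemma linearExtension_comm {ι κ : Type} {M : Type u} [AddCommGroup M] [Module F M]
    (f : ι → κ → M) (ρ : ι →₀ F) (σ : κ →₀ F) :
    linearExtension (fun x => linearExtension (f x) σ) ρ =
      linearExtension (fun y => linearExtension (fun x => f x y) ρ) σ := by
  simp only [Finsupp.linearCombination_apply, Finsupp.sum, Finset.smul_sum]
  rw [Finset.sum_comm]
  exact Finset.sum_congr rfl fun y _ => Finset.sum_congr rfl fun x _ => smul_comm _ _ _

lemma linearExtension_sign_smul {ι : Type} {M : Type u} [AddCommGroup M] [Module F M] {f : ι → M}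
    {e : ι → ℤˣ} {e' : ℤˣ} {s : Set ι} (h : ∀ x ∈ s, e x = e') {ρ : ι →₀ F}
    (hρ : ρ ∈ Finsupp.supported F F s) :
    linearExtension (fun x => e x • f x) ρ = e' • linearExtension f ρ := by
  have := eq_of_mem_supported (f := linearExtension fun x => e x • f x)
    (g := (e' : ℤ) • linearExtension f) (fun x hx => ?_) hρ
  · exact this
  · rw [LinearMap.smul_apply, linearExtension_single, linearExtension_single, h x hx,
      Units.smul_def]

lemma linearExtension_sign_smul_const {ι : Type} {M : Type u} [AddCommGroup M] [Module F M]
    {f : ι → M} (e : ℤˣ) (ρ : ι →₀ F) :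
    linearExtension (fun x => e • f x) ρ = e • linearExtension f ρ :=
  linearExtension_sign_smul (s := Set.univ) (fun _ _ => rfl) (by simp)

/-- A morphism of differential graded operads, given on the basis elements. -/
structure IsOperadHom (P Q : OperadData F) (φ : ∀ {r : ℕ}, P.ι r → Q.obj r) : Prop where
  mem : ∀ {r : ℕ} (x : P.ι r), φ x ∈ Finsupp.supported F F {y | Q.deg y = P.deg x}
  one : φ P.one = Finsupp.single Q.one 1
  act : ∀ {r : ℕ} (g : Equiv.Perm (Fin r)) (x : P.ι r),
    linearExtension φ (P.act g x) = linearExtension (Q.act g) (φ x)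
  comp : ∀ {r s : ℕ} (i : Fin (r + 1)) (x : P.ι (r + 1)) (y : P.ι s),
    linearExtension φ (P.comp i x y) =
      linearExtension (fun y' => linearExtension (fun x' => Q.comp i x' y') (φ x)) (φ y)
  d : ∀ {r : ℕ} (x : P.ι r), linearExtension φ (P.d x) = linearExtension Q.d (φ x)

/-- The restriction of structure along a morphism of operads. -/
def GradedOps.restrict (φ : ∀ {r : ℕ}, P.ι r → Q.obj r) (X : GradedOps Q A) : GradedOps P A where
  gr := X.gr
  internal := X.internal
  op x := X.eval (φ x)

variable {φ : ∀ {r : ℕ}, P.ι r → Q.obj r}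

lemma GradedOps.restrict_eval (X : GradedOps Q A) {r : ℕ} (ρ : P.obj r) (a : Fin r → A) :
    (X.restrict φ).eval ρ a = X.eval (linearExtension φ ρ) a := by
  have : (X.restrict φ).evalAt a = X.evalAt a ∘ₗ linearExtension φ := by
    refine Finsupp.lhom_ext' fun x => LinearMap.ext_ring ?_
    simp only [LinearMap.comp_apply, Finsupp.lsingle_apply, linearExtension_single,
      GradedOps.evalAt_single]
    rfl
  exact LinearMap.congr_fun this ρ

lemma GradedOps.IsAlgebra.restrict (hφ : IsOperadHom P Q φ) {X : GradedOps Q A}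
    (hX : X.IsAlgebra) : (X.restrict φ).IsAlgebra where
  op_mem x _ _ ha := hX.eval_mem (hφ.mem x) ha
  op_one a := by
    change X.eval (φ P.one) _ = a
    rw [hφ.one, X.eval_single_one, hX.op_one]
  op_act g x a n ha := by
    rw [X.restrict_eval, hφ.act, hX.eval_act g _ ha]
    rfl
  op_comp i x y a n ha := by
    rw [X.restrict_eval, hφ.comp, hX.eval_comp i _ (hφ.mem y) ha]
    rfl

lemma GradedOps.restrict_leibnizSum (hφ : IsOperadHom P Q φ) (X : GradedOps Q A) {r : ℕ}
    (x : P.ι r) (e : ℤ) (n : Fin r → ℤ) (a b : Fin r → A) :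
    (X.restrict φ).leibnizSum (Finsupp.single x 1) e n a b = X.leibnizSum (φ x) e n a b := by
  rw [GradedOps.leibnizSum, GradedOps.leibnizSum, X.restrict_eval, linearExtension_single, hφ.d]
  simp only [X.restrict_eval, linearExtension_single]

lemma GradedOps.IsDerivation.restrict (hφ : IsOperadHom P Q φ) {X : GradedOps Q A} {d : A →ₗ[F] A}
    (hd : X.IsDerivation d) : (X.restrict φ).IsDerivation d where
  mem := hd.mem
  leibniz x _ _ ha := by
    rw [X.restrict_leibnizSum hφ]
    exact hd.eval (hφ.mem x) ha

/-- A linear map that commutes with the operations commutes with the operations of arbitrary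
elements of the operad. -/
lemma GradedOps.map_eval {X : GradedOps P A} {Y : GradedOps P B} {f : A →ₗ[F] B}
    (hf : ∀ {r : ℕ} (x : P.ι r) (a : Fin r → A), f (X.op x a) = Y.op x fun i => f (a i))
    {r : ℕ} (ρ : P.obj r) (a : Fin r → A) : f (X.eval ρ a) = Y.eval ρ fun i => f (a i) := by
  have : f ∘ₗ X.evalAt a = Y.evalAt fun i => f (a i) := by
    refine Finsupp.lhom_ext' fun x => LinearMap.ext_ring ?_
    simp only [LinearMap.comp_apply, Finsupp.lsingle_apply, GradedOps.evalAt_single, hf]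
  exact LinearMap.congr_fun this ρ

lemma GradedOps.map_leibnizSum {X : GradedOps P A} {Y : GradedOps P B} {f : A →ₗ[F] B}
    (hf : ∀ {r : ℕ} (x : P.ι r) (a : Fin r → A), f (X.op x a) = Y.op x fun i => f (a i))
    {r : ℕ} (ρ : P.obj r) (e : ℤ) (n : Fin r → ℤ) (a b : Fin r → A) :
    f (X.leibnizSum ρ e n a b) = Y.leibnizSum ρ e n (fun i => f (a i)) fun i => f (b i) := by
  rw [GradedOps.leibnizSum, GradedOps.leibnizSum, map_add, GradedOps.map_eval hf, map_sum]
  congr 1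
  refine Finset.sum_congr rfl fun i _ => ?_
  rw [map_sign_smul, GradedOps.map_eval hf]
  congr 2
  funext j
  exact Function.apply_update (fun _ => f) a i (b i) j

/-- A morphism out of a free algebra commutes with derivations as soon as it does so on the
generators. -/
lemma Free.map_derivation {V : CochainComplex (ModuleCat.{u} F) ℤ} {Y : GradedOps P B}
    {f : Free P V →ₗ[F] B} {d : Free P V →ₗ[F] Free P V} {d' : B →ₗ[F] B}
    (hmem : ∀ (n : ℤ) (a : Free P V), a ∈ (freeAlgebra P V).gr n → f a ∈ Y.gr n)
    (hf : ∀ {r : ℕ} (x : P.ι r) (a : Fin r → Free P V),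
      f ((freeAlgebra P V).op x a) = Y.op x fun i => f (a i))
    (hd : (freeAlgebra P V).IsDerivation d) (hd' : Y.IsDerivation d')
    (hvar : ∀ (n : ℤ) (v : V.X n), f (d (Free.var P V n v)) = d' (f (Free.var P V n v)))
    (a : Free P V) : f (d a) = d' (f a) := by
  refine LinearMap.congr_fun (f := f ∘ₗ d) (g := d' ∘ₗ f) ?_ a
  refine Free.linear_ext hvar fun x a n ha e => ?_
  simp only [LinearMap.comp_apply] at e ⊢
  rw [hd.leibniz x a n ha, GradedOps.map_leibnizSum hf, hf, hd'.leibniz x _ n fun i =>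
    hmem _ _ (ha i)]
  simp only [e]

end Restriction

/-! ### The differential of a suspended operad -/

section SuspensionDifferential

variable {F : Type u} [Field F] {P : OperadData F}

lemma OperadData.HasDifferential.suspension_act (hP : P.HasDifferential) {r : ℕ} (e : ℤˣ)
    (g : Equiv.Perm (Fin r)) (x : P.ι r) :
    linearExtension (fun z : P.ι r => e • P.d z) (Equiv.Perm.sign g • P.act g x) =
      linearExtension (fun z : P.ι r => Equiv.Perm.sign g • P.act g z) (e • P.d x) := by
  rw [linearExtension_sign_smul_const, linearExtension_sign_smul_const, map_sign_smul,
    map_sign_smul, hP.d_act, smul_comm]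

lemma OperadData.HasDifferential.suspension_comp (hP : P.HasDifferential) {r s : ℕ}
    (i : Fin (r + 1)) (x : P.ι (r + 1)) (y : P.ι s) :
    linearExtension (fun z : P.ι (r + s) => (((r + s : ℕ) : ℤ) - 1).negOnePow • P.d z)
        ((((s : ℤ) - 1) * (P.deg x + r - i.val)).negOnePow • P.comp i x y) =
      linearExtension (fun x' : P.ι (r + 1) =>
          (((s : ℤ) - 1) * (P.deg x' + r - i.val)).negOnePow • P.comp i x' y)
        ((((r + 1 : ℕ) : ℤ) - 1).negOnePow • P.d x) +
      (P.deg x + (((r + 1 : ℕ) : ℤ) - 1)).negOnePow • linearExtension (fun y' : P.ι s =>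
          (((s : ℤ) - 1) * (P.deg x + r - i.val)).negOnePow • P.comp i x y')
        (((s : ℤ) - 1).negOnePow • P.d y) := by
  have two : (2 : ZMod 2) = 0 := rfl
  rw [linearExtension_sign_smul_const, linearExtension_sign_smul_const, map_sign_smul,
    map_sign_smul, map_sign_smul, hP.d_comp, linearExtension_sign_smul
      (e' := (((s : ℤ) - 1) * (P.deg x - 1 + r - i.val)).negOnePow) (fun x' hx' => by
        rw [show P.deg x' = P.deg x - 1 from hx']) (P.deg_d x)]
  simp only [smul_add, smul_smul, ← Int.negOnePow_add]
  congr 2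
  · refine negOnePow_congr ?_
    push_cast
    linear_combination ((s : ZMod 2) - 1) * two
  · refine negOnePow_congr ?_
    push_cast
    ring

lemma OperadData.HasDifferential.suspension_sq (hP : P.HasDifferential) {r : ℕ} (e : ℤˣ)
    (x : P.ι r) : linearExtension (fun z : P.ι r => e • P.d z) (e • P.d x) = 0 := by
  rw [linearExtension_sign_smul_const, map_sign_smul, hP.d_sq, smul_zero, smul_zero]

lemma OperadData.HasDifferential.suspension_one (hP : P.HasDifferential) (e : ℤˣ) :
    e • P.d P.one = 0 := by
  rw [hP.d_one, smul_zero]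

/-- The laws of a differential graded operad are preserved by the operadic suspension. -/
lemma OperadData.HasDifferential.suspension (hP : P.HasDifferential) :
    P.suspension.HasDifferential where
  d_one := hP.suspension_one _
  d_act g x := hP.suspension_act _ g x
  d_comp i x y := hP.suspension_comp i x y
  d_sq x := hP.suspension_sq _ x

end SuspensionDifferential

/-! ### The morphism from the Barratt-Eccles operad to its suspension -/

section CapMorphism

variable (F : Type u) [Field F] {A : Type u} [AddCommGroup A] [Module F A]

lemma cap_act {r : ℕ} (g : Equiv.Perm (Fin r)) (w : Simplex r) :
    linearExtension (cap F) (beAct F g w) =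
      linearExtension (fun z => Equiv.Perm.sign g • beAct F g z) (cap F w) := by
  rw [cap_beAct, linearExtension_sign_smul_const]

lemma cap_d {r : ℕ} (w : Simplex r) : linearExtension (cap F) (beD F w) =
    linearExtension (fun z => ((r : ℤ) - 1).negOnePow • beD F z) (cap F w) := by
  rw [cap_beD, linearExtension_sign_smul_const]

lemma cap_comp {r s : ℕ} (i : Fin (r + 1)) (x : Simplex (r + 1)) (y : Simplex s) :
    linearExtension (cap F) (beComp F i x y) =
      linearExtension (fun y' => linearExtension (fun x' =>
        (((s : ℤ) - 1) * (x'.dim + r - i.val)).negOnePow • beComp F i x' y') (cap F x))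
          (cap F y) := by
  rw [cap_beComp, linearExtension_comm]

/-- The cap products with the cocycles `ε_r` form a morphism of operads `E → Λ^*E`. -/
lemma cap_isOperadHom :
    IsOperadHom (barrattEccles F) (barrattEccles F).suspension (cap F) where
  mem w := cap_mem F w
  one := cap_one F
  act g w := cap_act F g w
  comp i x y := cap_comp F i x y
  d w := cap_d F w

lemma sign_smul_zsmul_sign_smul {s₁ s₂ s₃ : ℤˣ} (h : s₁ * s₂ = s₃) (c : ℤ) (a : A) :
    s₁ • c • s₂ • a = c • s₃ • a := by
  rw [← h, mul_smul, smul_comm]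

lemma suspensionAlgebra_op (X : GradedOps (barrattEccles F) A) {r : ℕ} (w : Simplex r)
    {a : Fin r → A} {n : Fin r → ℤ} (ha : ∀ i, a i ∈ X.gr (n i - 1)) :
    X.suspensionAlgebra.op (r := r) w a = ∑ k ∈ range w.toList.length,
      ((k : ℤ) * (w.dim - k)).negOnePow • epsilon (w.toList.take (k + 1)) •
        (∑ j : Fin r, ((k + j.val : ℕ) : ℤ) * n j).negOnePow •
          X.eval (r := r) (chain F (w.toList.drop k)) a := by
  change (∑ k ∈ range w.toList.length, ((k : ℤ) * (w.dim - k)).negOnePow •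
    epsilon (w.toList.take (k + 1)) •
      (X.eval (r := r) (chain F (w.toList.drop k))).compLinearMap fun j =>
        parity (fun n => X.gr (n - 1)) (internal_shift X.gr X.internal) ^ (k + j.val)) a = _
  rw [_root_.sum_apply]
  refine Finset.sum_congr rfl fun k _ => ?_
  rw [multilinear_sign_smul_apply, multilinear_zsmul_apply, MultilinearMap.compLinearMap_apply]
  simp only [parity_pow_apply (gr := fun n => X.gr (n - 1)) (internal_shift X.gr X.internal) (ha _)]
  rw [multilinear_map_sign_smul]

lemma suspension_eval_cap (X : GradedOps (barrattEccles F) A) {r : ℕ} (w : Simplex r)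
    {a : Fin r → A} {n : Fin r → ℤ} (ha : ∀ i, a i ∈ X.gr (n i - 1)) :
    X.suspension.eval (r := r) (cap F w) a = ∑ k ∈ range w.toList.length,
      epsilon (w.toList.take (k + 1)) • (suspExponent r (w.dim - k) n).negOnePow •
          X.eval (r := r) (chain F (w.toList.drop k)) a := by
  have h : X.suspension.eval (r := r) (cap F w) a = ∑ k ∈ range w.toList.length,
      epsilon (w.toList.take (k + 1)) •
        X.suspension.eval (r := r) (chain F (w.toList.drop k)) a := by
    let f : (Simplex r →₀ F) →ₗ[F] A := X.suspension.evalAt (r := r) a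
    change f (∑ k ∈ range w.toList.length,
      epsilon (w.toList.take (k + 1)) • chain F (w.toList.drop k)) = _
    rw [map_sum]
    refine Finset.sum_congr rfl fun k _ => ?_
    rw [map_zsmul]
    rfl
  rw [h]
  refine Finset.sum_congr rfl fun k hk => ?_
  congr 1
  refine X.suspension_eval (r := r) ?_ ha
  refine Finsupp.supported_mono ?_ (chain_mem F _)
  intro y hy
  have := Finset.mem_range.1 hk
  change (y.toList.length : ℤ) - 1 = (w.toList.length : ℤ) - 1 - k
  have hy' : y.toList.length = (w.toList.drop k).length := hy
  rw [List.length_drop] at hy'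
  omega

/-- The `E`-algebra structure of a suspension `Σ^*A` is the restriction of its `Λ^*E`-algebra
structure. -/
lemma suspensionAlgebra_eq (X : GradedOps (barrattEccles F) A) :
    X.suspensionAlgebra = X.suspension.restrict (cap F) := by
  refine GradedOps.ext_gr_op rfl fun {r} w => ?_
  refine multilinear_ext_homogeneous X.suspensionAlgebra.internal fun a n ha => ?_
  refine (suspensionAlgebra_op F X w ha).trans (Eq.trans ?_ (suspension_eval_cap F X w ha).symm)
  refine Finset.sum_congr rfl fun k hk => ?_
  by_cases hk' : k + 1 = r
  · refine sign_smul_zsmul_sign_smul ?_ _ _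
    rw [← Int.negOnePow_add]
    refine negOnePow_congr ?_
    have two : (2 : ZMod 2) = 0 := rfl
    have hr : (r : ZMod 2) = k + 1 := by rw [← hk']; push_cast; rfl
    rw [suspExponent]
    push_cast
    have h : ∑ j : Fin r, ((k : ZMod 2) + j.val) * n j =
        ∑ j : Fin r, ((r : ZMod 2) - 1 - j.val) * n j := by
      refine Finset.sum_congr rfl fun j _ => ?_
      rw [hr]
      linear_combination (j.val * n j : ZMod 2) * two
    rw [h, hr]
    ring
  · have : epsilon (Simplex.toList w |>.take (k + 1)) = 0 := by
      refine epsilon_of_length_ne ?_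
      rw [List.length_take]
      have := Finset.mem_range.1 hk
      omega
    rw [this, zero_smul, zero_smul, smul_zero]

end CapMorphism

/-! ### The universal property of the free algebra over the suspended operad -/

section UniversalProperty

variable {F : Type u} [Field F] (V : CochainComplex (ModuleCat.{u} F) ℤ)

/-- The free `Λ^*E`-algebra on `V`, as an algebra over the Barratt-Eccles operad. -/
abbrev capAlgebra : GradedOps (barrattEccles F) (Free (barrattEccles F).suspension V) :=
  (freeAlgebra (barrattEccles F).suspension V).restrict (cap F)

lemma capAlgebra_isAlgebra : (capAlgebra V).IsAlgebra :=
  freeAlgebra_isAlgebra.restrict (cap_isOperadHom F)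

/-- The morphism of `E`-algebras `κ : E(V) → Λ^*E(V)` that extends the identity of `V`. -/
def capMap : Free (barrattEccles F) V →ₗ[F] Free (barrattEccles F).suspension V :=
  Free.lift (capAlgebra_isAlgebra V) (Free.var (barrattEccles F).suspension V)
    fun n v => Free.var_mem n v

lemma capMap_var (n : ℤ) (v : V.X n) :
    capMap V (Free.var _ V n v) = Free.var (barrattEccles F).suspension V n v :=
  Free.lift_var _ _ _ n v

lemma capMap_op {r : ℕ} (w : (barrattEccles F).ι r) (a : Fin r → Free (barrattEccles F) V) :
    capMap V ((freeAlgebra (barrattEccles F) V).op w a) =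
      (capAlgebra V).op w fun i => capMap V (a i) :=
  Free.lift_op _ _ _ w a

lemma capMap_mem (n : ℤ) (a : Free (barrattEccles F) V)
    (ha : a ∈ (freeAlgebra (barrattEccles F) V).gr n) :
    capMap V a ∈ (freeAlgebra (barrattEccles F).suspension V).gr n :=
  Free.lift_mem (capAlgebra_isAlgebra V) _ _ n a ha

lemma capMap_isCapMap : IsCapMap V (capMap V) := by
  intro r w n v
  refine (capMap_op V w _).trans ?_
  simp only [capMap_var]
  rfl

lemma IsCapMap.eq_capMap {V : CochainComplex (ModuleCat.{u} F) ℤ}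
    {κ : Free (barrattEccles F) V →ₗ[F] Free (barrattEccles F).suspension V} (hκ : IsCapMap V κ) :
    κ = capMap V :=
  Free.linear_ext_op_var fun {r} w n v => (hκ r w n v).trans (capMap_isCapMap V r w n v).symm

variable {V} {h : ∀ n : ℤ, V.X n →ₗ[F] Free (barrattEccles F) V}
    {δ : Free (barrattEccles F) V →ₗ[F] Free (barrattEccles F) V}

/-- The values on the generators of the differential of `Λ^*E(V)`. -/
def capTwist (h : ∀ n : ℤ, V.X n →ₗ[F] Free (barrattEccles F) V) (n : ℤ) :
    V.X n →ₗ[F] Free (barrattEccles F).suspension V :=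
  Free.var _ V (n + 1) ∘ₗ (V.d n (n + 1)).hom + capMap V ∘ₗ h n

lemma capTwist_mem (hδ : IsAlmostFreeDifferential h δ) (n : ℤ) (v : V.X n) :
    capTwist h n v ∈ (freeAlgebra (barrattEccles F).suspension V).gr (n + 1) :=
  add_mem (Free.var_mem _ _) (capMap_mem V _ _ (hδ.mem n v))

/-- The differential of `Λ^*E(V)` determined by `κ ∘ h`. -/
def capDifferential (hδ : IsAlmostFreeDifferential h δ) :
    Free (barrattEccles F).suspension V →ₗ[F] Free (barrattEccles F).suspension V :=
  Free.der (barrattEccles_hasDifferential F).suspension (capTwist h) (capTwist_mem hδ)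

variable (hδ : IsAlmostFreeDifferential h δ)

lemma capDifferential_var (n : ℤ) (v : V.X n) :
    capDifferential hδ (Free.var _ V n v) =
      Free.var _ V (n + 1) (V.d n (n + 1) v) + capMap V (h n v) :=
  Free.der_var _ _ _ n v

lemma capDifferential_isDerivation :
    (freeAlgebra (barrattEccles F).suspension V).IsDerivation (capDifferential hδ) :=
  Free.der_isDerivation _ _ _

/-- The map `κ` commutes with the differentials. -/
lemma capMap_differential (a : Free (barrattEccles F) V) :
    capMap V (δ a) = capDifferential hδ (capMap V a) := by
  refine Free.map_derivation (Y := capAlgebra V) (capMap_mem V) (capMap_op V)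
    hδ.isDifferential.isDerivation
    ((capDifferential_isDerivation hδ).restrict (cap_isOperadHom F)) (fun n v => ?_) a
  rw [hδ.var, map_add, capMap_var, capMap_var, capDifferential_var]

lemma capDifferential_sq (a : Free (barrattEccles F).suspension V) :
    capDifferential hδ (capDifferential hδ a) = 0 := by
  refine LinearMap.congr_fun (f := capDifferential hδ ∘ₗ capDifferential hδ) (g := 0) ?_ a
  refine Free.linear_ext (fun n v => ?_) fun x a n ha e => ?_
  · rw [LinearMap.comp_apply, ← capMap_var, ← capMap_differential, ← capMap_differential,
      hδ.isDifferential.sq, map_zero]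
    rfl
  · exact (capDifferential_isDerivation hδ).sq_op (barrattEccles_hasDifferential F).suspension
      x ha e

lemma capDifferential_isAlmostFree :
    IsAlmostFreeDifferential (fun n => capMap V ∘ₗ h n) (capDifferential hδ) where
  mem n v := capMap_mem V _ _ (hδ.mem n v)
  isDifferential := (capDifferential_isDerivation hδ).isDifferential (capDifferential_sq hδ)
  var := capDifferential_var hδ

lemma capDifferential_isDGAlgebra :
    (freeAlgebra (barrattEccles F).suspension V).IsDGAlgebra (capDifferential hδ) :=
  ⟨freeAlgebra_isAlgebra, (capDifferential_isAlmostFree hδ).isDifferential⟩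

variable (V) in
/-- The underlying graded algebra of the loop algebra of `E(V)`: the desuspension of the free
`Λ^*E`-algebra. -/
abbrev loopFree : GradedOps (barrattEccles F) (Free (barrattEccles F).suspension V) :=
  (freeAlgebra (barrattEccles F).suspension V).desuspension

variable (V) in
lemma loopFree_suspension :
    (loopFree V).suspension = freeAlgebra (barrattEccles F).suspension V :=
  GradedOps.suspension_desuspension _

/-- The desuspension of `(Λ^*E(V), δ')`, together with `κ`, is a loop algebra of `(E(V), δ)`. -/
lemma loopFree_isLoopAlgebra : IsLoopAlgebra (freeAlgebra (barrattEccles F) V) δ (loopFree V)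
    (capDifferential hδ) (capMap V) where
  isDGAlgebra := .of_suspension (by
    rw [loopFree_suspension]
    exact capDifferential_isDGAlgebra hδ)
  isDGHom := by
    rw [suspensionAlgebra_eq, loopFree_suspension]
    exact ⟨capMap_mem V, capMap_op V, capMap_differential hδ⟩
  exists_unique := by
    intro C _ _ Z dZ hZ f hf
    rw [suspensionAlgebra_eq] at hf
    have hmem : ∀ (n : ℤ) (v : V.X n), (f ∘ₗ Free.var _ V n) v ∈ Z.suspension.gr n :=
      fun n v => hf.mem n _ (Free.var_mem n v)
    let g := Free.lift hZ.suspension.1 (fun n => f ∘ₗ Free.var _ V n) hmem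
    have hg_op : ∀ {r : ℕ} (x : (barrattEccles F).suspension.ι r)
        (a : Fin r → Free (barrattEccles F).suspension V),
        g ((freeAlgebra (barrattEccles F).suspension V).op x a) =
          Z.suspension.op x fun i => g (a i) := fun x a => Free.lift_op _ _ _ x a
    have hg_var : ∀ (n : ℤ) (v : V.X n), g (Free.var _ V n v) = f (Free.var _ V n v) :=
      fun n v => Free.lift_var _ _ _ n v
    have hg : ∀ a, g (capMap V a) = f a := by
      refine LinearMap.congr_fun (f := g ∘ₗ capMap V) ?_
      refine Free.linear_ext (fun n v => ?_) fun {r} w a n ha e => ?_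
      · rw [LinearMap.comp_apply, capMap_var, hg_var]
      · simp only [LinearMap.comp_apply] at e ⊢
        rw [capMap_op, hf.op]
        simp only [← e]
        exact GradedOps.map_eval hg_op _ _
    refine ⟨g, ⟨?_, LinearMap.ext hg⟩, ?_⟩
    · rw [← isDGHom_suspension_iff, loopFree_suspension]
      refine ⟨fun n a ha => Free.lift_mem hZ.suspension.1 _ _ n a ha, hg_op, ?_⟩
      refine Free.map_derivation (fun n a ha => Free.lift_mem hZ.suspension.1 _ _ n a ha) hg_op
        (capDifferential_isDerivation hδ) hZ.suspension.2.isDerivation fun n v => ?_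
      rw [hg_var, ← hf.d, ← capMap_var, ← capMap_differential, hg]
    · rintro g' ⟨hg', hg'f⟩
      rw [← isDGHom_suspension_iff, loopFree_suspension] at hg'
      refine Free.linear_ext (fun n v => ?_) fun x a n _ e => ?_
      · rw [hg_var, ← hg'f, LinearMap.comp_apply, capMap_var]
      · rw [hg'.op, hg_op]
        simp only [e]

lemma IsDGHom.id {P : OperadData F} {A : Type u} [AddCommGroup A] [Module F A]
    (X : GradedOps P A) (d : A →ₗ[F] A) : IsDGHom X d X d LinearMap.id :=
  ⟨fun _ _ h => h, fun _ _ => rfl, fun _ => rfl⟩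

lemma IsDGHom.comp {P : OperadData F} {A B C : Type u} [AddCommGroup A] [Module F A]
    [AddCommGroup B] [Module F B] [AddCommGroup C] [Module F C] {X : GradedOps P A}
    {Y : GradedOps P B} {Z : GradedOps P C} {dX : A →ₗ[F] A} {dY : B →ₗ[F] B} {dZ : C →ₗ[F] C}
    {g : B →ₗ[F] C} {f : A →ₗ[F] B} (hg : IsDGHom Y dY Z dZ g) (hf : IsDGHom X dX Y dY f) :
    IsDGHom X dX Z dZ (g ∘ₗ f) where
  mem n a ha := hg.mem n _ (hf.mem n a ha)
  op x a := by
    rw [LinearMap.comp_apply, hf.op, hg.op]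
    rfl
  d a := by
    rw [LinearMap.comp_apply, hf.d, hg.d]
    rfl

/-- Two loop algebras of the same algebra are isomorphic, in a unique way compatible with the
adjunction units. -/
lemma IsLoopAlgebra.exists_equiv {A B C : Type u} [AddCommGroup A] [Module F A]
    [AddCommGroup B] [Module F B] [AddCommGroup C] [Module F C]
    {X : GradedOps (barrattEccles F) A} {Y : GradedOps (barrattEccles F) B}
    {Z : GradedOps (barrattEccles F) C} {dX : A →ₗ[F] A} {dY : B →ₗ[F] B} {dZ : C →ₗ[F] C}
    {u : A →ₗ[F] B} {v : A →ₗ[F] C} (hY : IsLoopAlgebra X dX Y dY u)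
    (hZ : IsLoopAlgebra X dX Z dZ v) :
    ∃! Ψ : B ≃ₗ[F] C, IsDGHom Y dY Z dZ (Ψ : B →ₗ[F] C) ∧ ∀ x, Ψ (u x) = v x := by
  obtain ⟨f, ⟨hf, hfu⟩, hf_unique⟩ := hY.exists_unique C Z dZ hZ.isDGAlgebra v hZ.isDGHom
  obtain ⟨g, ⟨hg, hgv⟩, -⟩ := hZ.exists_unique B Y dY hY.isDGAlgebra u hY.isDGHom
  have hgf : g ∘ₗ f = LinearMap.id :=
    (hY.exists_unique B Y dY hY.isDGAlgebra u hY.isDGHom).unique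
      ⟨hg.comp hf, by rw [LinearMap.comp_assoc, hfu, hgv]⟩ ⟨.id Y dY, LinearMap.id_comp u⟩
  have hfg : f ∘ₗ g = LinearMap.id :=
    (hZ.exists_unique C Z dZ hZ.isDGAlgebra v hZ.isDGHom).unique
      ⟨hf.comp hg, by rw [LinearMap.comp_assoc, hgv, hfu]⟩ ⟨.id Z dZ, LinearMap.id_comp v⟩
  refine ⟨LinearEquiv.ofLinearMap f g hfg hgf, ⟨hf, fun x => LinearMap.congr_fun hfu x⟩, ?_⟩
  rintro Ψ ⟨hΨ, hΨu⟩
  have := hf_unique Ψ ⟨hΨ, LinearMap.ext hΨu⟩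
  exact LinearEquiv.toLinearMap_injective this

end UniversalProperty

end LoopAlgebra

end

open LoopAlgebra in
/-- Let `E(V) = (E(V), δ)` be an almost free algebra over the reduced Barratt-Eccles operad, with
differential `δ` determined by `h : V → E(V)`.  There are a map `κ : E(V) → Λ^*E(V)` given by the
cap products with the cocycles `ε_r`, and a differential `δ'` which makes `Λ^*E(V)` the almost free
`Λ^*E`-algebra associated to `κ ∘ h`, such that `Σ^*Ω^*E(V)` is isomorphic to `(Λ^*E(V), δ')` as a
`Λ^*E`-algebra, through an isomorphism which identifies the adjunction unit `E(V) → Σ^*Ω^*E(V)`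
with `κ`; in particular it is the identity on the generators `V`. -/
theorem proposition3p9 {F : Type u} [Field F] (V : CochainComplex (ModuleCat.{u} F) ℤ)
    (h : ∀ n : ℤ, V.X n →ₗ[F] Free (barrattEccles F) V)
    (δ : Free (barrattEccles F) V →ₗ[F] Free (barrattEccles F) V)
    (hδ : IsAlmostFreeDifferential h δ) :
    ∃! κ : Free (barrattEccles F) V →ₗ[F] Free (barrattEccles F).suspension V,
      IsCapMap V κ ∧
      ∃! δ' : Free (barrattEccles F).suspension V →ₗ[F] Free (barrattEccles F).suspension V,
        IsAlmostFreeDifferential (fun n => κ ∘ₗ h n) δ' ∧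
        (freeAlgebra (barrattEccles F).suspension V).IsDGAlgebra δ' ∧
        (∃ (B : Type u) (_ : AddCommGroup B) (_ : Module F B)
          (Y : GradedOps (barrattEccles F) B) (dY : B →ₗ[F] B)
          (η : Free (barrattEccles F) V →ₗ[F] B),
          IsLoopAlgebra (freeAlgebra (barrattEccles F) V) δ Y dY η) ∧
        ∀ (B : Type u) [AddCommGroup B] [Module F B]
          (Y : GradedOps (barrattEccles F) B) (dY : B →ₗ[F] B)
          (η : Free (barrattEccles F) V →ₗ[F] B),
          IsLoopAlgebra (freeAlgebra (barrattEccles F) V) δ Y dY η →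
          ∃! Ψ : B ≃ₗ[F] Free (barrattEccles F).suspension V,
            IsDGHom Y.suspension dY (freeAlgebra (barrattEccles F).suspension V) δ'
              (Ψ : B →ₗ[F] Free (barrattEccles F).suspension V) ∧
            ∀ x : Free (barrattEccles F) V, Ψ (η x) = κ x := by
  refine ⟨capMap V, ⟨capMap_isCapMap V, capDifferential hδ, ⟨capDifferential_isAlmostFree hδ,
    capDifferential_isDGAlgebra hδ, ⟨_, _, _, loopFree V, capDifferential hδ, capMap V,
      loopFree_isLoopAlgebra hδ⟩, ?_⟩, ?_⟩, fun κ hκ => hκ.1.eq_capMap⟩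
  · intro B _ _ Y dY η hY
    have := hY.exists_equiv (loopFree_isLoopAlgebra hδ)
    simp only [← isDGHom_suspension_iff (X := Y), loopFree_suspension] at this
    exact this
  · rintro δ' ⟨hδ', -⟩
    refine Free.derivation_ext hδ'.isDifferential.isDerivation (capDifferential_isDerivation hδ)
      fun n v => ?_
    rw [hδ'.var, capDifferential_var]
    rfl
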